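/- Let $\mathbb S^1=\mathbb R/\mathbb Z$ and let $f:\mathbb S^1\times\mathbb R\to\mathbb R$ be smooth and proper. Let $(B^1,B^0)$ be either $(C^1(\mathbb S^1),C^0(\mathbb S^1))$ or $(H^1(\mathbb S^1),L^2(\mathbb S^1))$ (real-valued functions), let $F:B^1\to B^0$ be $F(u)(t)=u'(t)+f(t,u(t))$, and let $\Sigma_1:B^1\to\mathbb R$ be $\Sigma_1(u)=\int_{\mathbb S^1}\frac{\partial f}{\partial x}(t,u(t))\,dt$, where $\frac{\partial f}{\partial x}$ is the derivative of $f$ in its second variable. A critical point (singularity) of $F$ is a $u\in B^1$ at which $DF(u)$ is not surjective. It is a fold if there are a Banach space $X$ and smooth local coordinates near $u$ and near $F(u)$, with values in $X\times\mathbb R$, in which $F$ takes the form $(x,y)\mapsto(x,\mu(x,y))$ with $\mu$ smooth and, at the point corresponding to $u$, $\partial_y\mu=0$ and $\partial_y^2\mu\neq0$. Suppose that $0$ is a regular value of $\Sigma_1$, that $F$ has at least one critical point, and that every critical point of $F$ is a fold. Then $F$ is a (smooth) global fold: with $\tilde B^0=\{v\in B^0:\int_{\mathbb S^1} v=0\}$,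 there are $C^\infty$ diffeomorphisms $\Xi_1:B^1\to\mathbb R\times\tilde B^0$ and $\Xi_0:B^0\to\mathbb R\times\tilde B^0$ such that $$(\Xi_0\circ F\circ\Xi_1^{-1})(x,\tilde v)=(x^2,\tilde v)\qquad\text{for all }(x,\tilde v)\in\mathbb R\times\tilde B^0.$$ -/

import Mathlib

open MeasureTheory Set
open scoped ContDiff

namespace PeriodicFirstOrder

noncomputable section

/-! ### Regular values, critical points, folds and global folds of maps of normed spaces -/

section General

variable {E F : Type} [NormedAddCommGroup E] [NormedSpace ℝ E]
  [NormedAddCommGroup F] [NormedSpace ℝ F]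

/-- `c` is a regular value of `G`: the derivative of `G` is onto at every point of the level `c`. -/
def IsRegularValue (G : E → F) (c : F) : Prop :=
  ∀ u, G u = c → Function.Surjective (fderiv ℝ G u)

/-- `u` is a critical point (a singularity) of `G`: the derivative of `G` at `u` is not onto. -/
def IsCriticalPoint (G : E → F) (u : E) : Prop :=
  ¬ Function.Surjective (fderiv ℝ G u)

/-- `u₀` is a fold of `G` (a Morin singularity of order one): in suitable smooth local coordinates
`α` around `u₀` and `β` around `G u₀`, with values in `X × ℝ` for a Banach space `X`, the map has
the adapted form `(x, y) ↦ (x, μ (x, y))` with `μ` smooth, and, at the point that corresponds to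
`u₀`, the first derivative of `μ` in `y` vanishes and the second one does not. -/
def IsFold (G : E → F) (u₀ : E) : Prop :=
  ∃ (X : Type) (_ : NormedAddCommGroup X) (_ : NormedSpace ℝ X) (_ : CompleteSpace X)
    (α : OpenPartialHomeomorph E (X × ℝ)) (β : OpenPartialHomeomorph F (X × ℝ)) (μ : X × ℝ → ℝ),
    u₀ ∈ α.source ∧ MapsTo G α.source β.source ∧
    ContDiffOn ℝ ∞ α α.source ∧ ContDiffOn ℝ ∞ α.symm α.target ∧
    ContDiffOn ℝ ∞ β β.source ∧ ContDiffOn ℝ ∞ β.symm β.target ∧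
    ContDiffOn ℝ ∞ μ α.target ∧
    (∀ p ∈ α.target, β (G (α.symm p)) = (p.1, μ p)) ∧
    deriv (fun y => μ ((α u₀).1, y)) (α u₀).2 = 0 ∧
    iteratedDeriv 2 (fun y => μ ((α u₀).1, y)) (α u₀).2 ≠ 0

/-- `G : E → F` is a (smooth) global fold with parameter space `X`: smooth global diffeomorphisms
`Ξ₁ : E → ℝ × X` and `Ξ₀ : F → ℝ × X` conjugate it to `(x, v) ↦ (x ^ 2, v)`. -/
def IsGlobalFold (X : Type) [NormedAddCommGroup X] [NormedSpace ℝ X] (G : E → F) : Prop :=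
  ∃ (Ξ₁ : E ≃ ℝ × X) (Ξ₀ : F ≃ ℝ × X),
    ContDiff ℝ ∞ Ξ₁ ∧ ContDiff ℝ ∞ Ξ₁.symm ∧ ContDiff ℝ ∞ Ξ₀ ∧ ContDiff ℝ ∞ Ξ₀.symm ∧
    ∀ (x : ℝ) (v : X), Ξ₀ (G (Ξ₁.symm (x, v))) = (x ^ 2, v)

end General

/-! ### Function spaces on the circle `ℝ / ℤ` -/

/-- `C⁰(S¹)`, with the supremum norm. -/
abbrev C0 : Type := C(UnitAddCircle, ℝ)

/-- `H⁰(S¹) = L²(S¹)`. -/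
abbrev H0 : Type := Lp ℝ 2 (volume : Measure UnitAddCircle)

lemma integrable_C0 (u : C0) : Integrable (fun t => u t) (volume : Measure UnitAddCircle) :=
  u.continuous.integrable_of_hasCompactSupport (HasCompactSupport.of_compactSpace _)

lemma integrable_H0 (v : H0) : Integrable (fun t => v t) (volume : Measure UnitAddCircle) :=
  (Lp.memLp v).integrable (by norm_num)

lemma ae_Ioc {P : UnitAddCircle → Prop} (h : ∀ᵐ t ∂(volume : Measure UnitAddCircle), P t) :
    ∀ᵐ s : ℝ ∂(volume.restrict (Ioc (0 : ℝ) 1)), P (s : UnitAddCircle) := by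
  have := (UnitAddCircle.measurePreserving_mk 0).quasiMeasurePreserving.ae h
  simpa using this

lemma intervalIntegrable_H0 (v : H0) {t : ℝ} (ht : t ∈ Icc (0 : ℝ) 1) :
    IntervalIntegrable (fun s : ℝ => v (s : UnitAddCircle)) volume 0 t := by
  rw [intervalIntegrable_iff_integrableOn_Ioc_of_le ht.1]
  have h := (UnitAddCircle.measurePreserving_mk 0).integrable_comp_of_integrable (integrable_H0 v)
  rw [zero_add] at h
  exact IntegrableOn.mono_set h (Ioc_subset_Ioc_right ht.2)

lemma ae_interval {P : UnitAddCircle → Prop}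
    (h : ∀ᵐ t ∂(volume : Measure UnitAddCircle), P t) {t : ℝ} (ht : t ∈ Icc (0 : ℝ) 1) :
    ∀ᵐ s : ℝ, s ∈ uIoc 0 t → P (s : UnitAddCircle) := by
  rw [uIoc_of_le ht.1]
  filter_upwards [(ae_restrict_iff' measurableSet_Ioc).1 (ae_Ioc h)] with s hs hst
  exact hs (Ioc_subset_Ioc_right ht.2 hst)

/-- `C¹(S¹)`: the pairs `(u, u')` of continuous periodic functions, the second of which is the
derivative of the first. The norm is `max (sup |u|) (sup |u'|)`. -/
def C1 : Submodule ℝ (C0 × C0) where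
  carrier := {p | ∀ s : ℝ, HasDerivAt (fun r : ℝ => p.1 (r : UnitAddCircle)) (p.2 s) s}
  zero_mem' := fun s => hasDerivAt_const s (0 : ℝ)
  add_mem' := fun hp hq s => (hp s).add (hq s)
  smul_mem' := fun c _ hp s => (hp s).const_mul c

/-- `H¹(S¹)`: the pairs `(u, u')` with `u` continuous and periodic and `u'` in `L²(S¹)`, such that
`u` is an indefinite integral of `u'`, i.e. `u` is absolutely continuous with derivative `u'` almost
everywhere. The norm is `max (sup |u|) ‖u'‖_{L²}`; by `H1.norm_le` and `H1.le_norm` it is equivalent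
to the Hilbert norm `(‖u‖_{L²} ^ 2 + ‖u'‖_{L²} ^ 2) ^ (1 / 2)`. -/
def H1 : Submodule ℝ (C0 × H0) where
  carrier := {p | ∀ t ∈ Icc (0 : ℝ) 1,
    p.1 (t : UnitAddCircle) = p.1 0 + ∫ s in (0 : ℝ)..t, p.2 (s : UnitAddCircle)}
  zero_mem' := fun t ht => by
    change (0 : ℝ) = 0 + ∫ s in (0 : ℝ)..t, (0 : H0) (s : UnitAddCircle)
    rw [intervalIntegral.integral_congr_ae (ae_interval (Lp.coeFn_zero ℝ 2 volume) ht)]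
    simp
  add_mem' := fun {p q} hp hq t ht => by
    have h := intervalIntegral.integral_congr_ae (ae_interval (Lp.coeFn_add p.2 q.2) ht)
    simp only [Pi.add_apply] at h
    rw [intervalIntegral.integral_add (intervalIntegrable_H0 p.2 ht)
      (intervalIntegrable_H0 q.2 ht)] at h
    change p.1 t + q.1 t = (p.1 0 + q.1 0) + ∫ s in (0 : ℝ)..t, (p.2 + q.2) (s : UnitAddCircle)
    rw [h, hp t ht, hq t ht]
    ring
  smul_mem' := fun c p hp t ht => by
    have h := intervalIntegral.integral_congr_ae (ae_interval (Lp.coeFn_smul c p.2) ht)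
    simp only [Pi.smul_apply, smul_eq_mul, intervalIntegral.integral_const_mul] at h
    change c * p.1 t = c * p.1 0 + ∫ s in (0 : ℝ)..t, (c • p.2) (s : UnitAddCircle)
    rw [h, hp t ht]
    ring

/-- The inclusion of `C⁰(S¹)` in `L²(S¹)`. -/
def toH0 (u : C0) : H0 := ContinuousMap.toLp 2 volume ℝ u

lemma norm_toH0_le (u : C0) : ‖toH0 u‖ ≤ ‖u‖ := by
  have h1 : ‖(ContinuousMap.toLp 2 volume ℝ : C0 →L[ℝ] H0)‖ ≤ 1 := by
    refine (ContinuousMap.toLp_norm_le (p := 2) (𝕜 := ℝ) (μ := volume)).trans ?_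
    simp [measureUnivNNReal]
  exact (ContinuousLinearMap.le_of_opNorm_le _ h1 u).trans_eq (one_mul _)

lemma isProbabilityMeasure_circle : IsProbabilityMeasure (volume : Measure UnitAddCircle) :=
  ⟨by simp⟩

lemma integral_abs_le (v : H0) : ∫ t, |v t| ≤ ‖v‖ := by
  have := isProbabilityMeasure_circle
  have h1 := eLpNorm_le_eLpNorm_of_exponent_le (p := 1) (q := 2) (by norm_num)
    (Lp.aestronglyMeasurable v)
  have h2 := ENNReal.toReal_mono (Lp.eLpNorm_ne_top v) h1
  rw [← Lp.norm_def] at h2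
  refine le_trans (le_of_eq ?_) h2
  rw [eLpNorm_one_eq_lintegral_enorm, ← integral_norm_eq_lintegral_enorm
    (Lp.aestronglyMeasurable v)]
  rfl

lemma H1.le_norm (u : H1) : √(‖toH0 u.1.1‖ ^ 2 + ‖u.1.2‖ ^ 2) ≤ 2 * ‖u‖ := by
  have h1 : ‖toH0 u.1.1‖ ≤ ‖u‖ := (norm_toH0_le _).trans (norm_fst_le u.1)
  have h2 : ‖u.1.2‖ ≤ ‖u‖ := norm_snd_le u.1
  refine Real.sqrt_le_iff.2 ⟨by positivity, ?_⟩
  nlinarith [norm_nonneg (toH0 u.1.1), norm_nonneg u.1.2, norm_nonneg u]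

lemma H1.norm_le (u : H1) : ‖u‖ ≤ 3 * √(‖toH0 u.1.1‖ ^ 2 + ‖u.1.2‖ ^ 2) := by
  have key : ∀ a b : ℝ, a ∈ Icc (0 : ℝ) 1 → b ∈ Icc (0 : ℝ) 1 →
      |u.1.1 (a : UnitAddCircle)| ≤ |u.1.1 (b : UnitAddCircle)| + 2 * ‖u.1.2‖ := by
    have hint : ∀ t ∈ Icc (0 : ℝ) 1, |∫ s in (0 : ℝ)..t, u.1.2 (s : UnitAddCircle)| ≤ ‖u.1.2‖ := by
      intro t ht
      have e1 : ∫ s in (0 : ℝ)..1, |u.1.2 (s : UnitAddCircle)| = ∫ t, |u.1.2 t| := by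
        simpa using UnitAddCircle.intervalIntegral_preimage 0 (fun t => |u.1.2 t|)
      have hI := (intervalIntegrable_H0 u.1.2 (t := 1) (by simp)).abs
      calc |∫ s in (0 : ℝ)..t, u.1.2 (s : UnitAddCircle)|
          ≤ ∫ s in (0 : ℝ)..t, |u.1.2 (s : UnitAddCircle)| :=
            intervalIntegral.abs_integral_le_integral_abs ht.1
        _ ≤ ∫ s in (0 : ℝ)..1, |u.1.2 (s : UnitAddCircle)| :=
            intervalIntegral.integral_mono_interval le_rfl ht.1 ht.2
              (Filter.Eventually.of_forall fun _ => abs_nonneg _) hI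
        _ ≤ ‖u.1.2‖ := e1 ▸ integral_abs_le u.1.2
    intro a b ha hb
    have h1 := u.2 a ha
    have h2 := u.2 b hb
    have h3 := abs_le.1 (hint a ha)
    have h4 := abs_le.1 (hint b hb)
    have h5 := abs_le.1 (le_refl |u.1.1 (b : UnitAddCircle)|)
    rw [abs_le]
    constructor <;> linarith [h3.1, h3.2, h4.1, h4.2, h5.1, h5.2]
  have rep : ∀ t : UnitAddCircle, ∃ a ∈ Icc (0 : ℝ) 1, (a : UnitAddCircle) = t := by
    intro t
    have h := (AddCircle.equivIco 1 0 t).2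
    exact ⟨_, ⟨h.1, by linarith [h.2]⟩, AddCircle.coe_equivIco (a := (0 : ℝ)) (p := 1)⟩
  have hL1 : ∫ t, |u.1.1 t| ≤ ‖toH0 u.1.1‖ := by
    refine le_trans (le_of_eq ?_) (integral_abs_le (toH0 u.1.1))
    refine integral_congr_ae ?_
    filter_upwards [ContinuousMap.coeFn_toLp (p := 2) (𝕜 := ℝ) volume u.1.1] with t ht
    simp only [toH0]
    rw [ht]
  have := isProbabilityMeasure_circle
  have hsup : ‖u.1.1‖ ≤ ‖toH0 u.1.1‖ + 2 * ‖u.1.2‖ := by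
    rw [ContinuousMap.norm_le _ (by positivity)]
    intro t
    have hpt : ∀ r, |u.1.1 t| ≤ |u.1.1 r| + 2 * ‖u.1.2‖ := by
      intro r
      obtain ⟨a, ha, rfl⟩ := rep t
      obtain ⟨b, hb, rfl⟩ := rep r
      exact key a b ha hb
    have h := integral_mono (μ := (volume : Measure UnitAddCircle)) (integrable_const |u.1.1 t|)
      ((integrable_C0 u.1.1).abs.add (integrable_const (2 * ‖u.1.2‖))) hpt
    rw [integral_add' (integrable_C0 u.1.1).abs (integrable_const _)] at h
    simp only [integral_const, probReal_univ, one_smul] at h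
    rw [Real.norm_eq_abs]
    linarith
  have h1 : ‖toH0 u.1.1‖ ≤ √(‖toH0 u.1.1‖ ^ 2 + ‖u.1.2‖ ^ 2) :=
    Real.le_sqrt_of_sq_le (by nlinarith [sq_nonneg ‖u.1.2‖])
  have h2 : ‖u.1.2‖ ≤ √(‖toH0 u.1.1‖ ^ 2 + ‖u.1.2‖ ^ 2) :=
    Real.le_sqrt_of_sq_le (by nlinarith [sq_nonneg ‖toH0 u.1.1‖])
  change max ‖u.1.1‖ ‖u.1.2‖ ≤ _
  refine max_le (by linarith) (by linarith [norm_nonneg u.1.2])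

/-- The continuous functions of average zero. -/
def C0tilde : Submodule ℝ C0 where
  carrier := {v | ∫ t, v t = 0}
  zero_mem' := by simp
  add_mem' := fun {v w} hv hw => by
    change ∫ t, (v t + w t) = 0
    rw [integral_add (integrable_C0 v) (integrable_C0 w), mem_ofPred.1 hv, mem_ofPred.1 hw, add_zero]
  smul_mem' := fun c v hv => by
    change ∫ t, c * v t = 0
    rw [integral_const_mul, mem_ofPred.1 hv, mul_zero]

/-- The square integrable functions of average zero. -/
def H0tilde : Submodule ℝ H0 where
  carrier := {v | ∫ t, v t = 0}
  zero_mem' := by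
    change ∫ t, (0 : H0) t = 0
    rw [integral_congr_ae (Lp.coeFn_zero ℝ 2 volume)]
    simp
  add_mem' := fun {v w} hv hw => by
    change ∫ t, (v + w) t = 0
    rw [integral_congr_ae (Lp.coeFn_add v w),
      integral_add' (integrable_H0 v) (integrable_H0 w), mem_ofPred.1 hv, mem_ofPred.1 hw, add_zero]
  smul_mem' := fun c v hv => by
    change ∫ t, (c • v) t = 0
    rw [integral_congr_ae (Lp.coeFn_smul c v)]
    simp only [Pi.smul_apply, smul_eq_mul]
    rw [integral_const_mul, mem_ofPred.1 hv, mul_zero]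

/-! ### The operator `F (u) = u' + f (t, u)` and the functional `Σ₁` -/

/-- `f : S¹ × ℝ → ℝ` is smooth: its lift to `ℝ × ℝ` (periodic in the first variable) is `C^∞`. -/
def IsSmooth (f : C(UnitAddCircle × ℝ, ℝ)) : Prop :=
  ContDiff ℝ ∞ fun p : ℝ × ℝ => f ((p.1 : UnitAddCircle), p.2)

/-- The function `t ↦ f (t, u (t))`. -/
def nemytskii (f : C(UnitAddCircle × ℝ, ℝ)) (u : C0) : C0 :=
  ⟨fun t => f (t, u t), by fun_prop⟩

/-- `F : C¹(S¹) → C⁰(S¹)`, `F (u) = u' + f (t, u)`. -/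
def operatorC (f : C(UnitAddCircle × ℝ, ℝ)) (u : C1) : C0 :=
  u.1.2 + nemytskii f u.1.1

/-- `F : H¹(S¹) → L²(S¹)`, `F (u) = u' + f (t, u)`. -/
def operatorH (f : C(UnitAddCircle × ℝ, ℝ)) (u : H1) : H0 :=
  u.1.2 + toH0 (nemytskii f u.1.1)

/-- `Σ₁ (u) = ∫ D₂ f (t, u (t)) dt`. -/
def sigma1 (f : C(UnitAddCircle × ℝ, ℝ)) (u : C0) : ℝ :=
  ∫ t : UnitAddCircle, deriv (fun x : ℝ => f (t, x)) (u t)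

end

end PeriodicFirstOrder

open PeriodicFirstOrder

namespace PeriodicFirstOrder

noncomputable section

/-! ### Averages and periodic primitives -/

/-! The problem reduces to a family of functions of one real variable. Let `prim v` be the periodic
primitive of `v` minus its average, vanishing at `0`. Integrating `u' + f (t, u) = v` gives `u +
prim (f (t, u)) = u 0 + J v`, where `J` extends `prim`, together with the scalar equation that `f
(t, u)` and `v` have the same average. The map `psi f : u ↦ u + prim (f (t, u))` is a smooth
diffeomorphism of `C⁰`. Its derivatives are invertible by the Fredholm alternative and an
integrating factor, so its range is open, and properness of `f` together with compactness of `prim`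
makes the range closed. With `x = u 0` and `q` the part of `F u` of average zero as coordinates, `F`
becomes `(x, q) ↦ (avg (J q + x), q)`, where `avg V` is the average of `f (t, u)` for the solution
of `psi f u = V`.

On a fibre `x ↦ avg (V + x)` the derivative is `exp (Σ₁ u) - 1` divided by a positive weight, so
critical points are the zeros of `Σ₁`. There the second derivative is a positive multiple of `Σ₂ =
sigma2`. A fold cannot be stationary to second order along an immersed curve
(`IsFold.not_isLittleO`), hence `Σ₂ ≠ 0` at every critical point.

The central fact is that `Σ₂` has the same sign at all critical points. Critical points `u₀`, `u₁`
with opposite signs, which may be taken `C¹`, are joined by `u₀ + Θ (u₁ - u₀)`, where `Θ` oscillates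
rapidly and is close to a characteristic function of growing measure. Averages along the path are
then almost linear interpolations of those at the ends, so `Σ₁` stays near zero, and a small
correction in a direction in which `Σ₁` increases makes it vanish exactly. The intermediate value
theorem gives a common zero of `Σ₁` and `Σ₂` (`exists_common_zero`), a contradiction.

So, up to a global sign, every critical point of every fibre function is a strict local minimum, and
each fibre has at most one. A fibre that has one is bounded below. Since `avg V` is a value of `f
(t, V t)` and `f` is proper, `±f` is then positive far out, and all fibre functions tend to infinity
at both ends. Each therefore has exactly one nondegenerate minimum. Taylor's formula with a smooth
remainder and a square root turn the family into `x ^ 2` (`exists_square_coordinates`). `C¹` and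
`H¹` are two instances of `isGlobalFold_operator`. -/

lemma exists_coe_eq (t : UnitAddCircle) : ∃ s ∈ Icc (0 : ℝ) 1, (s : UnitAddCircle) = t := by
  obtain ⟨s, hs, rfl⟩ := AddCircle.eq_coe_Ico t
  exact ⟨s, ⟨hs.1, hs.2.le⟩, rfl⟩

lemma coe_one_eq_zero : ((1 : ℝ) : UnitAddCircle) = 0 := AddCircle.coe_period 1

lemma coe_zero_eq : ((0 : ℝ) : UnitAddCircle) = 0 := rfl

lemma C0_ext {u v : C0} (h : ∀ s ∈ Icc (0 : ℝ) 1, u (s : UnitAddCircle) = v s) : u = v := by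
  ext t
  obtain ⟨s, hs, rfl⟩ := exists_coe_eq t
  exact h s hs

lemma continuous_coe_comp (u : C0) : Continuous (fun s : ℝ => u (s : UnitAddCircle)) :=
  u.continuous.comp (AddCircle.continuous_mk' 1)

lemma intervalIntegral_circle (v : UnitAddCircle → ℝ) :
    ∫ s in (0 : ℝ)..1, v (s : UnitAddCircle) = ∫ t, v t := by
  simpa using UnitAddCircle.intervalIntegral_preimage 0 v

lemma intervalIntegrable_lift (v : H0) (a b : ℝ) :
    IntervalIntegrable (fun s : ℝ => v (s : UnitAddCircle)) volume a b := by
  have hp : Function.Periodic (fun s : ℝ => v (s : UnitAddCircle)) 1 := fun s => by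
    simp only [AddCircle.coe_add, coe_one_eq_zero, add_zero]
  exact hp.intervalIntegrable₀ one_ne_zero (intervalIntegrable_H0 v (by simp)) a b

/-- The average of a square integrable function. -/
def meanH : H0 →L[ℝ] ℝ :=
  LinearMap.mkContinuous
    { toFun := fun v => ∫ t, v t
      map_add' := fun v w => by
        rw [integral_congr_ae (Lp.coeFn_add v w),
          integral_add' (integrable_H0 v) (integrable_H0 w)]
      map_smul' := fun c v => by
        rw [integral_congr_ae (Lp.coeFn_smul c v)]
        simp only [Pi.smul_apply, smul_eq_mul, RingHom.id_apply]
        rw [integral_const_mul] } 1 (fun v => by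
      rw [one_mul]
      exact (norm_integral_le_integral_norm _).trans (integral_abs_le v))

lemma meanH_apply (v : H0) : meanH v = ∫ t, v t := rfl

/-- The inclusion of the continuous functions in the square integrable ones. -/
def inclH : C0 →L[ℝ] H0 := ContinuousMap.toLp 2 volume ℝ

lemma inclH_ae (u : C0) : ∀ᵐ t ∂(volume : Measure UnitAddCircle), inclH u t = u t :=
  ContinuousMap.coeFn_toLp (p := 2) (𝕜 := ℝ) volume u

/-- The average of a continuous function. -/
def meanC : C0 →L[ℝ] ℝ := meanH.comp inclH

lemma meanC_apply (u : C0) : meanC u = ∫ t, u t := by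
  change ∫ t, inclH u t = _
  exact integral_congr_ae (inclH_ae u)

lemma meanC_eq_interval (u : C0) : meanC u = ∫ s in (0 : ℝ)..1, u (s : UnitAddCircle) := by
  rw [meanC_apply, intervalIntegral_circle]

lemma meanC_one : meanC 1 = 1 := by
  rw [meanC_eq_interval]; simp

lemma abs_meanC_le (u : C0) : |meanC u| ≤ ‖u‖ := by
  rw [meanC_eq_interval]
  have := intervalIntegral.norm_integral_le_of_norm_le_const (a := (0 : ℝ)) (b := 1)
    (f := fun s : ℝ => u (s : UnitAddCircle)) (C := ‖u‖) (fun s _ => u.norm_coe_le_norm _)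
  simpa using this

lemma meanC_mono {u v : C0} (h : ∀ t, u t ≤ v t) : meanC u ≤ meanC v := by
  rw [meanC_apply, meanC_apply]
  exact integral_mono (integrable_C0 u) (integrable_C0 v) h

/-- The primitive, vanishing at the origin, of the oscillation of a function around its average. -/
def primFun (v : H0) (r : ℝ) : ℝ := ∫ s in (0 : ℝ)..r, (v (s : UnitAddCircle) - meanH v)

lemma intervalIntegrable_sub_mean (v : H0) (a b : ℝ) :
    IntervalIntegrable (fun s : ℝ => v (s : UnitAddCircle) - meanH v) volume a b :=
  (intervalIntegrable_lift v a b).sub intervalIntegrable_const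

lemma primFun_eq (v : H0) (r : ℝ) :
    primFun v r = (∫ s in (0 : ℝ)..r, v (s : UnitAddCircle)) - r * meanH v := by
  rw [primFun, intervalIntegral.integral_sub (intervalIntegrable_lift v 0 r)
    intervalIntegrable_const]
  simp

lemma primFun_periodic (v : H0) : Function.Periodic (primFun v) 1 := by
  intro r
  have hp : Function.Periodic (fun s : ℝ => v (s : UnitAddCircle) - meanH v) 1 := fun s => by
    simp only [AddCircle.coe_add, coe_one_eq_zero, add_zero]
  have h1 : primFun v 1 = 0 := by
    rw [primFun_eq, intervalIntegral_circle, ← meanH_apply]; simp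
  rw [primFun, ← intervalIntegral.integral_add_adjacent_intervals
    (intervalIntegrable_sub_mean v 0 r) (intervalIntegrable_sub_mean v r (r + 1)),
    hp.intervalIntegral_add_eq r 0, zero_add]
  change primFun v r + primFun v 1 = _
  rw [h1, add_zero]

lemma continuous_primFun (v : H0) : Continuous (primFun v) :=
  intervalIntegral.continuous_primitive (intervalIntegrable_sub_mean v) 0

/-- The periodic primitive as a continuous function on the circle. -/
def primC (v : H0) : C0 :=
  ⟨(primFun_periodic v).lift, continuous_coinduced_dom.2 (continuous_primFun v)⟩

lemma abs_primFun_le (v : H0) {r : ℝ} (hr : r ∈ Icc (0 : ℝ) 1) : |primFun v r| ≤ 2 * ‖v‖ := by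
  have hI := (intervalIntegrable_H0 v (t := 1) (by simp)).abs
  have h1 : |∫ s in (0 : ℝ)..r, v (s : UnitAddCircle)| ≤ ‖v‖ :=
    calc _ ≤ ∫ s in (0 : ℝ)..r, |v (s : UnitAddCircle)| :=
            intervalIntegral.abs_integral_le_integral_abs hr.1
      _ ≤ ∫ s in (0 : ℝ)..1, |v (s : UnitAddCircle)| :=
            intervalIntegral.integral_mono_interval le_rfl hr.1 hr.2
              (Filter.Eventually.of_forall fun _ => abs_nonneg _) hI
      _ = ∫ t, |v t| := intervalIntegral_circle (fun t => |v t|)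
      _ ≤ ‖v‖ := integral_abs_le v
  have h2 : |meanH v| ≤ ‖v‖ := by
    rw [meanH_apply]
    exact abs_integral_le_integral_abs.trans (integral_abs_le v)
  rw [primFun_eq]
  calc _ ≤ |∫ s in (0 : ℝ)..r, v (s : UnitAddCircle)| + |r * meanH v| := abs_sub _ _
    _ ≤ ‖v‖ + 1 * ‖v‖ := by
        rw [abs_mul, abs_of_nonneg hr.1]
        gcongr
        exact hr.2
    _ = _ := by ring

lemma primFun_add (v w : H0) {r : ℝ} (hr : r ∈ Icc (0 : ℝ) 1) :
    primFun (v + w) r = primFun v r + primFun w r := by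
  rw [primFun_eq, primFun_eq, primFun_eq, map_add,
    intervalIntegral.integral_congr_ae (ae_interval (Lp.coeFn_add v w) hr)]
  simp only [Pi.add_apply]
  rw [intervalIntegral.integral_add (intervalIntegrable_lift v 0 r)
    (intervalIntegrable_lift w 0 r)]
  ring

lemma primFun_smul (c : ℝ) (v : H0) {r : ℝ} (hr : r ∈ Icc (0 : ℝ) 1) :
    primFun (c • v) r = c * primFun v r := by
  rw [primFun_eq, primFun_eq, map_smul,
    intervalIntegral.integral_congr_ae (ae_interval (Lp.coeFn_smul c v) hr)]
  simp only [Pi.smul_apply, smul_eq_mul]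
  rw [intervalIntegral.integral_const_mul]
  ring

/-- The periodic primitive as a continuous linear map `L² → C⁰`. -/
def primH : H0 →L[ℝ] C0 :=
  LinearMap.mkContinuous
    { toFun := primC
      map_add' := fun v w => C0_ext fun _ hs => primFun_add v w hs
      map_smul' := fun c v => C0_ext fun _ hs => primFun_smul c v hs } 2 (fun v => by
    refine (ContinuousMap.norm_le _ (by positivity)).2 fun t => ?_
    obtain ⟨s, hs, rfl⟩ := exists_coe_eq t
    exact abs_primFun_le v hs)

lemma primH_coe (v : H0) (r : ℝ) :
    primH v (r : UnitAddCircle) = (∫ s in (0 : ℝ)..r, v (s : UnitAddCircle)) - r * meanH v :=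
  primFun_eq v r

lemma primH_zero (v : H0) : primH v 0 = 0 := by
  have := primH_coe v 0
  simpa using this

/-- The periodic primitive of a continuous function. -/
def prim : C0 →L[ℝ] C0 := primH.comp inclH

lemma prim_zero (v : C0) : prim v 0 = 0 := primH_zero _

lemma prim_coe (v : C0) {r : ℝ} (hr : r ∈ Icc (0 : ℝ) 1) :
    prim v (r : UnitAddCircle) = ∫ s in (0 : ℝ)..r, (v (s : UnitAddCircle) - meanC v) := by
  change primH (inclH v) r = _
  have hc := continuous_coe_comp v
  rw [primH_coe, intervalIntegral.integral_sub (hc.intervalIntegrable 0 r)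
    intervalIntegrable_const, intervalIntegral.integral_congr_ae (ae_interval (inclH_ae v) hr)]
  simp [meanC]

/-- The formula on `[0, 1]` extends to the line because both sides have period `1`; two-sided
derivatives at integer points need this. -/
lemma prim_coe_real (v : C0) (r : ℝ) :
    prim v (r : UnitAddCircle) = ∫ s in (0 : ℝ)..r, (v (s : UnitAddCircle) - meanC v) := by
  have hp : Function.Periodic (fun s : ℝ => v (s : UnitAddCircle) - meanC v) 1 := fun s => by
    simp only [AddCircle.coe_add, coe_one_eq_zero, add_zero]
  have hc : Continuous (fun s : ℝ => v (s : UnitAddCircle) - meanC v) :=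
    (continuous_coe_comp v).sub continuous_const
  have h0 : ∫ s in (0 : ℝ)..1, (v (s : UnitAddCircle) - meanC v) = 0 := by
    rw [intervalIntegral.integral_sub ((continuous_coe_comp v).intervalIntegrable 0 1)
      intervalIntegrable_const, ← meanC_eq_interval]
    simp
  have h1 : Function.Periodic (fun r : ℝ => ∫ s in (0 : ℝ)..r, (v (s : UnitAddCircle) - meanC v))
      1 := by
    intro r
    simp only
    rw [← intervalIntegral.integral_add_adjacent_intervals (hc.intervalIntegrable 0 r)
      (hc.intervalIntegrable r (r + 1)), hp.intervalIntegral_add_eq r 0, zero_add, h0, add_zero]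
  have h2 : Function.Periodic (fun r : ℝ => prim v (r : UnitAddCircle)) 1 := fun s => by
    simp only [AddCircle.coe_add, coe_one_eq_zero, add_zero]
  have key : ∀ P : ℝ → ℝ, Function.Periodic P 1 → P r = P (Int.fract r) := fun P hP => by
    have := hP.sub_int_mul_eq ⌊r⌋ (x := r)
    rw [← this, Int.fract, mul_one]
  have k1 := key _ h1
  have k2 := key _ h2
  rw [k1, k2]
  exact prim_coe v ⟨Int.fract_nonneg r, (Int.fract_lt_one r).le⟩

lemma hasDerivAt_prim (v : C0) (r : ℝ) :
    HasDerivAt (fun s : ℝ => prim v (s : UnitAddCircle)) (v r - meanC v) r := by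
  have hc : Continuous (fun s : ℝ => v (s : UnitAddCircle) - meanC v) :=
    (continuous_coe_comp v).sub continuous_const
  have := intervalIntegral.integral_hasDerivAt_right (hc.intervalIntegrable 0 r)
    (hc.stronglyMeasurableAtFilter _ _) hc.continuousAt
  simpa only [← prim_coe_real] using this

/-- A continuous function on the circle whose lift has the derivative `n - k` is, up to its value at
the origin, the periodic primitive of `n`, and `k` is the average of `n`. -/
lemma eq_prim_of_hasDerivAt {y n : C0} {k : ℝ}
    (h : ∀ r : ℝ, HasDerivAt (fun s : ℝ => y (s : UnitAddCircle)) (n r - k) r) :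
    k = meanC n ∧ ∀ t, y t = y 0 + prim n t := by
  have hc : Continuous (fun s : ℝ => n (s : UnitAddCircle) - k) :=
    (continuous_coe_comp n).sub continuous_const
  have hi : ∀ r : ℝ, ∫ s in (0 : ℝ)..r, (n (s : UnitAddCircle) - k) = y r - y 0 := fun r =>
    intervalIntegral.integral_eq_sub_of_hasDerivAt (fun s _ => h s) (hc.intervalIntegrable 0 r)
  have hk : k = meanC n := by
    have h1 := hi 1
    rw [coe_one_eq_zero, sub_self, intervalIntegral.integral_sub
      ((continuous_coe_comp n).intervalIntegrable 0 1) intervalIntegrable_const,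
      ← meanC_eq_interval] at h1
    simp at h1
    linarith
  refine ⟨hk, fun t => ?_⟩
  obtain ⟨s, hs, rfl⟩ := exists_coe_eq t
  rw [prim_coe_real, ← hk, hi s]
  ring

/-! ### Compactness of the periodic primitive -/

lemma lipschitzWith_of_lift {u : C0} {K : NNReal}
    (h : ∀ s t : ℝ, |u (s : UnitAddCircle) - u t| ≤ K * |s - t|) : LipschitzWith K u := by
  refine LipschitzWith.of_dist_le_mul fun x y => ?_
  induction x using QuotientAddGroup.induction_on with | _ s
  induction y using QuotientAddGroup.induction_on with | _ t
  -- Shifting `t` by the integer nearest to `s - t` makes the distance on the line equal to the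
  -- distance on the circle.
  have e : ((t + round (s - t) : ℝ) : UnitAddCircle) = t := by
    have : ((round (s - t) : ℝ) : UnitAddCircle) = 0 :=
      (AddCircle.coe_eq_zero_iff 1).2 ⟨round (s - t), by simp⟩
    rw [AddCircle.coe_add, this, add_zero]
  have h1 := h s (t + round (s - t))
  rw [e] at h1
  rw [Real.dist_eq, dist_eq_norm]
  change _ ≤ K * ‖((s - t : ℝ) : UnitAddCircle)‖
  rw [UnitAddCircle.norm_eq, sub_sub]
  exact h1

/-- Arzelà–Ascoli: the common Lipschitz constant gives equicontinuity, and both conditions are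
closed under pointwise convergence inside a compact product of intervals. -/
lemma isCompact_lipschitz (R : ℝ) (K : NNReal) :
    IsCompact {u : C0 | (∀ t, u t ∈ Icc (-R) R) ∧ LipschitzWith K u} := by
  apply ArzelaAscoli.isCompact_of_equicontinuous
  · have e : ContinuousMap.toFun '' {u : C0 | (∀ t, u t ∈ Icc (-R) R) ∧ LipschitzWith K u} =
        {u : UnitAddCircle → ℝ | (∀ t, u t ∈ Icc (-R) R) ∧ LipschitzWith K u} := by
      ext u
      constructor
      · rintro ⟨w, hw, rfl⟩; exact hw
      · intro hu; exact ⟨⟨u, hu.2.continuous⟩, hu, rfl⟩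
    rw [e]
    have hK : IsCompact (univ.pi fun _ : UnitAddCircle => Icc (-R) R) :=
      isCompact_univ_pi fun _ => isCompact_Icc
    refine hK.of_isClosed_subset ?_ (fun u hu t _ => hu.1 t)
    have e2 : {u : UnitAddCircle → ℝ | (∀ t, u t ∈ Icc (-R) R) ∧ LipschitzWith K u} =
      (⋂ t, {u | u t ∈ Icc (-R) R}) ∩
        ⋂ s, ⋂ t, {u : UnitAddCircle → ℝ | dist (u s) (u t) ≤ K * dist s t} := by
      ext u
      simp [lipschitzWith_iff_dist_le_mul]
    rw [e2]
    refine (isClosed_iInter fun t => ?_).inter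
      (isClosed_iInter fun s => isClosed_iInter fun t => ?_)
    · exact isClosed_Icc.preimage (continuous_apply t)
    · exact isClosed_le ((continuous_apply s).dist (continuous_apply t)) continuous_const
  · exact (LipschitzWith.uniformEquicontinuous _ K fun u => u.2.2).equicontinuous

lemma lipschitzWith_prim {v : C0} {K : NNReal} (h : ∀ t, |v t - meanC v| ≤ K) :
    LipschitzWith K (prim v) := by
  refine lipschitzWith_of_lift fun s t => ?_
  have := Convex.norm_image_sub_le_of_norm_hasDerivWithin_le (s := univ) (C := K) (x := t) (y := s)
    (fun x _ => (hasDerivAt_prim v x).hasDerivWithinAt) (fun x _ => h x) convex_univ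
    (mem_univ _) (mem_univ _)
  simpa using this

/-- The derivative of `prim v` is `v - meanC v`, of norm at most `2 ‖v‖`, so the unit ball is sent
to bounded functions with Lipschitz constant `2`. -/
lemma isCompactOperator_prim : IsCompactOperator prim := by
  refine (isCompactOperator_iff_image_closedBall_subset_compact (𝕜₁ := ℝ)
    (f := (prim : C0 →ₗ[ℝ] C0)) zero_lt_one).2 ⟨_, isCompact_lipschitz ‖prim‖ 2, ?_⟩
  rintro _ ⟨v, hv, rfl⟩
  have hv : ‖v‖ ≤ 1 := by simpa using hv
  refine ⟨fun t => abs_le.1 ?_, lipschitzWith_prim fun t => ?_⟩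
  · calc |prim v t| ≤ ‖prim v‖ := (prim v).norm_coe_le_norm t
      _ ≤ ‖prim‖ * ‖v‖ := prim.le_opNorm v
      _ ≤ ‖prim‖ * 1 := by gcongr
      _ = _ := mul_one _
  · calc |v t - meanC v| ≤ |v t| + |meanC v| := abs_sub _ _
      _ ≤ ‖v‖ + ‖v‖ := add_le_add (v.norm_coe_le_norm t) (abs_meanC_le v)
      _ ≤ 1 + 1 := by gcongr
      _ = _ := by norm_num

/-! ### The derivative in the second variable and the Nemytskii operator -/

/-- Continuity on `S¹ × ℝ` can thus be tested on lifts to `ℝ × ℝ`, where smoothness of `f` is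
defined. -/
lemma isOpenQuotientMap_coe_prod :
    IsOpenQuotientMap (fun p : ℝ × ℝ => ((p.1 : UnitAddCircle), p.2)) :=
  IsOpenQuotientMap.prodMap (QuotientAddGroup.isOpenQuotientMap_mk) IsOpenQuotientMap.id

lemma IsSmooth.hasDerivAt {f : C(UnitAddCircle × ℝ, ℝ)} (hf : IsSmooth f) (s x : ℝ) :
    HasDerivAt (fun x : ℝ => f ((s : UnitAddCircle), x))
      (fderiv ℝ (fun p : ℝ × ℝ => f ((p.1 : UnitAddCircle), p.2)) (s, x) (0, 1)) x := by
  have h1 : HasFDerivAt (fun p : ℝ × ℝ => f ((p.1 : UnitAddCircle), p.2))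
      (fderiv ℝ (fun p : ℝ × ℝ => f ((p.1 : UnitAddCircle), p.2)) (s, x)) (s, x) :=
    (ContDiff.differentiable hf (by simp)).differentiableAt.hasFDerivAt
  have h2 : HasDerivAt (fun x : ℝ => ((s, x) : ℝ × ℝ)) (0, 1) x :=
    (hasDerivAt_const x s).prodMk (hasDerivAt_id x)
  exact h1.comp_hasDerivAt x h2

/-- The derivative of a smooth function on `S¹ × ℝ` in the second variable. -/
def partialX (f : C(UnitAddCircle × ℝ, ℝ)) (hf : IsSmooth f) : C(UnitAddCircle × ℝ, ℝ) where
  toFun p := deriv (fun x : ℝ => f (p.1, x)) p.2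
  continuous_toFun := by
    refine isOpenQuotientMap_coe_prod.isQuotientMap.continuous_iff.2 ?_
    have e : (fun p : UnitAddCircle × ℝ => deriv (fun x : ℝ => f (p.1, x)) p.2) ∘
        (fun p : ℝ × ℝ => ((p.1 : UnitAddCircle), p.2)) =
        fun p => fderiv ℝ (fun p : ℝ × ℝ => f ((p.1 : UnitAddCircle), p.2)) p (0, 1) := by
      ext ⟨s, x⟩
      exact (hf.hasDerivAt s x).deriv
    rw [e]
    exact ((ContDiff.continuous_fderiv hf (by simp)).clm_apply continuous_const)

variable {f : C(UnitAddCircle × ℝ, ℝ)}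

lemma partialX_apply (hf : IsSmooth f) (t : UnitAddCircle) (x : ℝ) :
    partialX f hf (t, x) = deriv (fun x : ℝ => f (t, x)) x := rfl

lemma hasDerivAt_partialX (hf : IsSmooth f) (t : UnitAddCircle) (x : ℝ) :
    HasDerivAt (fun x : ℝ => f (t, x)) (partialX f hf (t, x)) x := by
  induction t using QuotientAddGroup.induction_on with | _ s
  rw [partialX_apply]
  exact (hf.hasDerivAt s x).differentiableAt.hasDerivAt

lemma isSmooth_partialX (hf : IsSmooth f) : IsSmooth (partialX f hf) := by
  have e : (fun p : ℝ × ℝ => partialX f hf ((p.1 : UnitAddCircle), p.2)) =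
        fun p => fderiv ℝ (fun p : ℝ × ℝ => f ((p.1 : UnitAddCircle), p.2)) p (0, 1) := by
    ext ⟨s, x⟩
    exact (hf.hasDerivAt s x).deriv
  rw [IsSmooth, e]
  exact (ContDiff.fderiv_right hf (m := ∞) (by simp)).clm_apply contDiff_const

lemma continuous_nemytskii (f : C(UnitAddCircle × ℝ, ℝ)) : Continuous (nemytskii f) := by
  refine ContinuousMap.continuous_of_continuous_uncurry _ ?_
  change Continuous fun p : C0 × UnitAddCircle => f (p.2, p.1 p.2)
  fun_prop

/-- Multiplication by a continuous function, as a continuous linear map. -/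
def mulL : C0 →L[ℝ] C0 →L[ℝ] C0 := ContinuousLinearMap.mul ℝ C0

/-- Mean value inequality at each `t` along the segment from `u` to `u + h`. The bound is uniform in
`t` because the Nemytskii operator of `∂f/∂x` is continuous in the supremum norm. -/
lemma hasFDerivAt_nemytskii (hf : IsSmooth f) (u : C0) :
    HasFDerivAt (nemytskii f) (mulL (nemytskii (partialX f hf) u)) u := by
  rw [hasFDerivAt_iff_isLittleO_nhds_zero, Asymptotics.isLittleO_iff]
  intro ε hε
  have hc := (continuous_nemytskii (partialX f hf)).continuousAt (x := u)
  obtain ⟨δ, hδ, hδu⟩ := Metric.continuousAt_iff.1 hc ε hε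
  filter_upwards [Metric.ball_mem_nhds (0 : C0) hδ] with h hh
  have hh : ‖h‖ < δ := by simpa using hh
  refine (ContinuousMap.norm_le _ (by positivity)).2 fun t => ?_
  have hd : ∀ r ∈ (univ : Set ℝ), HasDerivWithinAt
      (fun r : ℝ => f (t, u t + r * h t) - partialX f hf (t, u t) * (r * h t))
      (partialX f hf (t, u t + r * h t) * h t - partialX f hf (t, u t) * h t) univ r := by
    intro r _
    have h1 : HasDerivAt (fun r : ℝ => r * h t) (h t) r := by
      simpa using (hasDerivAt_id r).mul_const (h t)
    have h2 := (hasDerivAt_partialX hf t (u t + r * h t)).comp r (h1.const_add (u t))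
    exact (h2.sub (h1.const_mul _)).hasDerivWithinAt
  have hb : ∀ r ∈ Icc (0 : ℝ) 1,
      ‖partialX f hf (t, u t + r * h t) * h t - partialX f hf (t, u t) * h t‖ ≤ ε * ‖h‖ := by
    intro r hr
    have h1 : dist (u + r • h) u < δ := by
      rw [dist_eq_norm, add_sub_cancel_left, norm_smul, Real.norm_eq_abs, abs_of_nonneg hr.1]
      calc r * ‖h‖ ≤ 1 * ‖h‖ := by gcongr; exact hr.2
        _ < δ := by rwa [one_mul]
    have h2 := (ContinuousMap.norm_coe_le_norm (nemytskii (partialX f hf) (u + r • h) -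
      nemytskii (partialX f hf) u) t).trans ((dist_eq_norm _ _).symm.le.trans (hδu h1).le)
    rw [← sub_mul, norm_mul]
    have h3 := h.norm_coe_le_norm t
    exact mul_le_mul h2 h3 (norm_nonneg _) hε.le
  have := Convex.norm_image_sub_le_of_norm_hasDerivWithin_le
    (fun r hr => (hd r (mem_univ _)).mono (subset_univ (Icc (0 : ℝ) 1))) hb (convex_Icc 0 1)
    (left_mem_Icc.2 zero_le_one) (right_mem_Icc.2 zero_le_one)
  simp only [one_mul, zero_mul, add_zero, mul_zero, sub_zero, norm_one, mul_one] at this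
  refine le_trans (le_of_eq ?_) this
  change ‖f (t, u t + h t) - f (t, u t) - partialX f hf (t, u t) * h t‖ = _
  ring_nf

/-- The derivative is multiplication by the Nemytskii operator of `∂f/∂x`, which is again smooth;
hence an induction over all `f` at once. -/
lemma contDiff_nemytskii (hf : IsSmooth f) : ContDiff ℝ ∞ (nemytskii f) := by
  refine contDiff_infty.2 fun n => ?_
  induction n generalizing f with
  | zero => exact contDiff_zero.2 (continuous_nemytskii f)
  | succ n ih =>
    refine contDiff_succ_iff_hasFDerivAt.2 ⟨fun u => mulL (nemytskii (partialX f hf) u), ?_,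
      hasFDerivAt_nemytskii hf⟩
    exact (ContinuousLinearMap.contDiff (E := C0) (F := C0 →L[ℝ] C0) mulL).comp
      (ih (isSmooth_partialX hf))

/-! ### A zero with a derivative of prescribed sign -/

/-- If the derivative were positive at every zero, `φ` would be positive just after `a`; but the
next zero is reached from positive values, so the derivative there is at most `0`. -/
lemma exists_zero_deriv_nonpos {φ φ' : ℝ → ℝ} {a b : ℝ} (hab : a < b)
    (hd : ∀ x, HasDerivAt φ (φ' x) x) (ha : φ a = 0) (hb : φ b = 0) :
    ∃ z ∈ Icc a b, φ z = 0 ∧ φ' z ≤ 0 := by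
  by_contra! hcon
  have hcont : Continuous φ := continuous_iff_continuousAt.2 fun x => (hd x).continuousAt
  have hright : ∀ z, 0 < φ' z → φ z = 0 → ∀ᶠ x in nhdsWithin z (Ioi z), 0 < φ x := by
    intro z hz h0
    have h1 := (hasDerivAt_iff_tendsto_slope.1 (hd z)).mono_left
      (nhdsWithin_mono z (fun x (hx : z < x) => hx.ne'))
    filter_upwards [h1.eventually (lt_mem_nhds hz), self_mem_nhdsWithin] with x hx hzx
    rw [slope_def_field, h0, sub_zero] at hx
    exact (div_pos_iff_of_pos_right (sub_pos.2 hzx)).1 hx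
  obtain ⟨y, hy0, hya, hyb⟩ : ∃ y, 0 < φ y ∧ a < y ∧ y < b := by
    have h := (hright a (hcon a (left_mem_Icc.2 hab.le) ha) ha).and
      (Ioo_mem_nhdsGT hab)
    obtain ⟨y, hy⟩ := h.exists
    exact ⟨y, hy.1, hy.2.1, hy.2.2⟩
  let S := {x | x ∈ Icc y b ∧ φ x ≤ 0}
  have hSne : S.Nonempty := ⟨b, ⟨hyb.le, le_rfl⟩, hb.le⟩
  have hSbdd : BddBelow S := ⟨y, fun x hx => hx.1.1⟩
  have hScl : IsClosed S := isClosed_Icc.inter (isClosed_le hcont continuous_const)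
  have hz := hScl.csInf_mem hSne hSbdd
  set z := sInf S
  have hyz : y < z := lt_of_le_of_ne hz.1.1 (fun h => by
    have := hz.2
    rw [← h] at this
    exact this.not_gt hy0)
  have hpos : ∀ x ∈ Ico y z, 0 < φ x := by
    intro x hx
    by_contra! hneg
    exact (csInf_le hSbdd (show x ∈ S from ⟨⟨hx.1, hx.2.le.trans hz.1.2⟩, hneg⟩)).not_gt hx.2
  have hev : ∀ᶠ x in nhdsWithin z (Iio z), 0 < φ x := by
    filter_upwards [Ico_mem_nhdsLT hyz] with x hx using hpos x hx
  have hz0 : φ z = 0 := le_antisymm hz.2 (ge_of_tendsto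
    ((hcont.tendsto z).mono_left (nhdsWithin_le_nhds (s := Iio z))) (hev.mono fun _ => le_of_lt))
  refine (hcon z ⟨hya.le.trans hz.1.1, hz.1.2⟩ hz0).not_ge ?_
  have h1 : Filter.Tendsto (slope φ z) (nhdsWithin z (Iio z)) (nhds (φ' z)) :=
    (hasDerivAt_iff_tendsto_slope.1 (hd z)).mono_left
      (nhdsWithin_mono z (fun x (hx : x < z) => hx.ne))
  refine le_of_tendsto h1 ?_
  filter_upwards [hev, self_mem_nhdsWithin] with x hx hxz
  rw [slope_def_field, hz0, sub_zero]
  exact (div_neg_of_pos_of_neg hx (sub_neg.2 hxz)).le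

lemma exists_zero_deriv_nonneg {φ φ' : ℝ → ℝ} {a b : ℝ} (hab : a < b)
    (hd : ∀ x, HasDerivAt φ (φ' x) x) (ha : φ a = 0) (hb : φ b = 0) :
    ∃ z ∈ Icc a b, φ z = 0 ∧ 0 ≤ φ' z := by
  obtain ⟨z, hz, h0, h1⟩ := exists_zero_deriv_nonpos hab (fun x => (hd x).neg)
    (by simpa using ha) (by simpa using hb)
  exact ⟨z, hz, by simpa using h0, by simpa using h1⟩

/-! ### Smooth maps with invertible derivatives -/

section InverseFunction

variable {E F : Type} [NormedAddCommGroup E] [NormedSpace ℝ E] [CompleteSpace E]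
  [NormedAddCommGroup F] [NormedSpace ℝ F]

lemma isOpenMap_of_invertible_fderiv {Φ : E → F} (hc : ContDiff ℝ ∞ Φ)
    (hd : ∀ x, ∃ L : E ≃L[ℝ] F, HasFDerivAt Φ (L : E →L[ℝ] F) x) : IsOpenMap Φ := by
  refine isOpenMap_iff_nhds_le.2 fun x => ?_
  obtain ⟨L, hL⟩ := hd x
  exact (hc.contDiffAt.hasStrictFDerivAt' hL (by simp)).map_nhds_eq_of_equiv.ge

lemma contDiff_symm_of_invertible_fderiv (e : E ≃ F) (hc : ContDiff ℝ ∞ e)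
    (hd : ∀ x, ∃ L : E ≃L[ℝ] F, HasFDerivAt e (L : E →L[ℝ] F) x) : ContDiff ℝ ∞ e.symm := by
  choose L hL using hd
  exact (e.toHomeomorphOfContinuousOpen hc.continuous
    (isOpenMap_of_invertible_fderiv hc fun x => ⟨L x, hL x⟩)).contDiff_symm hL hc

end InverseFunction

/-! ### Linear equations of the first order -/

/-- The primitive `∫₀ʳ a` on the line. -/
def linePrim (a : C0) (r : ℝ) : ℝ := ∫ s in (0 : ℝ)..r, a (s : UnitAddCircle)

lemma linePrim_zero (a : C0) : linePrim a 0 = 0 := intervalIntegral.integral_same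

lemma linePrim_one (a : C0) : linePrim a 1 = meanC a := (meanC_eq_interval a).symm

lemma hasDerivAt_linePrim (a : C0) (r : ℝ) : HasDerivAt (linePrim a) (a r) r := by
  have hc := continuous_coe_comp a
  exact intervalIntegral.integral_hasDerivAt_right (hc.intervalIntegrable 0 r)
    (hc.stronglyMeasurableAtFilter _ _) hc.continuousAt

lemma continuous_linePrim (a : C0) : Continuous (linePrim a) :=
  continuous_iff_continuousAt.2 fun r => (hasDerivAt_linePrim a r).continuousAt

/-- Integrating factor for `z' + a z = k`. -/
lemma mul_exp_linePrim {a : C0} {z : ℝ → ℝ} {k : ℝ}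
    (hz : ∀ r : ℝ, HasDerivAt z (k - a r * z r) r) (r : ℝ) :
    z r * Real.exp (linePrim a r) = z 0 + k * ∫ s in (0 : ℝ)..r, Real.exp (linePrim a s) := by
  have hd : ∀ s : ℝ, HasDerivAt (fun s => z s * Real.exp (linePrim a s))
      (k * Real.exp (linePrim a s)) s := fun s => by
    refine ((hz s).mul (hasDerivAt_linePrim a s).exp).congr_deriv ?_
    ring
  have hc : Continuous fun s => k * Real.exp (linePrim a s) :=
    continuous_const.mul (Real.continuous_exp.comp (continuous_linePrim a))
  have := intervalIntegral.integral_eq_sub_of_hasDerivAt (a := 0) (b := r) (fun s _ => hd s)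
    (hc.intervalIntegrable 0 r)
  rw [intervalIntegral.integral_const_mul, linePrim_zero, Real.exp_zero] at this
  linarith

/-- `∫₀¹ exp (∫₀ʳ a) dr`. -/
def expWeight (a : C0) : ℝ := ∫ s in (0 : ℝ)..1, Real.exp (linePrim a s)

lemma expWeight_pos (a : C0) : 0 < expWeight a :=
  intervalIntegral.intervalIntegral_pos_of_pos
    ((Real.continuous_exp.comp (continuous_linePrim a)).intervalIntegrable 0 1)
    (fun _ => Real.exp_pos _) zero_lt_one

lemma hasDerivAt_of_add_prim_eq {n y h : C0} {x : ℝ} (e : y + prim n = x • h) (hh : h = 1) (r : ℝ) :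
    HasDerivAt (fun s : ℝ => y (s : UnitAddCircle)) (meanC n - n r) r := by
  have e1 : (fun s : ℝ => y (s : UnitAddCircle)) = fun s : ℝ => x - prim n (s : UnitAddCircle) := by
    ext s
    have := congrArg (fun u : C0 => u s) e
    simp only [hh, ContinuousMap.add_apply, ContinuousMap.smul_apply, ContinuousMap.one_apply,
      smul_eq_mul, mul_one] at this
    linarith
  rw [e1]
  simpa using (hasDerivAt_prim n r).const_sub x

/-- The equation says `z' + a z = k` with `z 0 = 0`. Periodicity gives `k * expWeight a = 0`, so `k
= 0`, and then `z` vanishes everywhere. -/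
lemma eq_zero_of_add_prim_mul {a z : C0} (h : z + prim (a * z) = 0) : z = 0 := by
  have hd : ∀ r : ℝ, HasDerivAt (fun s : ℝ => z (s : UnitAddCircle))
      (meanC (a * z) - a r * z r) r := fun r =>
    hasDerivAt_of_add_prim_eq (x := 0) (h := 1) (by simpa using h) rfl r
  have h0 : z 0 = 0 := by
    have := congrArg (fun u : C0 => u 0) h
    simpa [prim_zero] using this
  have hk := mul_exp_linePrim hd 1
  change _ = _ + _ * expWeight a at hk
  rw [coe_one_eq_zero, coe_zero_eq, h0, zero_mul, zero_add, eq_comm, mul_eq_zero,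
    or_iff_left (expWeight_pos a).ne'] at hk
  refine C0_ext fun s _ => ?_
  have hs := mul_exp_linePrim hd s
  rw [hk, coe_zero_eq, h0, zero_mul, zero_add, mul_eq_zero, or_iff_left (Real.exp_ne_zero _)] at hs
  simpa using hs

/-- `w ↦ w + prim (a w)`. -/
def linOp (a : C0) : C0 →L[ℝ] C0 := ContinuousLinearMap.id ℝ C0 + prim.comp (mulL a)

/-- Fredholm alternative: `w ↦ prim (a w)` is compact and `-1` is not an eigenvalue, so `-1` lies in
the resolvent set. -/
lemma bijective_linOp (a : C0) : Function.Bijective (linOp a) := by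
  have hT : IsCompactOperator (prim.comp (mulL a)) := isCompactOperator_prim.comp_clm (mulL a)
  rcases hT.hasEigenvalue_or_mem_resolventSet (μ := (-1 : ℝ)) (by norm_num) with h | h
  · exfalso
    obtain ⟨w, hw⟩ := h.exists_hasEigenvector
    refine hw.2 (eq_zero_of_add_prim_mul (a := a) ?_)
    have h1 : prim (a * w) = (-1 : ℝ) • w := hw.apply_eq_smul
    rw [h1]
    simp
  · rw [spectrum.mem_resolventSet_iff, ← IsUnit.neg_iff,
      ContinuousLinearMap.isUnit_iff_bijective] at h
    convert h using 2
    ext w : 1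
    simp [linOp, add_comm]

/-- `w ↦ w + prim (a w)` as a continuous linear equivalence. -/
def linEquiv (a : C0) : C0 ≃L[ℝ] C0 :=
  ContinuousLinearEquiv.ofBijective (linOp a) (LinearMap.ker_eq_bot.2 (bijective_linOp a).1)
    (LinearMap.range_eq_top.2 (bijective_linOp a).2)

lemma linEquiv_symm_spec (a h : C0) :
    (linEquiv a).symm h + prim (a * (linEquiv a).symm h) = h :=
  (linEquiv a).apply_symm_apply h

/-! ### The integral form of the equation -/

/-- `u ↦ u + prim (f (t, u))`: the equation `u' + f (t, u) = v + const` in integral form. -/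
def psi (f : C(UnitAddCircle × ℝ, ℝ)) (u : C0) : C0 := u + prim (nemytskii f u)

lemma contDiff_psi (hf : IsSmooth f) : ContDiff ℝ ∞ (psi f) :=
  contDiff_id.add (prim.contDiff.comp (contDiff_nemytskii hf))

lemma hasFDerivAt_psi (hf : IsSmooth f) (u : C0) :
    HasFDerivAt (psi f) (linEquiv (nemytskii (partialX f hf) u) : C0 →L[ℝ] C0) u :=
  (hasFDerivAt_id u).add (prim.hasFDerivAt.comp u (hasFDerivAt_nemytskii hf u))

/-- Mean value theorem in integral form, `a` being the average of `∂f/∂x` over the segment from `v`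
to `u`. It reduces injectivity of `psi f` to the linear equation. -/
lemma nemytskii_sub (hf : IsSmooth f) (u v : C0) :
    ∃ a : C0, nemytskii f u - nemytskii f v = a * (u - v) := by
  have hd : ∀ s : ℝ, HasDerivAt (fun s : ℝ => nemytskii f (v + s • (u - v)))
      (nemytskii (partialX f hf) (v + s • (u - v)) * (u - v)) s := fun s => by
    have h1 : HasDerivAt (fun s : ℝ => v + s • (u - v)) (u - v) s := by
      simpa using ((hasDerivAt_id s).smul_const (u - v)).const_add v
    exact (hasFDerivAt_nemytskii hf _).comp_hasDerivAt s h1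
  have hc : Continuous fun s : ℝ => nemytskii (partialX f hf) (v + s • (u - v)) :=
    (continuous_nemytskii _).comp (by fun_prop)
  refine ⟨∫ s in (0 : ℝ)..1, nemytskii (partialX f hf) (v + s • (u - v)), ?_⟩
  have h2 := intervalIntegral.integral_eq_sub_of_hasDerivAt (a := 0) (b := 1) (fun s _ => hd s)
    ((hc.mul continuous_const).intervalIntegrable 0 1)
  have h3 := (mulL.flip (u - v)).intervalIntegral_comp_comm (hc.intervalIntegrable (0 : ℝ) 1)
    (μ := volume)
  have h4 : nemytskii f (v + (1 : ℝ) • (u - v)) - nemytskii f (v + (0 : ℝ) • (u - v)) =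
    nemytskii f u - nemytskii f v := by simp
  rw [← h4]
  exact h2.symm.trans h3

lemma injective_psi (hf : IsSmooth f) : Function.Injective (psi f) := by
  intro u v h
  obtain ⟨a, ha⟩ := nemytskii_sub hf u v
  refine sub_eq_zero.1 (eq_zero_of_add_prim_mul (a := a) ?_)
  rw [← ha, map_sub]
  have h : u + prim (nemytskii f u) = v + prim (nemytskii f v) := h
  rw [show u - v + (prim (nemytskii f u) - prim (nemytskii f v)) =
    (u + prim (nemytskii f u)) - (v + prim (nemytskii f v)) by abel, h, sub_self]

/-- The average of `f (t, u)` is attained by `f (t, psi f u)`. -/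
lemma exists_meanC_nemytskii_eq (f : C(UnitAddCircle × ℝ, ℝ)) (u : C0) :
    ∃ t, f (t, psi f u t) = meanC (nemytskii f u) := by
  set n := nemytskii f u with hn
  have hd := hasDerivAt_prim n
  have h0 : prim n ((0 : ℝ) : UnitAddCircle) = 0 := prim_zero n
  have h1 : prim n ((1 : ℝ) : UnitAddCircle) = 0 := by rw [coe_one_eq_zero]; exact prim_zero n
  have hz : ∀ r : ℝ, prim n (r : UnitAddCircle) = 0 →
      f (r, psi f u r) = n r := fun r hr => by
    have : psi f u r = u r := by
      change u r + prim n r = u r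
      rw [hr, add_zero]
    rw [this]
    rfl
  -- Where `prim n` vanishes, `psi f u = u`; its derivative is `n` minus the average. Zeros with
  -- derivatives of both signs give values of `f (t, psi f u)` on both sides of the average.
  obtain ⟨r, -, hr0, hr⟩ := exists_zero_deriv_nonpos zero_lt_one hd h0 h1
  obtain ⟨s, -, hs0, hs⟩ := exists_zero_deriv_nonneg zero_lt_one hd h0 h1
  have hc : Continuous fun t => f (t, psi f u t) := by fun_prop
  refine mem_range_of_exists_le_of_exists_ge hc ⟨r, ?_⟩ ⟨s, ?_⟩
  · rw [hz r hr0]; linarith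
  · rw [hz s hs0]; linarith

/-! ### A priori bounds and global inversion of `psi f` -/

lemma exists_bound_nemytskii (f : C(UnitAddCircle × ℝ, ℝ)) (B : ℝ) :
    ∃ M, ∀ u : C0, ‖u‖ ≤ B → ∀ t, |f (t, u t)| ≤ M := by
  have hK : IsCompact ((univ : Set UnitAddCircle) ×ˢ Icc (-B) B) :=
    isCompact_univ.prod isCompact_Icc
  obtain ⟨M, hM⟩ := hK.exists_bound_of_continuousOn f.continuous.continuousOn
  exact ⟨M, fun u hu t => hM (t, u t)
    ⟨mem_univ _, abs_le.1 ((u.norm_coe_le_norm t).trans hu)⟩⟩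

lemma exists_bound_of_proper (hproper : IsProperMap f) (M : ℝ) :
    ∃ R, ∀ t x, |f (t, x)| ≤ M → |x| ≤ R := by
  have hK : IsCompact (f ⁻¹' Icc (-M) M) := hproper.isCompact_preimage isCompact_Icc
  obtain ⟨R, hR⟩ := hK.exists_bound_of_continuousOn (f := fun p : UnitAddCircle × ℝ => p.2)
    continuous_snd.continuousOn
  exact ⟨R, fun t x hx => hR (t, x) (abs_le.1 hx)⟩

/-- The average of `f (t, u)` is a value of `f (t, psi f u)`, hence bounded. At the extrema of `prim
(f (t, u))`, `f (t, u)` equals this average, so properness bounds `u` by some `R` there. Thus `prim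
(f (t, u)) = psi f u - u` is at most `R + B` in absolute value everywhere, and `|u| ≤ R + 2 * B`. -/
lemma exists_bound_psi (hproper : IsProperMap f) (B : ℝ) :
    ∃ R, ∀ u : C0, ‖psi f u‖ ≤ B → ‖u‖ ≤ R := by
  obtain ⟨M, hM⟩ := exists_bound_nemytskii f B
  obtain ⟨R, hR⟩ := exists_bound_of_proper hproper M
  refine ⟨R + 2 * B, fun u hu => ?_⟩
  have hB : 0 ≤ B := (norm_nonneg _).trans hu
  have hR0 : 0 ≤ R + 2 * B := by
    obtain ⟨t, ht⟩ := exists_meanC_nemytskii_eq f u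
    have := (abs_nonneg _).trans (hR t _ (hM _ hu t))
    positivity
  set n := nemytskii f u with hn
  have hext : ∀ r : ℝ, meanC n = n r → |u r| ≤ R := fun r hr => by
    obtain ⟨t, ht⟩ := exists_meanC_nemytskii_eq f u
    refine hR r (u r) ?_
    change |n r| ≤ M
    rw [← hr, ← ht]
    exact hM _ hu t
  have hy : ∀ t, prim n t = psi f u t - u t := fun t => by
    change _ = u t + prim n t - u t
    ring
  have hpsi : ∀ t, |psi f u t| ≤ B := fun t => ((psi f u).norm_coe_le_norm t).trans hu
  obtain ⟨tM, -, htM⟩ := isCompact_univ.exists_isMaxOn univ_nonempty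
    (prim n).continuous.continuousOn
  obtain ⟨tm, -, htm⟩ := isCompact_univ.exists_isMinOn univ_nonempty
    (prim n).continuous.continuousOn
  induction tM using QuotientAddGroup.induction_on with | _ rM
  induction tm using QuotientAddGroup.induction_on with | _ rm
  have h1 : |u (rM : UnitAddCircle)| ≤ R := by
    refine hext rM ?_
    have hloc : IsLocalMax (fun s : ℝ => prim n (s : UnitAddCircle)) rM :=
      Filter.Eventually.of_forall fun s => htM (mem_univ (s : UnitAddCircle))
    have := hloc.hasDerivAt_eq_zero (hasDerivAt_prim n rM)
    linarith
  have h2 : |u (rm : UnitAddCircle)| ≤ R := by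
    refine hext rm ?_
    have hloc : IsLocalMin (fun s : ℝ => prim n (s : UnitAddCircle)) rm :=
      Filter.Eventually.of_forall fun s => htm (mem_univ (s : UnitAddCircle))
    have := hloc.hasDerivAt_eq_zero (hasDerivAt_prim n rm)
    linarith
  refine (ContinuousMap.norm_le _ hR0).2 fun t => ?_
  have h3 : prim n t ≤ prim n rM := htM (mem_univ t)
  have h4 : prim n rm ≤ prim n t := htm (mem_univ t)
  rw [hy, hy] at h3 h4
  have a1 := abs_le.1 h1
  have a2 := abs_le.1 h2
  have a3 := abs_le.1 (hpsi t)
  have a4 := abs_le.1 (hpsi rM)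
  have a5 := abs_le.1 (hpsi rm)
  rw [Real.norm_eq_abs, abs_le]
  change psi f u t - u t ≤ psi f u rM - u rM at h3
  change psi f u rm - u rm ≤ psi f u t - u t at h4
  constructor <;> linarith [a1.1, a1.2, a2.1, a2.2, a3.1, a3.2, a4.1, a4.2, a5.1, a5.2]

/-- If `psi f (u n)` converges, `u n` is bounded, so `prim (f (t, u n))` stays in a compact set. A
subsequence of it converges, and so does that subsequence of `u n`. -/
lemma isClosed_range_psi (hproper : IsProperMap f) : IsClosed (range (psi f)) := by
  refine IsSeqClosed.isClosed fun h h₀ hh hlim => ?_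
  choose u hu using hh
  obtain ⟨B, hB⟩ := (Metric.isBounded_range_of_tendsto h hlim).exists_norm_le
  obtain ⟨R, hR⟩ := exists_bound_psi hproper B
  have huR : ∀ n, ‖u n‖ ≤ R := fun n => hR _ (by rw [hu]; exact hB _ (mem_range_self n))
  obtain ⟨M, hM⟩ := exists_bound_nemytskii f R
  have hM0 : 0 ≤ M := (abs_nonneg _).trans (hM (u 0) (huR 0) 0)
  obtain ⟨K, hK, hKsub⟩ := IsCompactOperator.image_closedBall_subset_compact (𝕜₁ := ℝ)
    (f := (prim : C0 →ₗ[ℝ] C0)) isCompactOperator_prim M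
  have hmem : ∀ n, prim (nemytskii f (u n)) ∈ K := fun n => by
    refine hKsub ⟨nemytskii f (u n), ?_, rfl⟩
    rw [mem_closedBall_zero_iff]
    exact (ContinuousMap.norm_le _ hM0).2 fun t => hM (u n) (huR n) t
  obtain ⟨y, -, φ, hφ, hy⟩ := hK.tendsto_subseq hmem
  have hu' : ∀ n, u n = h n - prim (nemytskii f (u n)) := fun n => by
    rw [← hu n, psi, add_sub_cancel_right]
  have hulim : Filter.Tendsto (u ∘ φ) Filter.atTop (nhds (h₀ - y)) := by
    have := (hlim.comp hφ.tendsto_atTop).sub hy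
    refine this.congr fun n => ?_
    exact (hu' (φ n)).symm
  have hcont : Continuous (psi f) :=
    continuous_id.add (prim.continuous.comp (continuous_nemytskii f))
  refine ⟨h₀ - y, tendsto_nhds_unique ((hcont.tendsto _).comp hulim) ?_⟩
  refine (hlim.comp hφ.tendsto_atTop).congr fun n => ?_
  exact (hu (φ n)).symm

/-- The range is closed, and open by the inverse function theorem, in the connected space `C⁰`. -/
lemma surjective_psi (hf : IsSmooth f) (hproper : IsProperMap f) :
    Function.Surjective (psi f) := by
  have h : IsClopen (range (psi f)) := ⟨isClosed_range_psi hproper,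
    (isOpenMap_of_invertible_fderiv (contDiff_psi hf)
      fun u => ⟨_, hasFDerivAt_psi hf u⟩).isOpen_range⟩
  exact range_eq_univ.1 (h.eq_univ (range_nonempty _))

/-- `psi f` as a bijection. -/
def psiEquiv (hf : IsSmooth f) (hproper : IsProperMap f) : C0 ≃ C0 :=
  Equiv.ofBijective (psi f) ⟨injective_psi hf, surjective_psi hf hproper⟩

lemma psi_symm (hf : IsSmooth f) (hproper : IsProperMap f) (h : C0) :
    psi f ((psiEquiv hf hproper).symm h) = h := (psiEquiv hf hproper).apply_symm_apply h

lemma psi_symm_apply (hf : IsSmooth f) (hproper : IsProperMap f) (u : C0) :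
    (psiEquiv hf hproper).symm (psi f u) = u := (psiEquiv hf hproper).symm_apply_apply u

lemma contDiff_psi_symm (hf : IsSmooth f) (hproper : IsProperMap f) :
    ContDiff ℝ ∞ (psiEquiv hf hproper).symm :=
  contDiff_symm_of_invertible_fderiv _ (contDiff_psi hf) fun u => ⟨_, hasFDerivAt_psi hf u⟩

lemma hasFDerivAt_psi_symm (hf : IsSmooth f) (hproper : IsProperMap f) (h : C0) :
    HasFDerivAt (psiEquiv hf hproper).symm
      ((linEquiv (nemytskii (partialX f hf) ((psiEquiv hf hproper).symm h))).symm : C0 →L[ℝ] C0)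
      h :=
  HasFDerivAt.of_local_left_inverse (contDiff_psi_symm hf hproper).continuous.continuousAt
    (hasFDerivAt_psi hf _) (Filter.Eventually.of_forall fun x => psi_symm hf hproper x)

/-! ### The average as a function of the data, and its derivatives along the constants -/

lemma linePrim_eq (a : C0) (r : ℝ) : linePrim a r = prim a (r : UnitAddCircle) + r * meanC a := by
  rw [prim_coe_real, intervalIntegral.integral_sub ((continuous_coe_comp a).intervalIntegrable 0 r)
    intervalIntegrable_const]
  simp [linePrim]

lemma continuous_expWeight : Continuous expWeight := by
  refine intervalIntegral.continuous_parametric_intervalIntegral_of_continuous' ?_ 0 1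
  have e : (Function.uncurry fun (a : C0) (s : ℝ) => Real.exp (linePrim a s)) =
      fun p : C0 × ℝ => Real.exp (prim p.1 (p.2 : UnitAddCircle) + p.2 * meanC p.1) := by
    ext p
    exact congrArg Real.exp (linePrim_eq p.1 p.2)
  rw [e]
  have h1 : Continuous fun p : C0 × ℝ => prim p.1 (p.2 : UnitAddCircle) :=
    continuous_eval.comp ((prim.continuous.comp continuous_fst).prodMk
      ((AddCircle.continuous_mk' 1).comp continuous_snd))
  exact Real.continuous_exp.comp
    (h1.add (continuous_snd.mul (meanC.continuous.comp continuous_fst)))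

/-- The function `exp (-v)`. -/
def negExp (v : C0) : C0 := ⟨fun t => Real.exp (-v t), by fun_prop⟩

lemma continuous_negExp : Continuous negExp := by
  refine ContinuousMap.continuous_of_continuous_uncurry _ ?_
  change Continuous fun p : C0 × UnitAddCircle => Real.exp (-p.1 p.2)
  fun_prop

lemma sigma1_eq (hf : IsSmooth f) (u : C0) :
    sigma1 f u = meanC (nemytskii (partialX f hf) u) := by
  rw [meanC_apply]
  rfl

/-- The second order functional whose sign decides the type of a critical point. -/
def sigma2 (f : C(UnitAddCircle × ℝ, ℝ)) (hf : IsSmooth f) (u : C0) : ℝ :=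
  meanC (nemytskii (partialX (partialX f hf) (isSmooth_partialX hf)) u *
    negExp (prim (nemytskii (partialX f hf) u)))

lemma continuous_sigma2 (hf : IsSmooth f) : Continuous (sigma2 f hf) :=
  meanC.continuous.comp ((continuous_nemytskii _).mul
    (continuous_negExp.comp (prim.continuous.comp (continuous_nemytskii _))))

lemma hasFDerivAt_sigma1 (hf : IsSmooth f) (u : C0) :
    HasFDerivAt (sigma1 f) (meanC.comp (mulL (nemytskii (partialX (partialX f hf)
      (isSmooth_partialX hf)) u))) u := by
  have e : sigma1 f = fun u => meanC (nemytskii (partialX f hf) u) := funext (sigma1_eq hf)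
  rw [e]
  exact meanC.hasFDerivAt.comp u (hasFDerivAt_nemytskii (isSmooth_partialX hf) u)

lemma continuous_sigma1 (hf : IsSmooth f) : Continuous (sigma1 f) :=
  continuous_iff_continuousAt.2 fun u => (hasFDerivAt_sigma1 hf u).continuousAt

lemma hasDerivAt_linEquiv_symm_one (a : C0) (r : ℝ) :
    HasDerivAt (fun s : ℝ => (linEquiv a).symm 1 (s : UnitAddCircle))
      (meanC (a * (linEquiv a).symm 1) - a r * (linEquiv a).symm 1 r) r :=
  hasDerivAt_of_add_prim_eq (x := 1) (h := 1)
    (by rw [one_smul]; exact linEquiv_symm_spec a 1) rfl r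

lemma linEquiv_symm_one_zero (a : C0) : (linEquiv a).symm 1 0 = 1 := by
  have := congrArg (fun u : C0 => u 0) (linEquiv_symm_spec a 1)
  simpa [prim_zero] using this

/-- The function `w = (linEquiv a).symm 1` solves `w' + a w = k` with `k = meanC (a * w)` and `w 0 =
w 1 = 1`; the integrating factor over one period gives `exp (meanC a) = 1 + k * expWeight a`. -/
lemma meanC_mul_linEquiv_symm_one (a : C0) :
    meanC (a * (linEquiv a).symm 1) = (Real.exp (meanC a) - 1) / expWeight a := by
  have h := mul_exp_linePrim (hasDerivAt_linEquiv_symm_one a) 1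
  rw [coe_one_eq_zero, coe_zero_eq, linEquiv_symm_one_zero, linePrim_one, one_mul] at h
  rw [eq_div_iff (expWeight_pos a).ne', h, expWeight]
  ring

/-- Here `k = 0`, so `w` solves the homogeneous equation. This produces the weight in `sigma2`. -/
lemma linEquiv_symm_one_of_mean_zero {a : C0} (ha : meanC a = 0) :
    (linEquiv a).symm 1 = negExp (prim a) := by
  refine C0_ext fun s _ => ?_
  have h := mul_exp_linePrim (hasDerivAt_linEquiv_symm_one a) s
  rw [meanC_mul_linEquiv_symm_one, ha, Real.exp_zero, sub_self, zero_div, zero_mul, add_zero,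
    coe_zero_eq, linEquiv_symm_one_zero, linePrim_eq, ha, mul_zero, add_zero] at h
  change _ = Real.exp (-prim a s)
  rw [Real.exp_neg]
  exact eq_inv_of_mul_eq_one_left h

section Avg

variable (hf : IsSmooth f) (hproper : IsProperMap f)

/-- The average of `f (t, u)`, where `u` solves the integral equation with the given datum. -/
def avg (V : C0) : ℝ := meanC (nemytskii f ((psiEquiv hf hproper).symm V))

lemma contDiff_avg : ContDiff ℝ ∞ (avg hf hproper) :=
  meanC.contDiff.comp ((contDiff_nemytskii hf).comp (contDiff_psi_symm hf hproper))

lemma exists_avg_eq (V : C0) : ∃ t, avg hf hproper V = f (t, V t) := by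
  obtain ⟨t, ht⟩ := exists_meanC_nemytskii_eq f ((psiEquiv hf hproper).symm V)
  rw [psi_symm] at ht
  exact ⟨t, ht.symm⟩

/-- The derivative of the average along the constants. -/
def avgSlope (V : C0) : ℝ :=
  (Real.exp (sigma1 f ((psiEquiv hf hproper).symm V)) - 1) /
    expWeight (nemytskii (partialX f hf) ((psiEquiv hf hproper).symm V))

lemma hasDerivAt_line (V : C0) (x : ℝ) : HasDerivAt (fun x : ℝ => V + x • (1 : C0)) 1 x := by
  simpa using ((hasDerivAt_id x).smul_const (1 : C0)).const_add V

lemma hasDerivAt_avg (V : C0) (x : ℝ) :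
    HasDerivAt (fun x : ℝ => avg hf hproper (V + x • 1)) (avgSlope hf hproper (V + x • 1)) x := by
  have h1 := (hasFDerivAt_psi_symm hf hproper (V + x • 1)).comp_hasDerivAt x (hasDerivAt_line V x)
  have h2 := meanC.hasFDerivAt.comp_hasDerivAt x
    ((hasFDerivAt_nemytskii hf _).comp_hasDerivAt x h1)
  refine h2.congr_deriv ?_
  rw [avgSlope, sigma1_eq hf, ← meanC_mul_linEquiv_symm_one]
  rfl

lemma avgSlope_eq_zero_iff (V : C0) :
    avgSlope hf hproper V = 0 ↔ sigma1 f ((psiEquiv hf hproper).symm V) = 0 := by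
  rw [avgSlope, div_eq_zero_iff, or_iff_left (expWeight_pos _).ne', sub_eq_zero,
    Real.exp_eq_one_iff]

/-- The numerator of `avgSlope` vanishes at `x`, so the difference quotient is that of the numerator
divided by the nearby denominator, of which only continuity is needed. -/
lemma hasDerivAt_avgSlope {V : C0} {x : ℝ}
    (h0 : sigma1 f ((psiEquiv hf hproper).symm (V + x • 1)) = 0) :
    HasDerivAt (fun x : ℝ => avgSlope hf hproper (V + x • 1))
      (sigma2 f hf ((psiEquiv hf hproper).symm (V + x • 1)) /
        expWeight (nemytskii (partialX f hf) ((psiEquiv hf hproper).symm (V + x • 1)))) x := by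
  have h1 := (hasFDerivAt_psi_symm hf hproper (V + x • 1)).comp_hasDerivAt x (hasDerivAt_line V x)
  have h2 := (hasFDerivAt_sigma1 hf _).comp_hasDerivAt x h1
  have h3 := h2.exp.sub_const 1
  have hw : ((linEquiv (nemytskii (partialX f hf)
      ((psiEquiv hf hproper).symm (V + x • 1)))).symm : C0 →L[ℝ] C0) 1 =
      negExp (prim (nemytskii (partialX f hf) ((psiEquiv hf hproper).symm (V + x • 1)))) :=
    linEquiv_symm_one_of_mean_zero (by rw [← sigma1_eq hf]; exact h0)
  have hI : Continuous fun x : ℝ =>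
      expWeight (nemytskii (partialX f hf) ((psiEquiv hf hproper).symm (V + x • 1))) :=
    continuous_expWeight.comp ((continuous_nemytskii _).comp
      ((contDiff_psi_symm hf hproper).continuous.comp (by fun_prop)))
  rw [hasDerivAt_iff_tendsto_slope] at h3 ⊢
  have h4 := h3.div (hI.continuousAt.tendsto.mono_left (nhdsWithin_le_nhds (s := {x}ᶜ)))
    (expWeight_pos _).ne'
  rw [hw] at h4
  have e : ∀ y : ℝ, slope (fun x : ℝ => avgSlope hf hproper (V + x • 1)) x y =
      slope (fun y : ℝ => Real.exp ((sigma1 f ∘ (psiEquiv hf hproper).symm ∘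
        fun x : ℝ => V + x • (1 : C0)) y) - 1) x y /
      expWeight (nemytskii (partialX f hf) ((psiEquiv hf hproper).symm (V + y • 1))) := by
    intro y
    simp only [slope_def_field, avgSlope, Function.comp_apply, h0]
    simp only [Real.exp_zero, sub_self, zero_div, sub_zero]
    ring
  refine (h4.congr fun y => (e y).symm).trans_eq ?_
  simp only [Function.comp_apply, h0, Real.exp_zero, one_mul]
  rfl

end Avg

/-! ### Integrals depending smoothly on a parameter -/

section Parametric

variable {E : Type} [NormedAddCommGroup E] [NormedSpace ℝ E]

/-- The tube lemma bounds the partial derivative for `e` near `e₀` uniformly in `t ∈ [0, 1]`,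
without local compactness of `E`; then differentiation under dominated convergence applies. -/
lemma hasFDerivAt_integral_of_contDiff {F : Type} [NormedAddCommGroup F] [NormedSpace ℝ F]
    {H : E × ℝ → F} (hH : ContDiff ℝ ∞ H) (e₀ : E) :
    HasFDerivAt (fun e => ∫ t in (0 : ℝ)..1, H (e, t))
      (∫ t in (0 : ℝ)..1, (fderiv ℝ H (e₀, t)).comp (ContinuousLinearMap.inl ℝ E ℝ)) e₀ := by
  let D : E × ℝ → (E →L[ℝ] F) := fun p => (fderiv ℝ H p).comp (ContinuousLinearMap.inl ℝ E ℝ)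
  have hD : Continuous D :=
    (hH.continuous_fderiv (by simp)).clm_comp continuous_const
  have hcont : ∀ e, Continuous fun t : ℝ => H (e, t) := fun e =>
    hH.continuous.comp (Continuous.prodMk_right e)
  have hcontD : Continuous fun t : ℝ => D (e₀, t) := hD.comp (Continuous.prodMk_right e₀)
  obtain ⟨C, hC⟩ := (isCompact_Icc (a := (0 : ℝ)) (b := 1)).exists_bound_of_continuousOn
    hcontD.continuousOn
  have hopen : IsOpen {p : E × ℝ | ‖D p‖ < C + 1} := isOpen_lt hD.norm continuous_const
  obtain ⟨u, v, hu, -, heu, hv, huv⟩ := generalized_tube_lemma (isCompact_singleton (x := e₀))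
    (isCompact_Icc (a := (0 : ℝ)) (b := 1)) hopen (by
      rintro ⟨e, t⟩ ⟨rfl, ht⟩
      exact (hC t ht).trans_lt (lt_add_one C))
  have hu' : u ∈ nhds e₀ := hu.mem_nhds (heu rfl)
  refine (intervalIntegral.hasFDerivAt_integral_of_dominated_of_fderiv_le (μ := volume)
    (F := fun e t => H (e, t)) (F' := fun e t => D (e, t)) (bound := fun _ => C + 1) hu'
    (Filter.Eventually.of_forall fun e => (hcont e).aestronglyMeasurable)
    ((hcont e₀).intervalIntegrable 0 1) hcontD.aestronglyMeasurable
    (Filter.Eventually.of_forall fun t ht e he => ?_) intervalIntegrable_const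
    (Filter.Eventually.of_forall fun t _ e _ => ?_))
  · rw [uIoc_of_le zero_le_one] at ht
    exact (huv (show (e, t) ∈ u ×ˢ v from ⟨he, hv (Ioc_subset_Icc_self ht)⟩)).le
  · have h1 : HasFDerivAt (fun e : E => (e, t)) (ContinuousLinearMap.inl ℝ E ℝ) e :=
      hasFDerivAt_prodMk_left e t
    exact ((hH.differentiable (by simp)).differentiableAt.hasFDerivAt).comp e h1

lemma contDiff_integral_of_contDiff {F : Type} [NormedAddCommGroup F] [NormedSpace ℝ F]
    {H : E × ℝ → F} (hH : ContDiff ℝ ∞ H) :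
    ContDiff ℝ ∞ fun e => ∫ t in (0 : ℝ)..1, H (e, t) := by
  refine contDiff_infty.2 fun n => ?_
  induction n generalizing F with
  | zero =>
    exact contDiff_zero.2 (continuous_iff_continuousAt.2 fun e =>
      (hasFDerivAt_integral_of_contDiff hH e).continuousAt)
  | succ n ih =>
    exact contDiff_succ_iff_hasFDerivAt.2
      ⟨_, ih (H := fun p => (fderiv ℝ H p).comp (ContinuousLinearMap.inl ℝ E ℝ))
        ((hH.fderiv_right (m := ∞) (by simp)).clm_comp contDiff_const),
        hasFDerivAt_integral_of_contDiff hH⟩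

end Parametric

/-! ### Families of functions of one variable with one nondegenerate minimum -/

section Family

variable {X : Type} [NormedAddCommGroup X] [NormedSpace ℝ X]

/-- The partial derivative in the real variable. -/
def pd (c : ℝ × X → ℝ) (p : ℝ × X) : ℝ := fderiv ℝ c p (1, 0)

lemma contDiff_pd {c : ℝ × X → ℝ} (hc : ContDiff ℝ ∞ c) : ContDiff ℝ ∞ (pd c) :=
  (hc.fderiv_right (m := ∞) (by simp)).clm_apply contDiff_const

lemma hasDerivAt_pd {c : ℝ × X → ℝ} (hc : ContDiff ℝ ∞ c) (x : ℝ) (q : X) :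
    HasDerivAt (fun y : ℝ => c (y, q)) (pd c (x, q)) x := by
  have h1 : HasDerivAt (fun y : ℝ => ((y, q) : ℝ × X)) (1, 0) x :=
    (hasDerivAt_id x).prodMk (hasDerivAt_const x q)
  exact ((hc.differentiable (by simp)).differentiableAt.hasFDerivAt).comp_hasDerivAt x h1

/-- The triangular equivalence `(x, q) ↦ (L (x, q), q)`. -/
def triEquiv (L : ℝ × X →L[ℝ] ℝ) (h : L (1, 0) ≠ 0) : (ℝ × X) ≃L[ℝ] (ℝ × X) :=
  ContinuousLinearEquiv.equivOfInverse (L.prod (ContinuousLinearMap.snd ℝ ℝ X))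
    (((L (1, 0))⁻¹ • (ContinuousLinearMap.fst ℝ ℝ X -
      (L.comp (ContinuousLinearMap.inr ℝ ℝ X)).comp (ContinuousLinearMap.snd ℝ ℝ X))).prod
      (ContinuousLinearMap.snd ℝ ℝ X))
    (fun ⟨x, q⟩ => by
      have e : L (x, q) = x * L (1, 0) + L (0, q) := by
        rw [← smul_eq_mul, ← map_smul, ← map_add]; simp
      refine Prod.ext ?_ rfl
      change (L (1, 0))⁻¹ * (L (x, q) - L (0, q)) = x
      rw [e]; field_simp; ring)
    (fun ⟨y, q⟩ => by
      have e : ∀ x, L (x, q) = x * L (1, 0) + L (0, q) := fun x => by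
        rw [← smul_eq_mul, ← map_smul, ← map_add]; simp
      refine Prod.ext ?_ rfl
      change L ((L (1, 0))⁻¹ * (y - L (0, q)), q) = y
      rw [e]; field_simp; ring)

lemma hasFDerivAt_tri {y : ℝ × X → ℝ} (hy : ContDiff ℝ ∞ y) (p : ℝ × X) (h : pd y p ≠ 0) :
    HasFDerivAt (fun p : ℝ × X => (y p, p.2)) (triEquiv (fderiv ℝ y p) h : ℝ × X →L[ℝ] ℝ × X) p :=
  ((hy.differentiable (by simp)).differentiableAt.hasFDerivAt).prodMk hasFDerivAt_snd

/-- The remainder is kept as an integral so that the factor of `x ^ 2` depends smoothly on all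
variables. -/
lemma taylor_integral {c : ℝ × X → ℝ} (hc : ContDiff ℝ ∞ c) (m x : ℝ) (q : X) :
    c (m + x, q) = c (m, q) + x * pd c (m, q) +
      x ^ 2 * ∫ t in (0 : ℝ)..1, (1 - t) * pd (pd c) (m + t * x, q) := by
  have hlin : ∀ t : ℝ, HasDerivAt (fun t : ℝ => m + t * x) x t := fun t => by
    simpa using ((hasDerivAt_id t).mul_const x).const_add m
  have hd : ∀ t : ℝ, HasDerivAt
      (fun t : ℝ => c (m + t * x, q) + (1 - t) * (x * pd c (m + t * x, q)))
      (x ^ 2 * ((1 - t) * pd (pd c) (m + t * x, q))) t := fun t => by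
    have h1 := (hasDerivAt_pd hc (m + t * x) q).comp t (hlin t)
    have h2 := (hasDerivAt_pd (contDiff_pd hc) (m + t * x) q).comp t (hlin t)
    refine (h1.add (((hasDerivAt_id t).const_sub 1).mul (h2.const_mul x))).congr_deriv ?_
    simp only [Function.comp_apply, id]
    ring
  have hcont : Continuous fun t : ℝ => x ^ 2 * ((1 - t) * pd (pd c) (m + t * x, q)) := by
    have := (contDiff_pd (contDiff_pd hc)).continuous
    fun_prop
  have := intervalIntegral.integral_eq_sub_of_hasDerivAt (a := 0) (b := 1) (fun t _ => hd t)
    (hcont.intervalIntegrable 0 1)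
  rw [intervalIntegral.integral_const_mul] at this
  simp only [one_mul, sub_self, zero_mul, add_zero, sub_zero] at this
  linarith

variable [CompleteSpace X]

/-- The map `(x, q) ↦ (k (x, q), q)` is a local diffeomorphism at `(m q₀, q₀)`. Its local inverse
sends `(0, q)` to a zero of `k`, which can only be `(m q, q)`; no continuity of `m` is needed
beforehand. -/
lemma contDiff_of_unique_zero {k : ℝ × X → ℝ} (hk : ContDiff ℝ ∞ k) {m : X → ℝ}
    (hm : ∀ x q, k (x, q) = 0 ↔ x = m q) (hnd : ∀ q, pd k (m q, q) ≠ 0) : ContDiff ℝ ∞ m := by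
  refine contDiff_iff_contDiffAt.2 fun q₀ => ?_
  have hΦ : ContDiff ℝ ∞ fun p : ℝ × X => (k p, p.2) := hk.prodMk contDiff_snd
  have hd := hasFDerivAt_tri hk (m q₀, q₀) (hnd q₀)
  let T := hΦ.contDiffAt.toOpenPartialHomeomorph _ hd (by simp)
  have hsource : (m q₀, q₀) ∈ T.source :=
    hΦ.contDiffAt.mem_toOpenPartialHomeomorph_source hd (by simp)
  have hT : ∀ p, T p = (k p, p.2) := fun _ => rfl
  have hT0 : T (m q₀, q₀) = (0, q₀) := by rw [hT, (hm _ _).2 rfl]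
  have htarget : (0, q₀) ∈ T.target := hT0 ▸ T.map_source hsource
  have hsymm : ContDiffAt ℝ ∞ T.symm (0, q₀) := by
    refine T.contDiffAt_symm htarget (f₀' := triEquiv _ (hnd q₀)) ?_ hΦ.contDiffAt
    rw [← hT0, T.left_inv hsource]
    exact hd
  have h1 : ContDiffAt ℝ ∞ (fun q : X => (T.symm (0, q)).1) q₀ :=
    contDiffAt_fst.comp q₀ (hsymm.comp q₀ (contDiffAt_const.prodMk contDiffAt_id))
  refine h1.congr_of_eventuallyEq ?_
  have hev : ∀ᶠ q in nhds q₀, ((0 : ℝ), q) ∈ T.target :=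
    (Continuous.prodMk_right (0 : ℝ)).continuousAt.eventually (T.open_target.mem_nhds htarget)
  filter_upwards [hev] with q hq
  have h2 := T.right_inv hq
  rw [hT] at h2
  have h3 : (T.symm (0, q)).2 = q := congrArg Prod.snd h2
  have h4 : k (T.symm (0, q)) = 0 := congrArg Prod.fst h2
  have h5 : k ((T.symm (0, q)).1, q) = 0 := by
    rw [show ((T.symm (0, q)).1, q) = T.symm (0, q) from Prod.ext rfl h3.symm, h4]
  exact ((hm _ _).1 h5).symm

/-- A family of functions of one real variable, each with one critical point, which is a
nondegenerate minimum, and growing to infinity at both ends, is a family of squares in suitable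
smooth coordinates. -/
theorem exists_square_coordinates {c : ℝ × X → ℝ} (hc : ContDiff ℝ ∞ c) {m : X → ℝ}
    (hm : ∀ x q, pd c (x, q) = 0 ↔ x = m q) (hnd : ∀ q, 0 < pd (pd c) (m q, q))
    (htop : ∀ q, Filter.Tendsto (fun x => c (x, q)) Filter.atTop Filter.atTop)
    (hbot : ∀ q, Filter.Tendsto (fun x => c (x, q)) Filter.atBot Filter.atTop) :
    ContDiff ℝ ∞ m ∧ ∃ Θ : ℝ × X ≃ ℝ × X, ContDiff ℝ ∞ Θ ∧ ContDiff ℝ ∞ Θ.symm ∧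
      ∀ x q, (Θ (x, q)).2 = q ∧ (Θ (x, q)).1 ^ 2 = c (x, q) - c (m q, q) := by
  have hms : ContDiff ℝ ∞ m :=
    contDiff_of_unique_zero (contDiff_pd hc) hm fun q => (hnd q).ne'
  refine ⟨hms, ?_⟩
  have hmin : ∀ x q, x ≠ m q → c (m q, q) < c (x, q) := by
    intro x q hx
    have hcont : Continuous fun x => c (x, q) := hc.continuous.comp (Continuous.prodMk_left q)
    obtain ⟨z, hz⟩ := hcont.exists_forall_le (by
      rw [cocompact_eq_atBot_atTop]
      exact (hbot q).sup (htop q))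
    have hcrit : ∀ w, (∀ y, c (w, q) ≤ c (y, q)) → w = m q := fun w hw =>
      (hm w q).1 (IsLocalMin.hasDerivAt_eq_zero (Filter.Eventually.of_forall hw)
        (hasDerivAt_pd hc w q))
    have hzm := hcrit z hz
    rw [hzm] at hz
    refine lt_of_le_of_ne (hz x) fun h => hx (hcrit x fun y => ?_)
    rw [← h]
    exact hz y
  -- The Taylor remainder factor: `c - c (m q, q) = (x - m q) ^ 2 * h` with `h > 0` everywhere, so
  -- `(x - m q) * √h` is the new coordinate.
  let h : ℝ × X → ℝ := fun p => ∫ t in (0 : ℝ)..1,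
    (1 - t) * pd (pd c) (m p.2 + t * (p.1 - m p.2), p.2)
  have hsm : ContDiff ℝ ∞ h := by
    have hK := contDiff_pd (contDiff_pd hc)
    refine contDiff_integral_of_contDiff (E := ℝ × X)
      (H := fun z : (ℝ × X) × ℝ =>
        (1 - z.2) * pd (pd c) (m z.1.2 + z.2 * (z.1.1 - m z.1.2), z.1.2)) ?_
    have hm2 : ContDiff ℝ ∞ fun z : (ℝ × X) × ℝ => m z.1.2 :=
      hms.comp (contDiff_snd.comp contDiff_fst)
    exact (contDiff_const.sub contDiff_snd).mul (hK.comp ((hm2.add (contDiff_snd.mul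
      ((contDiff_fst.comp contDiff_fst).sub hm2))).prodMk (contDiff_snd.comp contDiff_fst)))
  have hsq : ∀ x q, (x - m q) ^ 2 * h (x, q) = c (x, q) - c (m q, q) := fun x q => by
    have := taylor_integral hc (m q) (x - m q) q
    rw [add_sub_cancel, (hm _ _).2 rfl, mul_zero, add_zero] at this
    rw [this]
    ring
  have hpos : ∀ p, 0 < h p := by
    rintro ⟨x, q⟩
    by_cases hx : x = m q
    · have e : h (x, q) = 1 / 2 * pd (pd c) (m q, q) := by
        simp only [h, hx, sub_self, mul_zero, add_zero]
        rw [intervalIntegral.integral_mul_const, intervalIntegral.integral_sub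
          intervalIntegrable_const intervalIntegral.intervalIntegrable_id]
        simp
        norm_num
      rw [e]
      have := hnd q
      positivity
    · have h1 := hsq x q
      have h2 := hmin x q hx
      have h3 : 0 < (x - m q) ^ 2 := by
        have := sub_ne_zero.2 hx
        positivity
      by_contra! h4
      nlinarith
  let y : ℝ × X → ℝ := fun p => (p.1 - m p.2) * √(h p)
  have hy : ContDiff ℝ ∞ y := (contDiff_fst.sub (hms.comp contDiff_snd)).mul
    (hsm.sqrt fun p => (hpos p).ne')
  have hysq : ∀ x q, y (x, q) ^ 2 = c (x, q) - c (m q, q) := fun x q => by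
    change ((x - m q) * √(h (x, q))) ^ 2 = _
    rw [mul_pow, Real.sq_sqrt (hpos _).le, hsq]
  -- At the minimum the derivative is `√h`; elsewhere `2 y y_x = c_x ≠ 0`.
  have hyd : ∀ p, pd y p ≠ 0 := by
    rintro ⟨x, q⟩
    by_cases hx : x = m q
    · have hdy := hasDerivAt_pd hy x q
      have hds : HasDerivAt (fun x => √(h (x, q))) _ x :=
        hasDerivAt_pd (hsm.sqrt fun p => (hpos p).ne') x q
      have h2 := ((hasDerivAt_id x).sub_const (m q)).mul hds
      have h3 := hdy.unique h2
      rw [h3]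
      simp only [id, hx, sub_self, zero_mul, add_zero, one_mul]
      exact (Real.sqrt_pos.2 (hpos _)).ne'
    · have h1 := (hasDerivAt_pd hy x q).pow 2
      have h2 := (hasDerivAt_pd hc x q).sub_const (c (m q, q))
      have e : (fun x => y (x, q)) ^ 2 = fun x => c (x, q) - c (m q, q) :=
        funext fun x => hysq x q
      rw [e] at h1
      have h3 := h1.unique h2
      intro h4
      rw [h4, mul_zero] at h3
      exact hx ((hm x q).1 h3.symm)
  have hcont : ∀ q, Continuous fun x => y (x, q) := fun q =>
    hy.continuous.comp (Continuous.prodMk_left q)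
  have hinj : Function.Injective fun p : ℝ × X => (y p, p.2) := by
    rintro ⟨x, q⟩ ⟨x', q'⟩ hxx
    obtain ⟨h1, h2⟩ := Prod.ext_iff.1 hxx
    simp only at h1 h2
    subst h2
    have key : ∀ a b : ℝ, a < b → y (a, q) ≠ y (b, q) := fun a b hab heq => by
      obtain ⟨z, -, hz⟩ := exists_hasDerivAt_eq_zero hab (hcont q).continuousOn heq
        fun z _ => hasDerivAt_pd hy z q
      exact hyd _ hz
    rcases lt_trichotomy x x' with hlt | heq | hgt
    · exact absurd h1 (key _ _ hlt)
    · rw [heq]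
    · exact absurd h1.symm (key _ _ hgt)
  have hsurj : Function.Surjective fun p : ℝ × X => (y p, p.2) := by
    rintro ⟨v, q⟩
    obtain ⟨a, ha1, ha2⟩ := (((htop q).eventually_ge_atTop (v ^ 2 + c (m q, q))).and
      (Filter.eventually_gt_atTop (m q))).exists
    obtain ⟨b, hb1, hb2⟩ := (((hbot q).eventually_ge_atTop (v ^ 2 + c (m q, q))).and
      (Filter.eventually_lt_atBot (m q))).exists
    have hya : |v| ≤ y (a, q) := by
      have h1 := hysq a q
      have h2 : 0 ≤ y (a, q) := mul_nonneg (sub_nonneg.2 ha2.le) (Real.sqrt_nonneg _)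
      exact abs_le_of_sq_le_sq (by linarith) h2
    have hyb : y (b, q) ≤ -|v| := by
      have h1 := hysq b q
      have h2 : y (b, q) ≤ 0 :=
        mul_nonpos_of_nonpos_of_nonneg (sub_nonpos.2 hb2.le) (Real.sqrt_nonneg _)
      have h3 : |v| ≤ -y (b, q) :=
        abs_le_of_sq_le_sq (by rw [neg_sq]; linarith) (by linarith)
      linarith
    obtain ⟨x, hx⟩ := mem_range_of_exists_le_of_exists_ge (hcont q)
      ⟨b, hyb.trans (neg_abs_le v)⟩ ⟨a, (le_abs_self v).trans hya⟩
    exact ⟨(x, q), Prod.ext hx rfl⟩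
  have hΘ : ContDiff ℝ ∞ fun p : ℝ × X => (y p, p.2) := hy.prodMk contDiff_snd
  refine ⟨Equiv.ofBijective _ ⟨hinj, hsurj⟩, hΘ, ?_, fun x q => ⟨rfl, hysq x q⟩⟩
  exact contDiff_symm_of_invertible_fderiv (Equiv.ofBijective _ ⟨hinj, hsurj⟩) hΘ
    fun p => ⟨_, hasFDerivAt_tri hy p (hyd p)⟩

/-- A map which, in global coordinates, is a family of functions of one variable with one
nondegenerate minimum (or maximum, if `σ = -1`), is a global fold. -/
theorem isGlobalFold_of_family {E F : Type} [NormedAddCommGroup E] [NormedSpace ℝ E]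
    [NormedAddCommGroup F] [NormedSpace ℝ F] {G : E → F} {c : ℝ × X → ℝ} (hc : ContDiff ℝ ∞ c)
    {m : X → ℝ} (hm : ∀ x q, pd c (x, q) = 0 ↔ x = m q) (hnd : ∀ q, 0 < pd (pd c) (m q, q))
    (htop : ∀ q, Filter.Tendsto (fun x => c (x, q)) Filter.atTop Filter.atTop)
    (hbot : ∀ q, Filter.Tendsto (fun x => c (x, q)) Filter.atBot Filter.atTop)
    (e : E ≃ ℝ × X) (he : ContDiff ℝ ∞ e) (hes : ContDiff ℝ ∞ e.symm) (δ : F ≃L[ℝ] ℝ × X)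
    {σ : ℝ} (hσ : σ * σ = 1) (hG : ∀ x q, δ (G (e.symm (x, q))) = (σ * c (x, q), q)) :
    IsGlobalFold X G := by
  obtain ⟨hms, Θ, hΘ, hΘs, hprop⟩ := exists_square_coordinates hc hm hnd htop hbot
  have hcm : ContDiff ℝ ∞ fun p : ℝ × X => c (m p.2, p.2) :=
    hc.comp ((hms.comp contDiff_snd).prodMk contDiff_snd)
  -- In the target, the sign is undone and the minimum value of each fibre is moved to `0`.
  let τ : ℝ × X ≃ ℝ × X :=
    { toFun := fun p => (σ * p.1 - c (m p.2, p.2), p.2)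
      invFun := fun p => (σ * (p.1 + c (m p.2, p.2)), p.2)
      left_inv := fun p => Prod.ext (by
        change σ * (σ * p.1 - c (m p.2, p.2) + c (m p.2, p.2)) = p.1
        rw [sub_add_cancel, ← mul_assoc, hσ, one_mul]) rfl
      right_inv := fun p => Prod.ext (by
        change σ * (σ * (p.1 + c (m p.2, p.2))) - c (m p.2, p.2) = p.1
        rw [← mul_assoc, hσ, one_mul, add_sub_cancel_right]) rfl }
  have hτ : ContDiff ℝ ∞ τ :=
    ((contDiff_const.mul contDiff_fst).sub hcm).prodMk contDiff_snd
  have hτs : ContDiff ℝ ∞ τ.symm :=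
    (contDiff_const.mul (contDiff_fst.add hcm)).prodMk contDiff_snd
  refine ⟨e.trans Θ, δ.toEquiv.trans τ, hΘ.comp he, hes.comp hΘs, hτ.comp δ.contDiff,
    δ.symm.contDiff.comp hτs, fun x v => ?_⟩
  obtain ⟨⟨x', q⟩, hx'⟩ := Θ.surjective (x, v)
  have h1 := hprop x' q
  rw [hx'] at h1
  obtain ⟨h2, h3⟩ := h1
  simp only at h2 h3
  subst h2
  have h4 : Θ.symm (x, v) = (x', v) := by rw [← hx', Θ.symm_apply_apply]
  change τ (δ (G (e.symm (Θ.symm (x, v))))) = _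
  rw [h4, hG]
  refine Prod.ext ?_ rfl
  change σ * (σ * c (x', v)) - c (m v, v) = x ^ 2
  rw [← mul_assoc, hσ, one_mul, h3]

end Family

/-! ### Nondegeneracy of folds -/

section Folds

open Asymptotics Filter Topology

/-- Mean value inequality for `ν z - A / 2 * (z - b) ^ 2` on the ball of radius `|y - b|`; its
derivative is `o (z - b)` there. -/
lemma isLittleO_second_order {ν ν' : ℝ → ℝ} {A b : ℝ} (hd : ∀ᶠ y in 𝓝 b, HasDerivAt ν (ν' y) y)
    (h0 : ν' b = 0) (hA : HasDerivAt ν' A b) :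
    (fun y => ν y - ν b - A / 2 * (y - b) ^ 2) =o[𝓝 b] fun y => (y - b) ^ 2 := by
  rw [isLittleO_iff]
  intro ε hε
  have h1 := (isLittleO_iff.1 (hasDerivAt_iff_isLittleO.1 hA)) hε
  obtain ⟨r, hr, hball⟩ := Metric.eventually_nhds_iff_ball.1 (hd.and h1)
  filter_upwards [Metric.ball_mem_nhds b hr] with y hy
  let g : ℝ → ℝ := fun z => ν z - A / 2 * (z - b) ^ 2
  have hsub : Metric.closedBall b |y - b| ⊆ Metric.ball b r := fun z hz =>
    lt_of_le_of_lt (Metric.mem_closedBall.1 hz) (by simpa [Real.dist_eq] using hy)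
  have hg : ∀ z ∈ Metric.closedBall b |y - b|,
      HasDerivWithinAt g (ν' z - A * (z - b)) (Metric.closedBall b |y - b|) z := fun z hz => by
    have h2 := (hball z (hsub hz)).1
    have h3 := (((hasDerivAt_id z).sub_const b).pow 2).const_mul (A / 2)
    refine ((h2.sub h3).congr_deriv ?_).hasDerivWithinAt
    simp
    ring
  have hb : ∀ z ∈ Metric.closedBall b |y - b|, ‖ν' z - A * (z - b)‖ ≤ ε * |y - b| := fun z hz => by
    have h2 := (hball z (hsub hz)).2
    rw [h0, sub_zero, smul_eq_mul, mul_comm (z - b)] at h2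
    refine h2.trans ?_
    gcongr
    exact Metric.mem_closedBall.1 hz
  have h4 := (convex_closedBall b |y - b|).norm_image_sub_le_of_norm_hasDerivWithin_le hg hb
    (Metric.mem_closedBall_self (abs_nonneg _)) (show y ∈ Metric.closedBall b |y - b| by
      simp [Real.dist_eq])
  have e : g y - g b = ν y - ν b - A / 2 * (y - b) ^ 2 := by
    simp only [g, sub_self]
    ring
  rw [e, Real.norm_eq_abs (y - b), mul_assoc] at h4
  rwa [norm_pow, Real.norm_eq_abs (y - b), sq |y - b|]

variable {E F : Type} [NormedAddCommGroup E] [NormedSpace ℝ E]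
  [NormedAddCommGroup F] [NormedSpace ℝ F]

/-- A fold is not stationary to the second order along an immersed curve. -/
lemma IsFold.not_isLittleO {G : E → F} {u₀ : E} (hG : IsFold G u₀) {γ : ℝ → E} {γ' : E} {x₀ : ℝ}
    (hγ : HasDerivAt γ γ' x₀) (hγ0 : γ x₀ = u₀) (hne : γ' ≠ 0) :
    ¬ (fun x => G (γ x) - G u₀) =o[𝓝 x₀] fun x => (x - x₀) ^ 2 := by
  intro ho
  obtain ⟨X, _, _, _, α, β, μ, hu, hmaps, hα, hαs, hβ, -, hμ, hform, hd1, hd2⟩ := hG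
  set p₀ := α u₀ with hp₀
  have hp₀t : p₀ ∈ α.target := α.map_source hu
  have hαd : HasFDerivAt α (fderiv ℝ α u₀) u₀ :=
    ((hα.contDiffAt (α.open_source.mem_nhds hu)).differentiableAt (by simp)).hasFDerivAt
  have hαsd : HasFDerivAt α.symm (fderiv ℝ α.symm p₀) p₀ :=
    ((hαs.contDiffAt (α.open_target.mem_nhds hp₀t)).differentiableAt (by simp)).hasFDerivAt
  have hGu : G u₀ ∈ β.source := hmaps hu
  have hβd : HasFDerivAt β (fderiv ℝ β (G u₀)) (G u₀) :=
    ((hβ.contDiffAt (β.open_source.mem_nhds hGu)).differentiableAt (by simp)).hasFDerivAt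
  have hγev : ∀ᶠ x in 𝓝 x₀, γ x ∈ α.source :=
    hγ.continuousAt.eventually (hγ0 ▸ α.open_source.mem_nhds hu)
  let p : ℝ → X × ℝ := fun x => α (γ x)
  have hp0 : p x₀ = p₀ := by simp only [p, hγ0, hp₀]
  have hp : HasDerivAt p (fderiv ℝ α u₀ γ') x₀ := by
    subst hγ0
    exact hαd.comp_hasDerivAt x₀ hγ
  set p' := fderiv ℝ α u₀ γ' with hp'
  have hp'ne : p' ≠ 0 := by
    intro h0
    have h1 : HasDerivAt (fun x => α.symm (p x)) (fderiv ℝ α.symm p₀ p') x₀ := by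
      rw [← hp0] at hαsd ⊢
      exact hαsd.comp_hasDerivAt x₀ hp
    have h2 : HasDerivAt γ (fderiv ℝ α.symm p₀ p') x₀ :=
      h1.congr_of_eventuallyEq (hγev.mono fun x hx => (α.left_inv hx).symm)
    exact hne (by rw [hγ.unique h2, h0, map_zero])
  have hsq1 : (fun x : ℝ => (x - x₀) ^ 2) =o[𝓝 x₀] fun x => x - x₀ := by
    have ht : Tendsto (fun x : ℝ => x - x₀) (𝓝 x₀) (𝓝 0) := by
      have h : ContinuousAt (fun x : ℝ => x - x₀) x₀ := by fun_prop
      simpa [ContinuousAt] using h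
    have := (isLittleO_pow_id (𝕜 := ℝ) (one_lt_two)).comp_tendsto ht
    exact this
  -- `G` is not assumed continuous; continuity of `G ∘ γ` at `x₀` comes from the estimate itself.
  have hcontG : Tendsto (fun x => G (γ x)) (𝓝 x₀) (𝓝 (G u₀)) := by
    have h1 : (fun x => G (γ x) - G u₀) =o[𝓝 x₀] fun _ => (1 : ℝ) := by
      refine (ho.trans hsq1).trans_isBigO ?_
      have : ContinuousAt (fun x : ℝ => x - x₀) x₀ := by fun_prop
      exact this.tendsto.isBigO_one ℝ
    exact tendsto_sub_nhds_zero_iff.1 ((isLittleO_one_iff ℝ).1 h1)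
  have hβo : (fun x => β (G (γ x)) - β (G u₀)) =o[𝓝 x₀] fun x => (x - x₀) ^ 2 :=
    (hβd.isBigO_sub.comp_tendsto hcontG).trans_isLittleO ho
  have hβG : ∀ᶠ x in 𝓝 x₀, β (G (γ x)) = ((p x).1, μ (p x)) := hγev.mono fun x hx => by
    have := hform (p x) (α.map_source hx)
    rwa [α.left_inv hx] at this
  have hβG0 : β (G u₀) = (p₀.1, μ p₀) := by
    have := hβG.self_of_nhds
    rwa [hγ0, hp0] at this
  have hpair : (fun x => ((p x).1 - p₀.1, μ (p x) - μ p₀)) =o[𝓝 x₀] fun x => (x - x₀) ^ 2 := by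
    refine hβo.congr' (hβG.mono fun x hx => ?_) EventuallyEq.rfl
    simp only [hx, hβG0]
    rfl
  have ho1 : (fun x => (p x).1 - p₀.1) =o[𝓝 x₀] fun x => (x - x₀) ^ 2 :=
    isBigO_fst_prod.trans_isLittleO hpair
  have ho2 : (fun x => μ (p x) - μ p₀) =o[𝓝 x₀] fun x => (x - x₀) ^ 2 :=
    isBigO_snd_prod.trans_isLittleO hpair
  have hp1 : HasDerivAt (fun x => (p x).1) p'.1 x₀ := 
    (hasFDerivAt_fst (𝕜 := ℝ) (p := p x₀)).comp_hasDerivAt x₀ hp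
  have hp2 : HasDerivAt (fun x => (p x).2) p'.2 x₀ := 
    (hasFDerivAt_snd (𝕜 := ℝ) (p := p x₀)).comp_hasDerivAt x₀ hp
  -- The adapted form preserves the first component, so its increment is `o ((x - x₀) ^ 2)`; the
  -- nonzero velocity is therefore in the `y` direction.
  have hp'1 : p'.1 = 0 := by
    have h1 : HasDerivAt (fun x => (p x).1) 0 x₀ := by
      rw [hasDerivAt_iff_isLittleO]
      refine (ho1.trans hsq1).congr_left fun x => ?_
      rw [smul_zero, sub_zero, hp0]
    exact hp1.unique h1
  have hp'2 : p'.2 ≠ 0 := fun h => hp'ne (Prod.ext hp'1 h)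
  let ν : ℝ → ℝ := fun y => μ (p₀.1, y)
  have hμat : ContDiffAt ℝ ∞ μ p₀ := hμ.contDiffAt (α.open_target.mem_nhds hp₀t)
  obtain ⟨K, t, ht, hK⟩ := (hμat.of_le (m := 1) (by simp)).exists_lipschitzOnWith
  have hpc : Tendsto p (𝓝 x₀) (𝓝 p₀) := hp0 ▸ hp.continuousAt.tendsto
  have hqc : Tendsto (fun x => (p₀.1, (p x).2)) (𝓝 x₀) (𝓝 p₀) :=
    tendsto_const_nhds.prodMk_nhds ((continuous_snd.tendsto p₀).comp hpc)
  -- Freezing the first variable at `p₀.1` costs `o ((x - x₀) ^ 2)`, since `μ` is locally Lipschitz.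
  have ho3 : (fun x => μ (p x) - ν (p x).2) =o[𝓝 x₀] fun x => (x - x₀) ^ 2 := by
    refine IsBigO.trans_isLittleO (IsBigO.of_bound K ?_) ho1
    filter_upwards [hpc.eventually ht, hqc.eventually ht] with x hx1 hx2
    have h1 := hK.norm_sub_le hx1 hx2
    refine h1.trans_eq ?_
    congr 1
    rw [Prod.norm_def]
    simp
  have ho4 : (fun x => ν (p x).2 - ν p₀.2) =o[𝓝 x₀] fun x => (x - x₀) ^ 2 := by
    refine (ho2.sub ho3).congr_left fun x => ?_
    change μ (p x) - μ p₀ - (μ (p x) - ν (p x).2) = ν (p x).2 - μ p₀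
    ring
  have hνat : ContDiffAt ℝ ∞ ν p₀.2 :=
    ContDiffAt.comp p₀.2 (f := fun y : ℝ => (p₀.1, y)) (g := μ) hμat
      (contDiffAt_const.prodMk contDiffAt_id)
  have hνd : ∀ᶠ y in 𝓝 p₀.2, HasDerivAt ν (deriv ν y) y :=
    ((hνat.of_le (m := 1) (by simp)).eventually (by simp)).mono fun y hy =>
      (hy.differentiableAt (by simp)).hasDerivAt
  have hν2 : HasDerivAt (deriv ν) (iteratedDeriv 2 ν p₀.2) p₀.2 := by
    have h1 : ContDiffAt ℝ 1 (deriv ν) p₀.2 := by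
      have h2 := (hνat.fderiv_right (m := 1) (by
        rw [one_add_one_eq_two]
        exact WithTop.coe_le_coe.2 (le_top : (2 : ℕ∞) ≤ ⊤))).clm_apply
        (contDiffAt_const (c := (1 : ℝ)))
      exact h2
    have h3 := (h1.differentiableAt (by simp)).hasDerivAt
    rwa [show iteratedDeriv 2 ν = deriv (deriv ν) by
      rw [iteratedDeriv_succ, iteratedDeriv_one]]
  have ho5 := isLittleO_second_order hνd hd1 hν2
  have hbc : Tendsto (fun x => (p x).2) (𝓝 x₀) (𝓝 p₀.2) := (continuous_snd.tendsto p₀).comp hpc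
  have hbO : (fun x => ((p x).2 - p₀.2)) =O[𝓝 x₀] fun x => x - x₀ := by
    have := hp2.isBigO_sub
    simpa only [hp0] using this
  have ho6 := (ho5.comp_tendsto hbc).trans_isBigO (hbO.pow 2)
  -- The quadratic term of `ν` is all that remains, and its coefficient is nonzero; this forces the
  -- velocity in `y` to vanish as well.
  have ho7 : (fun x => iteratedDeriv 2 ν p₀.2 / 2 * ((p x).2 - p₀.2) ^ 2) =o[𝓝 x₀]
      fun x => (x - x₀) ^ 2 := by
    refine (ho4.sub ho6).congr_left fun x => ?_
    simp only [Function.comp_apply]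
    ring
  have ho8 : (fun x => ((p x).2 - p₀.2) ^ 2) =o[𝓝 x₀] fun x => (x - x₀) ^ 2 := by
    have hne2 : iteratedDeriv 2 ν p₀.2 / 2 ≠ 0 := div_ne_zero hd2 two_ne_zero
    exact (isLittleO_const_mul_left_iff hne2).1 ho7
  have ho9 : (fun x => (p x).2 - p₀.2) =o[𝓝 x₀] fun x => x - x₀ :=
ho8.of_pow two_ne_zero
  have : HasDerivAt (fun x => (p x).2) 0 x₀ := by
    rw [hasDerivAt_iff_isLittleO]
    refine ho9.congr_left fun x => ?_
    rw [smul_zero, sub_zero, hp0]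
  exact hp'2 (hp2.unique this)

variable {X : Type} [NormedAddCommGroup X] [NormedSpace ℝ X]

/-- Coordinate changes have invertible derivatives, and the triangular derivative `(dc, dq)` is onto
exactly when `∂c/∂x ≠ 0`. -/
lemma isCriticalPoint_iff_pd_eq_zero {G : E → F} {c : ℝ × X → ℝ} (hc : ContDiff ℝ ∞ c)
    (e : E ≃ ℝ × X) (he : ContDiff ℝ ∞ e) (hes : ContDiff ℝ ∞ e.symm) (δ : F ≃L[ℝ] ℝ × X)
    (hG : ∀ x q, δ (G (e.symm (x, q))) = (c (x, q), q))
    (x : ℝ) (q : X) :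
    IsCriticalPoint G (e.symm (x, q)) ↔ pd c (x, q) = 0 := by
  set u := e.symm (x, q) with hu
  have heu : e u = (x, q) := e.apply_symm_apply _
  have hed : HasFDerivAt e (fderiv ℝ e u) u :=
    ((he.differentiable (by simp)).differentiableAt).hasFDerivAt
  have hesd : HasFDerivAt e.symm (fderiv ℝ e.symm (e u)) (e u) :=
    ((hes.differentiable (by simp)).differentiableAt).hasFDerivAt
  let M : ℝ × X →L[ℝ] ℝ × X := (fderiv ℝ c (x, q)).prod (ContinuousLinearMap.snd ℝ ℝ X)
  have hM : HasFDerivAt (fun p : ℝ × X => (c p, p.2)) M (e u) := by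
    rw [heu]
    exact ((hc.differentiable (by simp)).differentiableAt.hasFDerivAt).prodMk hasFDerivAt_snd
  have hGe : G = fun v => δ.symm ((fun p : ℝ × X => (c p, p.2)) (e v)) := by
    ext v
    have := hG (e v).1 (e v).2
    rw [Prod.mk.eta, e.symm_apply_apply] at this
    exact (δ.symm_apply_eq.2 this.symm).symm
  have hGd : HasFDerivAt G ((δ.symm : ℝ × X →L[ℝ] F).comp (M.comp (fderiv ℝ e u))) u := by
    rw [hGe]
    exact δ.symm.hasFDerivAt.comp u (hM.comp u hed)
  have hesurj : Function.Surjective (fderiv ℝ e u) := fun w => by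
    refine ⟨fderiv ℝ e.symm (e u) w, ?_⟩
    have h1 : HasFDerivAt (fun p => e (e.symm p))
        ((fderiv ℝ e u).comp (fderiv ℝ e.symm (e u))) (e u) := by
      refine HasFDerivAt.comp (g := e) (f := e.symm) (e u) ?_ hesd
      rwa [e.symm_apply_apply]
    have h2 : HasFDerivAt (fun p => e (e.symm p)) (ContinuousLinearMap.id ℝ (ℝ × X)) (e u) := by
      simp only [e.apply_symm_apply]
      exact hasFDerivAt_id (𝕜 := ℝ) (e u)
    exact congrArg (fun L : ℝ × X →L[ℝ] ℝ × X => L w) (h1.unique h2)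
  rw [IsCriticalPoint, hGd.fderiv, not_iff_comm]
  have hsurj : Function.Surjective ((δ.symm : ℝ × X →L[ℝ] F).comp (M.comp (fderiv ℝ e u))) ↔
      Function.Surjective M := by
    change Function.Surjective (δ.symm ∘ (M ∘ fderiv ℝ e u)) ↔ _
    rw [Function.Surjective.of_comp_iff' δ.symm.bijective]
    exact ⟨fun h => h.of_comp, fun h => h.comp hesurj⟩
  rw [hsurj]
  constructor
  · intro h
    exact (triEquiv (fderiv ℝ c (x, q)) h).surjective
  · intro h h0
    obtain ⟨⟨y, w⟩, hw⟩ := h (1, 0)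
    have h2 : w = 0 := congrArg Prod.snd hw
    have h1 : fderiv ℝ c (x, q) (y, w) = 1 := congrArg Prod.fst hw
    have h3 : fderiv ℝ c (x, q) (y, w) = y * pd c (x, q) := by
      rw [h2, pd, ← smul_eq_mul, ← map_smul]
      simp
    rw [h0, mul_zero, h1] at h3
    exact one_ne_zero h3

/-- If both derivatives vanished, `G` would be stationary to second order along the image of the
line `q = const`, against `IsFold.not_isLittleO`. -/
lemma IsFold.pd_pd_ne_zero {G : E → F} {c : ℝ × X → ℝ} (hc : ContDiff ℝ ∞ c)
    (e : E ≃ ℝ × X) (he : ContDiff ℝ ∞ e) (hes : ContDiff ℝ ∞ e.symm) (δ : F ≃L[ℝ] ℝ × X)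
    (hG : ∀ x q, δ (G (e.symm (x, q))) = (c (x, q), q))
    {x : ℝ} {q : X} (hfold : IsFold G (e.symm (x, q)))
    (h0 : pd c (x, q) = 0) : pd (pd c) (x, q) ≠ 0 := by
  intro h2
  have hline : HasDerivAt (fun y : ℝ => ((y, q) : ℝ × X)) (1, 0) x :=
    (hasDerivAt_id x).prodMk (hasDerivAt_const x q)
  have hesd : HasFDerivAt e.symm (fderiv ℝ e.symm (x, q)) (x, q) :=
    ((hes.differentiable (by simp)).differentiableAt).hasFDerivAt
  have hγ : HasDerivAt (fun y : ℝ => e.symm (y, q)) (fderiv ℝ e.symm (x, q) (1, 0)) x :=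
    hesd.comp_hasDerivAt x hline
  refine hfold.not_isLittleO hγ rfl ?_ ?_
  · intro hz
    have hed : HasFDerivAt e (fderiv ℝ e (e.symm (x, q))) (e.symm (x, q)) :=
      ((he.differentiable (by simp)).differentiableAt).hasFDerivAt
    have h3 := hed.comp_hasDerivAt x hγ
    have h4 : (e ∘ fun y : ℝ => e.symm (y, q)) = fun y : ℝ => ((y, q) : ℝ × X) :=
      funext fun y => e.apply_symm_apply _
    rw [h4, hz, map_zero] at h3
    exact one_ne_zero (congrArg Prod.fst (hline.unique h3))
  · have h3 := isLittleO_second_order (Eventually.of_forall fun y => hasDerivAt_pd hc y q) h0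
      (hasDerivAt_pd (contDiff_pd hc) x q)
    simp only [h2, zero_div, zero_mul, sub_zero] at h3
    have hGs : ∀ y, G (e.symm (y, q)) = δ.symm (c (y, q), q) := fun y =>
      (δ.symm_apply_eq.2 (hG y q).symm).symm
    have h4 : (fun y => G (e.symm (y, q)) - G (e.symm (x, q))) =
        fun y => δ.symm (c (y, q) - c (x, q), 0) := by
      ext y
      rw [hGs, hGs, ← map_sub]
      simp
    rw [h4]
    refine ((δ.symm : ℝ × X →L[ℝ] F).isBigO_comp
      (fun y => ((c (y, q) - c (x, q), 0) : ℝ × X)) (𝓝 x)).trans_isLittleO ?_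
    exact h3.prod_left (isLittleO_zero _ _)

end Folds

/-! ### Continuously differentiable functions on the circle -/

/-- The lift of `u` to the line is continuously differentiable. -/
def IsC1 (u : C0) : Prop :=
  ∃ u' : C0, ∀ s : ℝ, HasDerivAt (fun r : ℝ => u (r : UnitAddCircle)) (u' s) s

lemma IsC1.add {u v : C0} : IsC1 u → IsC1 v → IsC1 (u + v) := fun ⟨u', hu⟩ ⟨v', hv⟩ =>
  ⟨u' + v', fun s => (hu s).add (hv s)⟩

lemma IsC1.mul {u v : C0} : IsC1 u → IsC1 v → IsC1 (u * v) := fun ⟨u', hu⟩ ⟨v', hv⟩ =>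
  ⟨u' * v + u * v', fun s => (hu s).mul (hv s)⟩

lemma IsC1.smul {u : C0} (c : ℝ) : IsC1 u → IsC1 (c • u) := fun ⟨u', hu⟩ =>
  ⟨c • u', fun s => (hu s).const_mul c⟩

lemma IsC1.neg {u : C0} (hu : IsC1 u) : IsC1 (-u) := by
  simpa using hu.smul (-1)

lemma IsC1.sub {u v : C0} (hu : IsC1 u) (hv : IsC1 v) : IsC1 (u - v) := by
  simpa [sub_eq_add_neg] using hu.add hv.neg

lemma isC1_one : IsC1 1 := ⟨0, fun s => hasDerivAt_const s (1 : ℝ)⟩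

lemma isC1_prim (v : C0) : IsC1 (prim v) :=
  ⟨v - meanC v • (1 : C0), fun s => by simpa using hasDerivAt_prim v s⟩

lemma IsC1.negExp {u : C0} : IsC1 u → IsC1 (negExp u) := fun ⟨u', hu⟩ =>
  ⟨PeriodicFirstOrder.negExp u * (-u'), fun s => (hu s).neg.exp⟩

/-! ### Averages of rapidly oscillating functions -/

/-- The function `t ↦ q (N t)`. -/
def scale (N : ℕ) (q : C0) : C0 := ⟨fun t => q (N • t), by fun_prop⟩

lemma scale_coe (N : ℕ) (q : C0) (r : ℝ) :
    scale N q (r : UnitAddCircle) = q ((N * r : ℝ) : UnitAddCircle) := by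
  rw [← nsmul_eq_mul, AddCircle.coe_nsmul]
  rfl

/-- On an interval of length `1 / N`, `D` varies by at most `η`, while `scale N q` minus its average
integrates to `0`. The threshold for `N` depends only on `D`, so it serves all `q` at once. -/
lemma eventually_abs_meanC_scale_mul_le (D : C0) {η : ℝ} (hη : 0 < η) :
    ∃ N₀ : ℕ, ∀ N ≥ N₀, ∀ q : C0, (∀ t, q t ∈ Icc (0 : ℝ) 1) →
      |meanC (scale N q * D) - meanC q * meanC D| ≤ η := by
  have huc := isCompact_Icc.uniformContinuousOn_of_continuous
    (continuous_coe_comp D).continuousOn (s := Icc (0 : ℝ) 1)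
  obtain ⟨δ, hδ, hδD⟩ := Metric.uniformContinuousOn_iff.1 huc η hη
  obtain ⟨N₀, hN₀⟩ := exists_nat_gt (1 / δ)
  refine ⟨max N₀ 1, fun N hN q hq => ?_⟩
  have hN1 : 1 ≤ N := (le_max_right _ _).trans hN
  have hNpos : (0 : ℝ) < N := by exact_mod_cast hN1
  have hNδ : 1 / δ < N := hN₀.trans_le (by exact_mod_cast (le_max_left _ _).trans hN)
  have hstep : 1 / (N : ℝ) < δ := by
    rw [div_lt_iff₀ hNpos]
    rwa [div_lt_iff₀ hδ, mul_comm] at hNδ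
  set m := meanC q with hm
  have hm01 : m ∈ Icc (0 : ℝ) 1 := by
    constructor
    · exact (map_zero meanC).symm.le.trans (meanC_mono (u := 0) (v := q) fun t => (hq t).1)
    · exact (meanC_mono (u := q) (v := 1) fun t => (hq t).2).trans meanC_one.le
  let g : ℝ → ℝ := fun r => q (r : UnitAddCircle) - m
  have hg : Continuous g := (continuous_coe_comp q).sub continuous_const
  have hgb : ∀ r, |g r| ≤ 1 := fun r => by
    have h1 := hq (r : UnitAddCircle)
    rw [abs_le]
    constructor <;> simp only [g] <;> linarith [h1.1, h1.2, hm01.1, hm01.2]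
  have hDN : Continuous fun r : ℝ => D ((r / N : ℝ) : UnitAddCircle) :=
    (continuous_coe_comp D).comp (continuous_id.div_const (N : ℝ))
  let W : ℝ → ℝ := fun r => g r * D ((r / N : ℝ) : UnitAddCircle)
  have hW : Continuous W := hg.mul hDN
  have hmD : Continuous fun r : ℝ => m * D (r : UnitAddCircle) :=
    continuous_const.mul (continuous_coe_comp D)
  have e1 : meanC (scale N q * D) - m * meanC D = ∫ r in (0 : ℝ)..1, W (N * r) := by
    rw [meanC_eq_interval, meanC_eq_interval, ← intervalIntegral.integral_const_mul,
      ← intervalIntegral.integral_sub ((continuous_coe_comp _).intervalIntegrable 0 1)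
        (hmD.intervalIntegrable 0 1)]
    refine intervalIntegral.integral_congr fun r _ => ?_
    simp only [W, g, ContinuousMap.mul_apply, scale_coe]
    rw [mul_div_cancel_left₀ r hNpos.ne']
    ring
  have e2 : ∫ r in (0 : ℝ)..1, W (N * r) = (N : ℝ)⁻¹ * ∫ r in (0 : ℝ)..N, W r := by
    rw [intervalIntegral.integral_comp_mul_left _ hNpos.ne']
    simp
  have e3 : ∫ r in (0 : ℝ)..N, W r =
      ∑ k ∈ Finset.range N, ∫ r in (k : ℝ)..((k + 1 : ℕ) : ℝ), W r := by
    rw [intervalIntegral.sum_integral_adjacent_intervals (a := fun k : ℕ => (k : ℝ))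
      (fun k _ => hW.intervalIntegrable _ _)]
    simp
  have hpiece : ∀ k ∈ Finset.range N, |∫ r in (k : ℝ)..((k + 1 : ℕ) : ℝ), W r| ≤ η := by
    intro k hk
    have hkN : (k : ℝ) + 1 ≤ N := by exact_mod_cast Finset.mem_range.1 hk
    push_cast
    have hg0 : ∫ r in (k : ℝ)..(k + 1), g r = 0 := by
      rw [intervalIntegral.integral_sub ((continuous_coe_comp q).intervalIntegrable _ _)
        intervalIntegrable_const, UnitAddCircle.intervalIntegral_preimage (k : ℝ) (fun t => q t),
        ← meanC_apply, ← hm]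
      simp
    -- Subtracting the constant `D (k / N)` is free because `g` integrates to zero over a period.
    have e4 : ∫ r in (k : ℝ)..(k + 1), W r = ∫ r in (k : ℝ)..(k + 1),
        g r * (D ((r / N : ℝ) : UnitAddCircle) - D ((k / N : ℝ) : UnitAddCircle)) := by
      have : ∀ r, g r * (D ((r / N : ℝ) : UnitAddCircle) - D ((k / N : ℝ) : UnitAddCircle)) =
          W r - g r * D ((k / N : ℝ) : UnitAddCircle) := fun r => by simp only [W]; ring
      have hgc : Continuous fun r => g r * D ((k / N : ℝ) : UnitAddCircle) :=
        hg.mul continuous_const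
      simp only [this]
      rw [intervalIntegral.integral_sub (hW.intervalIntegrable _ _)
        (hgc.intervalIntegrable _ _), intervalIntegral.integral_mul_const,
        hg0, zero_mul, sub_zero]
    rw [e4]
    have h5 := intervalIntegral.norm_integral_le_of_norm_le_const (a := (k : ℝ)) (b := k + 1)
      (f := fun r => g r * (D ((r / N : ℝ) : UnitAddCircle) - D ((k / N : ℝ) : UnitAddCircle)))
      (C := η) (fun r hr => by
        rw [uIoc_of_le (by linarith)] at hr
        rw [norm_mul]
        have hk0 : (0 : ℝ) ≤ k := k.cast_nonneg
        have h6 : (r / N : ℝ) ∈ Icc (0 : ℝ) 1 :=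
          ⟨div_nonneg (hk0.trans hr.1.le) hNpos.le, (div_le_one hNpos).2 (hr.2.trans hkN)⟩
        have h7 : (k / N : ℝ) ∈ Icc (0 : ℝ) 1 :=
          ⟨div_nonneg hk0 hNpos.le, (div_le_one hNpos).2 (by linarith)⟩
        have h8 : dist (r / N : ℝ) (k / N : ℝ) < δ := by
          rw [Real.dist_eq, ← sub_div, abs_of_nonneg (div_nonneg (by linarith [hr.1]) hNpos.le)]
          refine lt_of_le_of_lt ?_ hstep
          gcongr
          linarith [hr.2]
        have h9 := (hδD _ h6 _ h7 h8).le
        rw [Real.dist_eq] at h9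
        calc ‖g r‖ * ‖D ((r / N : ℝ) : UnitAddCircle) - D ((k / N : ℝ) : UnitAddCircle)‖
            ≤ 1 * η := mul_le_mul (hgb r) h9 (norm_nonneg _) zero_le_one
          _ = η := one_mul η)
    simpa using h5
  rw [e1, e2, e3, abs_mul, abs_of_pos (inv_pos.2 hNpos)]
  calc (N : ℝ)⁻¹ * |∑ k ∈ Finset.range N, ∫ r in (k : ℝ)..((k + 1 : ℕ) : ℝ), W r|
      ≤ (N : ℝ)⁻¹ * ∑ k ∈ Finset.range N, η := by
        gcongr
        exact (Finset.abs_sum_le_sum_abs _ _).trans (Finset.sum_le_sum hpiece)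
    _ = η := by
        rw [Finset.sum_const, Finset.card_range, nsmul_eq_mul, ← mul_assoc,
          inv_mul_cancel₀ hNpos.ne', one_mul]

/-! ### A path of smoothed characteristic functions -/

/-- The function `cos (2 π t)` on the circle. -/
def cosCircle : C0 :=
  ⟨Function.Periodic.lift (f := fun r : ℝ => Real.cos (2 * Real.pi * r)) (c := 1) (fun r => by
      simp only
      rw [mul_add, mul_one, Real.cos_add_two_pi]),
    continuous_coinduced_dom.2 (by
      change Continuous fun r : ℝ => Real.cos (2 * Real.pi * r)
      fun_prop)⟩

lemma cosCircle_coe (r : ℝ) : cosCircle (r : UnitAddCircle) = Real.cos (2 * Real.pi * r) := rfl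

lemma cosCircle_mem (t : UnitAddCircle) : cosCircle t ∈ Icc (-1 : ℝ) 1 := by
  induction t using QuotientAddGroup.induction_on with | _ r
  exact ⟨Real.neg_one_le_cos _, Real.cos_le_one _⟩

/-- A trapezoidal function, equal to `1` on `[0, 1]` and to `0` outside `[-1, 2]`. -/
def trapezoid (x : ℝ) : ℝ := max 0 (min 1 (min (x + 1) (2 - x)))

lemma continuous_trapezoid : Continuous trapezoid := by unfold trapezoid; fun_prop

lemma trapezoid_mem (x : ℝ) : trapezoid x ∈ Icc (0 : ℝ) 1 :=
  ⟨le_max_left _ _, max_le zero_le_one (min_le_left _ _)⟩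

lemma trapezoid_eq_one {x : ℝ} (h0 : 0 ≤ x) (h1 : x ≤ 1) : trapezoid x = 1 := by
  rw [trapezoid, min_eq_left (le_min (by linarith) (by linarith)), max_eq_right zero_le_one]

lemma trapezoid_eq_zero_of_le {x : ℝ} (h : x ≤ -1) : trapezoid x = 0 :=
  max_eq_left ((min_le_right _ _).trans ((min_le_left _ _).trans (by linarith)))

lemma trapezoid_eq_zero_of_ge {x : ℝ} (h : 2 ≤ x) : trapezoid x = 0 :=
  max_eq_left ((min_le_right _ _).trans ((min_le_right _ _).trans (by linarith)))

/-- A function concentrated around the level `l` of `cos (2 π t)`. -/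
def levelBump (ε l : ℝ) : C0 :=
  ⟨fun t => trapezoid ((l - cosCircle t) / ε), continuous_trapezoid.comp (by fun_prop)⟩

/-- The bump lives where `cos (2 π t)` is between `l - 2ε` and `l + ε`. On half a period this is an
interval whose length is a difference of values of `arccos`, small uniformly in `l` by uniform
continuity. -/
lemma exists_levelBump_le {η : ℝ} (hη : 0 < η) : ∃ ε > 0, ∀ l, meanC (levelBump ε l) ≤ η := by
  have huc : UniformContinuous (fun x : ℝ => Real.arccos x) := by
    have h1 : UniformContinuous (fun x : Icc (-1 : ℝ) 1 => Real.arccos x) :=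
      CompactSpace.uniformContinuous_of_continuous (by fun_prop)
    have h2 : UniformContinuous (projIcc (-1 : ℝ) 1 (by norm_num)) :=
      (LipschitzWith.projIcc _).uniformContinuous
    have h3 : (fun x : ℝ => Real.arccos x) =
        (fun x : Icc (-1 : ℝ) 1 => Real.arccos x) ∘ projIcc (-1 : ℝ) 1 (by norm_num) := by
      ext x
      simp only [Function.comp_apply, Real.arccos, Real.arcsin_projIcc]
    rw [h3]
    exact h1.comp h2
  obtain ⟨δ, hδ, hδa⟩ := Metric.uniformContinuous_iff.1 huc (2 * Real.pi * (η / 2))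
    (by positivity)
  refine ⟨δ / 4, by positivity, fun l => ?_⟩
  set ε := δ / 4 with hε
  have hε0 : 0 < ε := by positivity
  let w : ℝ → ℝ := fun r => levelBump ε l (r : UnitAddCircle)
  have hw : ∀ r, w r = trapezoid ((l - Real.cos (2 * Real.pi * r)) / ε) := fun r => rfl
  have hwc : Continuous w := continuous_coe_comp _
  have hint : ∀ a b, IntervalIntegrable w volume a b := fun a b => hwc.intervalIntegrable a b
  have hsymm : ∫ r in (1 / 2 : ℝ)..1, w r = ∫ r in (0 : ℝ)..(1 / 2), w r := by
    have h1 := intervalIntegral.integral_comp_sub_left w (a := 0) (b := 1 / 2) (1 : ℝ)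
    have h2 : ∀ r, w (1 - r) = w r := fun r => by
      rw [hw, hw, mul_sub, mul_one, Real.cos_two_pi_sub]
    simp only [h2] at h1
    rw [h1]
    norm_num
  have hpi := Real.pi_pos
  set A := Real.arccos (l + ε) / (2 * Real.pi) with hA
  set B := Real.arccos (l - 2 * ε) / (2 * Real.pi) with hB
  have hA0 : 0 ≤ A := div_nonneg (Real.arccos_nonneg _) (by positivity)
  have hAB : A ≤ B := by
    exact div_le_div_of_nonneg_right (Real.antitone_arccos (by linarith)) (by positivity)
  have hB1 : B ≤ 1 / 2 := by
    rw [hB, div_le_iff₀ (by positivity)]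
    linarith [Real.arccos_le_pi (l - 2 * ε)]
  have hBA : B - A ≤ η / 2 := by
    have h1 : dist (l - 2 * ε) (l + ε) < δ := by
      rw [Real.dist_eq, abs_lt]
      constructor <;> linarith
    have h2 := hδa h1
    rw [Real.dist_eq] at h2
    rw [hA, hB, ← sub_div, div_le_iff₀ (by positivity)]
    linarith [le_abs_self (Real.arccos (l - 2 * ε) - Real.arccos (l + ε))]
  have hz1 : ∫ r in (0 : ℝ)..A, w r = 0 := by
    rw [intervalIntegral.integral_congr_Ioo_of_le hA0 (g := fun _ => (0 : ℝ)),
      intervalIntegral.integral_zero]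
    intro r hr
    rw [hw]
    refine trapezoid_eq_zero_of_le ?_
    rw [div_le_iff₀ hε0]
    by_contra! hlt
    have h1 : Real.arccos (l + ε) ≤ Real.arccos (Real.cos (2 * Real.pi * r)) :=
      Real.antitone_arccos (by linarith)
    rw [Real.arccos_cos (by have := hr.1; positivity)
      (by nlinarith [hr.2.trans_le (hAB.trans hB1)])] at h1
    refine hr.2.not_ge ?_
    rw [hA, div_le_iff₀ (by positivity)]
    linarith
  have hz2 : ∫ r in B..(1 / 2 : ℝ), w r = 0 := by
    rw [intervalIntegral.integral_congr_Ioo_of_le hB1 (g := fun _ => (0 : ℝ)),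
      intervalIntegral.integral_zero]
    intro r hr
    rw [hw]
    refine trapezoid_eq_zero_of_ge ?_
    rw [le_div_iff₀ hε0]
    by_contra! hlt
    have h1 : Real.arccos (Real.cos (2 * Real.pi * r)) ≤ Real.arccos (l - 2 * ε) :=
      Real.antitone_arccos (by linarith)
    have hr0 : 0 ≤ r := (hA0.trans hAB).trans hr.1.le
    rw [Real.arccos_cos (by positivity) (by nlinarith [hr.2])] at h1
    refine hr.1.not_ge ?_
    rw [hB, le_div_iff₀ (by positivity)]
    linarith
  have hz3 : ∫ r in A..B, w r ≤ B - A := by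
    have := intervalIntegral.integral_mono_on hAB (hint A B)
      (intervalIntegrable_const (c := (1 : ℝ))) (fun r _ => (trapezoid_mem _).2)
    simpa using this
  rw [meanC_eq_interval, ← intervalIntegral.integral_add_adjacent_intervals (hint 0 (1 / 2))
    (hint (1 / 2) 1)]
  change (∫ r in (0 : ℝ)..(1 / 2), w r) + (∫ r in (1 / 2 : ℝ)..1, w r) ≤ η
  rw [hsymm, ← intervalIntegral.integral_add_adjacent_intervals (hint 0 A) (hint A (1 / 2)),
    ← intervalIntegral.integral_add_adjacent_intervals (hint A B) (hint B (1 / 2)), hz1, hz2]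
  linarith

/-- A smoothed characteristic function of the set where `cos (2 π t) ≤ l`. -/
def smoothStep (ε l : ℝ) : C0 :=
  ⟨fun t => Real.smoothTransition ((l - cosCircle t) / ε),
    Real.smoothTransition.continuous.comp (by fun_prop)⟩

lemma smoothStep_mem (ε l : ℝ) (t : UnitAddCircle) : smoothStep ε l t ∈ Icc (0 : ℝ) 1 :=
  ⟨Real.smoothTransition.nonneg _, Real.smoothTransition.le_one _⟩

/-- The bump equals `1` on the transition zone of the step, so its average controls the measure of
that zone. -/
lemma smoothStep_cases {ε l : ℝ} (t : UnitAddCircle) :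
    smoothStep ε l t = 0 ∨ smoothStep ε l t = 1 ∨ levelBump ε l t = 1 := by
  set x := (l - cosCircle t) / ε with hx
  rcases le_total x 0 with h0 | h0
  · exact Or.inl (Real.smoothTransition.zero_of_nonpos h0)
  · rcases le_total 1 x with h1 | h1
    · exact Or.inr (Or.inl (Real.smoothTransition.one_of_one_le h1))
    · exact Or.inr (Or.inr (trapezoid_eq_one h0 h1))

lemma continuous_scale_smoothStep (N : ℕ) (ε : ℝ) {l : ℝ → ℝ} (hl : Continuous l) :
    Continuous fun s => scale N (smoothStep ε (l s)) := by
  refine ContinuousMap.continuous_of_continuous_uncurry _ ?_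
  change Continuous fun p : ℝ × UnitAddCircle =>
    Real.smoothTransition ((l p.1 - cosCircle (N • p.2)) / ε)
  exact Real.smoothTransition.continuous.comp (by fun_prop)

lemma isC1_scale_smoothStep (N : ℕ) (ε l : ℝ) : IsC1 (scale N (smoothStep ε l)) := by
  have hσd : Differentiable ℝ Real.smoothTransition :=
    (Real.smoothTransition.contDiff (n := 1)).differentiable (by simp)
  have hσc : Continuous (deriv Real.smoothTransition) :=
    (Real.smoothTransition.contDiff (n := 1)).continuous_deriv (by simp)
  let sinN : C0 :=
    ⟨Function.Periodic.lift (f := fun r : ℝ => Real.sin (2 * Real.pi * (N * r))) (c := 1)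
      (fun r => by
        simp only
        rw [show 2 * Real.pi * (N * (r + 1)) = 2 * Real.pi * (N * r) + N * (2 * Real.pi) by ring,
          Real.sin_add_nat_mul_two_pi]),
      continuous_coinduced_dom.2 (by
        change Continuous fun r : ℝ => Real.sin (2 * Real.pi * (N * r))
        fun_prop)⟩
  refine ⟨⟨fun t => deriv Real.smoothTransition ((l - cosCircle (N • t)) / ε) *
    (2 * Real.pi * N * sinN t / ε), (hσc.comp (by fun_prop)).mul (by fun_prop)⟩, fun r => ?_⟩
  have h1 : HasDerivAt (fun r : ℝ => (l - Real.cos (2 * Real.pi * (N * r))) / ε)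
      (2 * Real.pi * N * Real.sin (2 * Real.pi * (N * r)) / ε) r := by
    have h2 : HasDerivAt (fun r : ℝ => 2 * Real.pi * (N * r)) (2 * Real.pi * N) r := by
      simpa using ((hasDerivAt_id r).const_mul (N : ℝ)).const_mul (2 * Real.pi)
    refine ((h2.cos.const_sub l).div_const ε).congr_deriv ?_
    ring
  have hcos : ∀ r : ℝ, cosCircle (N • (r : UnitAddCircle)) = Real.cos (2 * Real.pi * (N * r)) :=
    fun r => by rw [← AddCircle.coe_nsmul, nsmul_eq_mul, cosCircle_coe]
  have h3 := (hσd _).hasDerivAt.comp r h1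
  refine (h3.congr_deriv ?_).congr_of_eventuallyEq (Filter.Eventually.of_forall fun r => ?_)
  · change _ = deriv Real.smoothTransition ((l - cosCircle (N • (r : UnitAddCircle))) / ε) * _
    rw [hcos]
    rfl
  · change Real.smoothTransition ((l - cosCircle (N • (r : UnitAddCircle))) / ε) = _
    rw [hcos]
    rfl

lemma scale_zero_smoothStep {N : ℕ} {ε l : ℝ} (hε : 0 < ε) (hl : l ≤ -1) :
    scale N (smoothStep ε l) = 0 := by
  ext t
  refine Real.smoothTransition.zero_of_nonpos (div_nonpos_of_nonpos_of_nonneg ?_ hε.le)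
  linarith [(cosCircle_mem (N • t)).1]

lemma scale_one_smoothStep {N : ℕ} {ε l : ℝ} (hε : 0 < ε) (hl : 1 + ε ≤ l) :
    scale N (smoothStep ε l) = 1 := by
  ext t
  refine Real.smoothTransition.one_of_one_le ((one_le_div hε).2 ?_)
  linarith [(cosCircle_mem (N • t)).2]

lemma abs_meanC_le_of_abs_le {u v : C0} (h : ∀ t, |u t| ≤ v t) : |meanC u| ≤ meanC v := by
  refine abs_le.2 ⟨?_, meanC_mono fun t => (le_abs_self _).trans (h t)⟩
  rw [← map_neg]
  exact meanC_mono fun t => neg_le.1 ((neg_le_abs _).trans (h t))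

/-- The error made when the average of `H (t, θ (t))` is replaced by its interpolation between the
values `0` and `1` of `θ`, for a rapidly oscillating function `θ`. -/
lemma abs_meanC_mixing_le (H : C(UnitAddCircle × ℝ, ℝ)) {η M : ℝ}
    (hM : ∀ u : C0, (∀ t, u t ∈ Icc (0 : ℝ) 1) → ∀ t, |H (t, u t)| ≤ M) {N : ℕ} {ε l : ℝ}
    (hbump : meanC (levelBump ε l) ≤ η)
    (h1 : ∀ q : C0, (∀ t, q t ∈ Icc (0 : ℝ) 1) → |meanC (scale N q * 1) - meanC q * meanC 1| ≤ η)
    (hD : ∀ q : C0, (∀ t, q t ∈ Icc (0 : ℝ) 1) →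
      |meanC (scale N q * (nemytskii H 1 - nemytskii H 0)) -
        meanC q * meanC (nemytskii H 1 - nemytskii H 0)| ≤ η) :
    |meanC (nemytskii H (scale N (smoothStep ε l))) -
      ((1 - meanC (smoothStep ε l)) * meanC (nemytskii H 0) +
        meanC (smoothStep ε l) * meanC (nemytskii H 1))| ≤ (4 * M + 1) * η := by
  set q := smoothStep ε l with hq
  set m := meanC q with hm
  set θ := scale N q with hθ
  set w := levelBump ε l with hw
  have hM0 : 0 ≤ M := (abs_nonneg _).trans (hM 0 (fun _ => ⟨le_rfl, zero_le_one⟩) 0)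
  have hθmem : ∀ t, θ t ∈ Icc (0 : ℝ) 1 := fun t => smoothStep_mem _ _ _
  -- Interpolation is exact where `θ` is `0` or `1` and is off by at most `2 * M` elsewhere. The
  -- scaled bump has average at most `2 * η`, so this contributes `4 * M * η`, and `hD` adds `η`.
  have hE : ∀ t, |(nemytskii H θ - nemytskii H 0 - θ * (nemytskii H 1 - nemytskii H 0)) t| ≤
      ((2 * M) • scale N w) t := by
    intro t
    have e0 : (nemytskii H 0) t = H (t, 0) := rfl
    have e1 : (nemytskii H 1) t = H (t, 1) := rfl
    have e2 : (nemytskii H θ) t = H (t, θ t) := rfl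
    simp only [ContinuousMap.sub_apply, ContinuousMap.mul_apply, ContinuousMap.smul_apply,
      smul_eq_mul, e0, e1, e2]
    have hwpos : 0 ≤ scale N w t := (trapezoid_mem _).1
    have b0 := hM 0 (fun _ => ⟨le_rfl, zero_le_one⟩) t
    have b1 := hM 1 (fun _ => ⟨zero_le_one, le_rfl⟩) t
    have b2 := hM θ hθmem t
    simp only [ContinuousMap.zero_apply] at b0
    simp only [ContinuousMap.one_apply] at b1
    rcases smoothStep_cases (ε := ε) (l := l) (N • t) with h | h | h
    · have : θ t = 0 := h
      rw [this]
      simp only [sub_self, zero_mul, abs_zero]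
      positivity
    · have : θ t = 1 := h
      rw [this]
      simp only [one_mul, sub_self, abs_zero]
      positivity
    · have : scale N w t = 1 := h
      rw [this, mul_one]
      have h01 := hθmem t
      have c0 := abs_le.1 b0
      have c1 := abs_le.1 b1
      have c2 := abs_le.1 b2
      rw [abs_le]
      constructor <;> nlinarith [h01.1, h01.2, c0.1, c0.2, c1.1, c1.2, c2.1, c2.2]
  have h2 := abs_meanC_le_of_abs_le hE
  have h3 := h1 w (fun t => trapezoid_mem _)
  have h4 := hD q (fun t => smoothStep_mem _ _ _)
  rw [mul_one, meanC_one, mul_one] at h3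
  rw [map_smul, smul_eq_mul, map_sub, map_sub] at h2
  rw [map_sub meanC (nemytskii H 1)] at h4
  have h5 : meanC (scale N w) ≤ 2 * η := by linarith [(abs_le.1 h3).2]
  have h6 : 2 * M * meanC (scale N w) ≤ 2 * M * (2 * η) := by gcongr
  have a1 := abs_le.1 h2
  have a2 := abs_le.1 h4
  rw [abs_le]
  constructor <;> nlinarith [a1.1, a1.2, a2.1, a2.2]

/-- A path of continuously differentiable functions with values in `[0, 1]`, from `0` to `1`, which
interpolates linearly the averages of two given functions. -/
lemma exists_mixing (H₁ H₂ : C(UnitAddCircle × ℝ, ℝ)) {ε : ℝ} (hε : 0 < ε) :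
    ∃ Θ : ℝ → C0, Continuous Θ ∧ Θ 0 = 0 ∧ Θ 1 = 1 ∧ (∀ s, IsC1 (Θ s)) ∧
      (∀ s t, Θ s t ∈ Icc (0 : ℝ) 1) ∧ ∀ s, ∃ m ∈ Icc (0 : ℝ) 1,
        |meanC (nemytskii H₁ (Θ s)) -
          ((1 - m) * meanC (nemytskii H₁ 0) + m * meanC (nemytskii H₁ 1))| ≤ ε ∧
        |meanC (nemytskii H₂ (Θ s)) -
          ((1 - m) * meanC (nemytskii H₂ 0) + m * meanC (nemytskii H₂ 1))| ≤ ε := by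
  have hbound : ∀ H : C(UnitAddCircle × ℝ, ℝ), ∃ M, 0 ≤ M ∧
      ∀ u : C0, (∀ t, u t ∈ Icc (0 : ℝ) 1) → ∀ t, |H (t, u t)| ≤ M := fun H => by
    obtain ⟨M, hM⟩ := exists_bound_nemytskii H 1
    have hM' : ∀ u : C0, (∀ t, u t ∈ Icc (0 : ℝ) 1) → ∀ t, |H (t, u t)| ≤ M := fun u hu =>
      hM u ((ContinuousMap.norm_le _ zero_le_one).2 fun t =>
        abs_le.2 ⟨by linarith [(hu t).1], (hu t).2⟩)
    exact ⟨M, (abs_nonneg _).trans (hM' 0 (fun _ => ⟨le_rfl, zero_le_one⟩) 0), hM'⟩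
  obtain ⟨M₁, hM₁0, hM₁⟩ := hbound H₁
  obtain ⟨M₂, hM₂0, hM₂⟩ := hbound H₂
  let η := ε / (4 * (M₁ + M₂) + 1)
  have hη : 0 < η := by positivity
  have hηε : (4 * (M₁ + M₂) + 1) * η = ε := mul_div_cancel₀ _ (by positivity)
  obtain ⟨r, hr, hbump⟩ := exists_levelBump_le hη
  obtain ⟨N₀, hN₀⟩ := eventually_abs_meanC_scale_mul_le 1 hη
  obtain ⟨N₁, hN₁⟩ := eventually_abs_meanC_scale_mul_le (nemytskii H₁ 1 - nemytskii H₁ 0) hη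
  obtain ⟨N₂, hN₂⟩ := eventually_abs_meanC_scale_mul_le (nemytskii H₂ 1 - nemytskii H₂ 0) hη
  let N := N₀ + N₁ + N₂
  -- The level runs from `-1`, where the step is identically `0`, to `1 + r`, where it is
  -- identically `1`.
  refine ⟨fun s => scale N (smoothStep r (-1 + (2 + r) * s)),
    continuous_scale_smoothStep N r (by fun_prop), scale_zero_smoothStep hr (by simp),
    scale_one_smoothStep hr (by linarith), fun s => isC1_scale_smoothStep _ _ _,
    fun s t => smoothStep_mem _ _ _, fun s => ⟨meanC (smoothStep r (-1 + (2 + r) * s)), ?_, ?_, ?_⟩⟩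
  · constructor
    · exact (map_zero meanC).symm.le.trans
        (meanC_mono (u := 0) (v := smoothStep _ _) fun t => (smoothStep_mem _ _ t).1)
    · exact (meanC_mono (u := smoothStep _ _) (v := 1) fun t => (smoothStep_mem _ _ t).2).trans
        meanC_one.le
  · refine (abs_meanC_mixing_le H₁ hM₁ (hbump _) (hN₀ N (by omega)) (hN₁ N (by omega))).trans ?_
    rw [← hηε]
    gcongr
    linarith
  · refine (abs_meanC_mixing_le H₂ hM₂ (hbump _) (hN₀ N (by omega)) (hN₂ N (by omega))).trans ?_
    rw [← hηε]
    gcongr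
    linarith

/-! ### Connecting critical points -/

lemma exists_modulus_nemytskii (f : C(UnitAddCircle × ℝ, ℝ)) (B : ℝ) {ε : ℝ} (hε : 0 < ε) :
    ∃ δ > 0, ∀ u v : C0, ‖u‖ ≤ B → ‖v - u‖ ≤ δ → ‖nemytskii f v - nemytskii f u‖ ≤ ε := by
  have hK : IsCompact ((univ : Set UnitAddCircle) ×ˢ Icc (-(B + 1)) (B + 1)) :=
    isCompact_univ.prod isCompact_Icc
  obtain ⟨δ, hδ, h⟩ := Metric.uniformContinuousOn_iff.1
    (hK.uniformContinuousOn_of_continuous f.continuous.continuousOn) ε hε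
  refine ⟨min (δ / 2) 1, by positivity, fun u v hu hv => ?_⟩
  refine (ContinuousMap.norm_le _ hε.le).2 fun t => ?_
  have h1 : |u t| ≤ B := (u.norm_coe_le_norm t).trans hu
  have h2 : |v t - u t| ≤ min (δ / 2) 1 := ((v - u).norm_coe_le_norm t).trans hv
  have h3 := h2.trans (min_le_left _ _)
  have h4 := h2.trans (min_le_right _ _)
  have a1 := abs_le.1 h1
  have a4 := abs_le.1 h4
  have h5 := h (t, v t) ⟨mem_univ _, by constructor <;> linarith⟩ (t, u t)
    ⟨mem_univ _, by constructor <;> linarith⟩ (by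
      rw [Prod.dist_eq, dist_self, Real.dist_eq, max_lt_iff]
      exact ⟨hδ, by linarith⟩)
  exact h5.le

/-- Zeros of a continuous family of increasing functions form a continuous curve. -/
lemma exists_continuous_zero {h : ℝ → ℝ → ℝ} (hc : Continuous fun p : ℝ × ℝ => h p.1 p.2) {r : ℝ}
    (hr : 0 < r) (hmono : ∀ s, StrictMonoOn (h s) (Icc (-r) r)) (hneg : ∀ s, h s (-r) < 0)
    (hpos : ∀ s, 0 < h s r) :
    ∃ τ : ℝ → ℝ, Continuous τ ∧ ∀ s, τ s ∈ Icc (-r) r ∧ h s (τ s) = 0 := by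
  have hcs : ∀ s, Continuous (h s) := fun s => hc.comp (Continuous.prodMk_right s)
  have hct : ∀ t, Continuous fun s => h s t := fun t => hc.comp (Continuous.prodMk_left t)
  have hex : ∀ s, ∃ t ∈ Icc (-r) r, h s t = 0 := fun s =>
    intermediate_value_Icc (by linarith) (hcs s).continuousOn ⟨(hneg s).le, (hpos s).le⟩
  choose τ hτ hτ0 using hex
  refine ⟨τ, continuous_iff_continuousAt.2 fun s₀ => ?_, fun s => ⟨hτ s, hτ0 s⟩⟩
  refine tendsto_order.2 ⟨fun a ha => ?_, fun b hb => ?_⟩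
  · by_cases har : a < -r
    · exact Filter.Eventually.of_forall fun s => har.trans_le (hτ s).1
    · have ham : a ∈ Icc (-r) r := ⟨not_lt.1 har, ha.le.trans (hτ s₀).2⟩
      have h1 : h s₀ a < 0 := hτ0 s₀ ▸ hmono s₀ ham (hτ s₀) ha
      filter_upwards [(hct a).continuousAt.eventually (gt_mem_nhds h1)] with s hs
      rw [← hτ0 s] at hs
      exact (hmono s).lt_iff_lt ham (hτ s) |>.1 hs
  · by_cases hbr : r < b
    · exact Filter.Eventually.of_forall fun s => (hτ s).2.trans_lt hbr
    · have hbm : b ∈ Icc (-r) r := ⟨(hτ s₀).1.trans hb.le, not_lt.1 hbr⟩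
      have h1 : 0 < h s₀ b := hτ0 s₀ ▸ hmono s₀ (hτ s₀) hbm hb
      filter_upwards [(hct b).continuousAt.eventually (lt_mem_nhds h1)] with s hs
      rw [← hτ0 s] at hs
      exact (hmono s).lt_iff_lt (hτ s) hbm |>.1 hs

lemma hasDerivAt_sigma1_line (hf : IsSmooth f) (u v : C0) (r : ℝ) :
    HasDerivAt (fun r : ℝ => sigma1 f (u + r • v))
      (meanC (nemytskii (partialX (partialX f hf) (isSmooth_partialX hf)) (u + r • v) * v)) r := by
  have h1 : HasDerivAt (fun r : ℝ => u + r • v) v r := by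
    simpa using ((hasDerivAt_id r).smul_const v).const_add u
  exact (hasFDerivAt_sigma1 hf _).comp_hasDerivAt r h1

/-- Two zeros of `Σ₁` at which `Σ₂` has opposite signs are connected by a path of zeros of `Σ₁`, and
hence there is a common zero of `Σ₁` and `Σ₂`. -/
theorem exists_common_zero (hf : IsSmooth f) {u₀ u₁ : C0} (hu₀ : IsC1 u₀) (hu₁ : IsC1 u₁)
    (h₀ : sigma1 f u₀ = 0) (h₁ : sigma1 f u₁ = 0) (hpos : 0 < sigma2 f hf u₀)
    (hneg : sigma2 f hf u₁ < 0) : ∃ u, IsC1 u ∧ sigma1 f u = 0 ∧ sigma2 f hf u = 0 := by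
  set g := partialX f hf with hg
  set b := partialX g (isSmooth_partialX hf) with hb
  -- The derivative of `Σ₁` at `u₀` along `φ₀` is `Σ₂ u₀`, and at `u₁` along `φ₁` it is `-Σ₂ u₁`;
  -- the sign in `φ₁` makes both positive.
  let φ₀ : C0 := negExp (prim (nemytskii g u₀))
  let φ₁ : C0 := -negExp (prim (nemytskii g u₁))
  have hφ₀ : IsC1 φ₀ := (isC1_prim _).negExp
  have hφ₁ : IsC1 φ₁ := (isC1_prim _).negExp.neg
  let δ := min (sigma2 f hf u₀) (-sigma2 f hf u₁)
  have hδ : 0 < δ := lt_min hpos (by linarith)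
  have hp₀ : δ ≤ meanC (nemytskii b u₀ * φ₀) := min_le_left _ _
  have hp₁ : δ ≤ meanC (nemytskii b u₁ * φ₁) := by
    have : meanC (nemytskii b u₁ * φ₁) = -sigma2 f hf u₁ := by
      change meanC (nemytskii b u₁ * -negExp (prim (nemytskii g u₁))) = _
      rw [mul_neg, map_neg]
      rfl
    rw [this]
    exact min_le_right _ _
  let P : C0 → C0 := fun Θ => u₀ + Θ * (u₁ - u₀)
  let Q : C0 → C0 := fun Θ => φ₀ + Θ * (φ₁ - φ₀)
  have hPc : Continuous P := by fun_prop
  have hQc : Continuous Q := by fun_prop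
  have hnorm : ∀ v w Θ : C0, (∀ t, Θ t ∈ Icc (0 : ℝ) 1) → ‖v + Θ * w‖ ≤ ‖v‖ + ‖w‖ :=
    fun v w Θ hΘ => by
      have h1 : ‖Θ‖ ≤ 1 := (ContinuousMap.norm_le _ zero_le_one).2 fun t =>
        abs_le.2 ⟨by linarith [(hΘ t).1], (hΘ t).2⟩
      calc ‖v + Θ * w‖ ≤ ‖v‖ + ‖Θ * w‖ := norm_add_le _ _
        _ ≤ ‖v‖ + ‖Θ‖ * ‖w‖ := by gcongr; exact norm_mul_le _ _
        _ ≤ ‖v‖ + 1 * ‖w‖ := by gcongr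
        _ = _ := by rw [one_mul]
  let B := ‖u₀‖ + ‖u₁ - u₀‖
  let R := ‖φ₀‖ + ‖φ₁ - φ₀‖ + 1
  have hR : 0 < R := by positivity
  obtain ⟨ρ, hρ, hmod⟩ := exists_modulus_nemytskii b B (ε := δ / (4 * R)) (by positivity)
  let r := ρ / R
  have hr : 0 < r := by positivity
  -- The bound `δ / 4` keeps the derivative of `Σ₁` along `Q` above `3 δ / 4` on the path; `r * δ /
  -- 4` is less than the growth `r * δ / 2` available within `|τ| ≤ r`.
  let ε := min (δ / 4) (r * δ / 4)
  have hε : 0 < ε := by positivity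
  let H₁ : C(UnitAddCircle × ℝ, ℝ) :=
    ⟨fun p => g (p.1, u₀ p.1 + p.2 * (u₁ p.1 - u₀ p.1)), by fun_prop⟩
  let H₂ : C(UnitAddCircle × ℝ, ℝ) :=
    ⟨fun p => b (p.1, u₀ p.1 + p.2 * (u₁ p.1 - u₀ p.1)) * (φ₀ p.1 + p.2 * (φ₁ p.1 - φ₀ p.1)),
      by fun_prop⟩
  have hH₁ : ∀ Θ, nemytskii H₁ Θ = nemytskii g (P Θ) := fun Θ => rfl
  have hH₂ : ∀ Θ, nemytskii H₂ Θ = nemytskii b (P Θ) * Q Θ := fun Θ => rfl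
  have hP0 : P 0 = u₀ := by simp [P]
  have hP1 : P 1 = u₁ := by simp [P]
  have hQ0 : Q 0 = φ₀ := by simp [Q]
  have hQ1 : Q 1 = φ₁ := by simp [Q]
  obtain ⟨Θ, hΘc, hΘ0, hΘ1, hΘC1, hΘmem, hΘ⟩ := exists_mixing H₁ H₂ hε
  have hS1 : ∀ s, |sigma1 f (P (Θ s))| ≤ r * δ / 4 := fun s => by
    obtain ⟨m, -, h, -⟩ := hΘ s
    rw [hH₁, hH₁, hH₁, hP0, hP1, ← sigma1_eq hf, ← sigma1_eq hf, ← sigma1_eq hf, h₀, h₁, mul_zero,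
      mul_zero, add_zero, sub_zero] at h
    exact h.trans (min_le_right _ _)
  have hS2 : ∀ s, δ - δ / 4 ≤ meanC (nemytskii b (P (Θ s)) * Q (Θ s)) := fun s => by
    obtain ⟨m, hm, -, h⟩ := hΘ s
    rw [hH₂, hH₂, hH₂, hP0, hP1, hQ0, hQ1] at h
    have h1 := (abs_le.1 (h.trans (min_le_left _ _))).1
    nlinarith [hm.1, hm.2]
  have hder : ∀ s, ∀ τ ∈ Icc (-r) r,
      δ / 2 ≤ meanC (nemytskii b (P (Θ s) + τ • Q (Θ s)) * Q (Θ s)) := fun s τ hτ => by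
    have hQR : ‖Q (Θ s)‖ ≤ R := (hnorm _ _ _ (hΘmem s)).trans (by simp only [R]; linarith)
    have h1 : ‖P (Θ s) + τ • Q (Θ s) - P (Θ s)‖ ≤ ρ := by
      rw [add_sub_cancel_left, norm_smul]
      calc ‖τ‖ * ‖Q (Θ s)‖ ≤ r * R := by
            gcongr
            exact abs_le.2 hτ
        _ = ρ := div_mul_cancel₀ _ hR.ne'
    have h2 := hmod (P (Θ s)) _ (hnorm _ _ _ (hΘmem s)) h1
    have h3 : |meanC ((nemytskii b (P (Θ s) + τ • Q (Θ s)) - nemytskii b (P (Θ s))) * Q (Θ s))| ≤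
        δ / 4 := by
      refine (abs_meanC_le _).trans ((norm_mul_le _ _).trans ?_)
      calc _ ≤ δ / (4 * R) * R := mul_le_mul h2 hQR (norm_nonneg _) (by positivity)
        _ = δ / 4 := by field_simp
    rw [sub_mul, map_sub] at h3
    linarith [(abs_le.1 h3).1, hS2 s]
  -- Moving by `τ` along `Q` increases `Σ₁` at rate at least `δ / 2`, so a unique small `τ s`
  -- restores `Σ₁ = 0`. It is `0` at the ends, where `Σ₁` already vanishes.
  let h : ℝ → ℝ → ℝ := fun s τ => sigma1 f (P (Θ s) + τ • Q (Θ s))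
  have hPΘ : Continuous fun s => P (Θ s) := hPc.comp hΘc
  have hQΘ : Continuous fun s => Q (Θ s) := hQc.comp hΘc
  have hpath : Continuous fun p : ℝ × ℝ => P (Θ p.1) + p.2 • Q (Θ p.1) :=
    (hPΘ.comp continuous_fst).add (continuous_snd.smul (hQΘ.comp continuous_fst))
  have hhc : Continuous fun p : ℝ × ℝ => h p.1 p.2 := (continuous_sigma1 hf).comp hpath
  have hhd : ∀ s τ, HasDerivAt (h s)
      (meanC (nemytskii b (P (Θ s) + τ • Q (Θ s)) * Q (Θ s))) τ := fun s τ =>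
    hasDerivAt_sigma1_line hf _ _ τ
  have hhcs : ∀ s, Continuous (h s) := fun s =>
    continuous_iff_continuousAt.2 fun τ => (hhd s τ).continuousAt
  have hh0 : ∀ s, h s 0 = sigma1 f (P (Θ s)) := fun s => by simp only [h, zero_smul, add_zero]
  have hgrow : ∀ s, ∀ x ∈ Icc (-r) r, ∀ y ∈ Icc (-r) r, x ≤ y →
      δ / 2 * (y - x) ≤ h s y - h s x := fun s =>
    (convex_Icc (-r) r).mul_sub_le_image_sub_of_le_deriv (hhcs s).continuousOn
      (fun τ _ => (hhd s τ).differentiableAt.differentiableWithinAt) fun τ hτ => by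
        rw [(hhd s τ).deriv]
        exact hder s τ (interior_subset hτ)
  have hmono : ∀ s, StrictMonoOn (h s) (Icc (-r) r) := fun s x hx y hy hxy => by
    have := hgrow s x hx y hy hxy.le
    have : 0 < δ / 2 * (y - x) := mul_pos (by positivity) (sub_pos.2 hxy)
    linarith
  have hm0 : (0 : ℝ) ∈ Icc (-r) r := ⟨by linarith, hr.le⟩
  have hrδ : 0 < r * δ := by positivity
  obtain ⟨τ, hτc, hτ⟩ := exists_continuous_zero hhc hr hmono
    (fun s => by
      have h1 := hgrow s (-r) ⟨le_rfl, by linarith⟩ 0 hm0 (by linarith)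
      have h2 := (abs_le.1 (hS1 s)).2
      rw [hh0] at h1
      nlinarith)
    (fun s => by
      have h1 := hgrow s 0 hm0 r ⟨by linarith, le_rfl⟩ hr.le
      have h2 := (abs_le.1 (hS1 s)).1
      rw [hh0] at h1
      nlinarith)
  have hτend : ∀ s, sigma1 f (P (Θ s)) = 0 → τ s = 0 := fun s hs =>
    (hmono s).injOn (hτ s).1 hm0 (by rw [(hτ s).2, hh0, hs])
  let U : ℝ → C0 := fun s => P (Θ s) + τ s • Q (Θ s)
  have hUc : Continuous U := hpath.comp (continuous_id.prodMk hτc)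
  have hU0 : U 0 = u₀ := by
    simp only [U]
    rw [hτend 0 (by rw [hΘ0, hP0, h₀]), hΘ0, hP0, zero_smul, add_zero]
  have hU1 : U 1 = u₁ := by
    simp only [U]
    rw [hτend 1 (by rw [hΘ1, hP1, h₁]), hΘ1, hP1, zero_smul, add_zero]
  obtain ⟨s, hs⟩ := mem_range_of_exists_le_of_exists_ge
    (((continuous_sigma2 hf).comp hUc)) (c := 0) ⟨1, by simp [hU1, hneg.le]⟩
    ⟨0, by simp [hU0, hpos.le]⟩
  refine ⟨U s, ?_, (hτ s).2, hs⟩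
  exact (hu₀.add ((hΘC1 s).mul (hu₁.sub hu₀))).add
    ((hφ₀.add ((hΘC1 s).mul (hφ₁.sub hφ₀))).smul (τ s))

/-! ### Critical points have the same type -/

section CriticalPoints

variable (hf : IsSmooth f) (hproper : IsProperMap f)

lemma continuous_avgSlope : Continuous (avgSlope hf hproper) := by
  have h := (contDiff_psi_symm hf hproper).continuous
  exact ((Real.continuous_exp.comp ((continuous_sigma1 hf).comp h)).sub continuous_const).div
    (continuous_expWeight.comp ((continuous_nemytskii _).comp h)) fun V => (expWeight_pos _).ne'

lemma isC1_psi_symm {V : C0} (hV : IsC1 V) : IsC1 ((psiEquiv hf hproper).symm V) := by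
  have h := psi_symm hf hproper V
  rw [psi, ← eq_sub_iff_add_eq] at h
  rw [h]
  exact hV.sub (isC1_prim _)

/-- A nondegenerate critical point can be moved to a continuously differentiable one. -/
lemma exists_isC1_critical {V : C0} (hV : V ∈ closure {V | IsC1 V})
    (h0 : sigma1 f ((psiEquiv hf hproper).symm V) = 0) {s : ℝ}
    (hs : 0 < s * sigma2 f hf ((psiEquiv hf hproper).symm V)) :
    ∃ u, IsC1 u ∧ sigma1 f u = 0 ∧ 0 < s * sigma2 f hf u := by
  have hcont2 : Continuous fun V => s * sigma2 f hf ((psiEquiv hf hproper).symm V) :=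
    continuous_const.mul ((continuous_sigma2 hf).comp (contDiff_psi_symm hf hproper).continuous)
  obtain ⟨r, hr, hball⟩ := Metric.eventually_nhds_iff_ball.1
    (hcont2.continuousAt.eventually (lt_mem_nhds hs))
  -- On the line through `V`, `φ` changes sign at `0`. The sign change between `-a` and `a` persists
  -- for nearby `W`, in particular for a `C¹` one, and gives a critical point close to `V`.
  let φ : C0 → ℝ → ℝ := fun W x => s * avgSlope hf hproper (W + x • 1)
  have hφc : ∀ W, Continuous (φ W) := fun W =>
    continuous_const.mul ((continuous_avgSlope hf hproper).comp (by fun_prop))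
  have hφW : ∀ x, Continuous fun W => φ W x := fun x =>
    continuous_const.mul ((continuous_avgSlope hf hproper).comp (by fun_prop))
  have hV0 : V + (0 : ℝ) • (1 : C0) = V := by simp
  have hd : HasDerivAt (φ V) (s * (sigma2 f hf ((psiEquiv hf hproper).symm V) /
      expWeight (nemytskii (partialX f hf) ((psiEquiv hf hproper).symm V)))) 0 := by
    have := (hasDerivAt_avgSlope hf hproper (V := V) (x := 0) (by rw [hV0]; exact h0)).const_mul s
    rwa [hV0] at this
  have hd0 : 0 < s * (sigma2 f hf ((psiEquiv hf hproper).symm V) /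
      expWeight (nemytskii (partialX f hf) ((psiEquiv hf hproper).symm V))) := by
    rw [← mul_div_assoc]
    exact div_pos hs (expWeight_pos _)
  have hφ0 : φ V 0 = 0 := by
    simp only [φ]
    rw [hV0, (avgSlope_eq_zero_iff hf hproper V).2 h0, mul_zero]
  have hslope : ∀ᶠ x in nhdsWithin (0 : ℝ) {0}ᶜ, 0 < x⁻¹ * φ V x := by
    filter_upwards [(hasDerivAt_iff_tendsto_slope.1 hd).eventually (lt_mem_nhds hd0)] with x hx
    rwa [slope_def_field, hφ0, sub_zero, sub_zero, div_eq_inv_mul] at hx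
  rw [eventually_nhdsWithin_iff] at hslope
  obtain ⟨ρ, hρ, hslope⟩ := Metric.eventually_nhds_iff_ball.1 hslope
  let a := min (ρ / 2) (r / 4)
  have ha : 0 < a := by positivity
  have haρ : a < ρ := (min_le_left _ _).trans_lt (by linarith)
  have har : a ≤ r / 4 := min_le_right _ _
  have hpos : 0 < φ V a := by
    have h := hslope a (by simpa [abs_of_pos ha] using haρ) ha.ne'
    exact (mul_pos_iff_of_pos_left (inv_pos.2 ha)).1 h
  have hneg : φ V (-a) < 0 := by
    have h := hslope (-a) (by simpa [abs_of_pos ha] using haρ) (neg_ne_zero.2 ha.ne')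
    rw [inv_neg, neg_mul, neg_pos] at h
    exact (pos_iff_neg_of_mul_neg h).1 (inv_pos.2 ha)
  have hev : ∀ᶠ W in nhds V, 0 < φ W a ∧ φ W (-a) < 0 ∧ W ∈ Metric.ball V (r / 2) :=
    ((hφW a).continuousAt.eventually (lt_mem_nhds hpos)).and
      (((hφW (-a)).continuousAt.eventually (gt_mem_nhds hneg)).and
        (Metric.ball_mem_nhds V (by positivity)))
  obtain ⟨W, hWC1, hW1, hW2, hW3⟩ := ((mem_closure_iff_frequently.1 hV).and_eventually hev).exists
  obtain ⟨x, hx, hx0⟩ := intermediate_value_Icc (by linarith : -a ≤ a) (hφc W).continuousOn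
    ⟨hW2.le, hW1.le⟩
  have hs0 : s ≠ 0 := fun h => by simp [h] at hs
  have hslope0 : avgSlope hf hproper (W + x • 1) = 0 :=
    (mul_eq_zero.1 hx0).resolve_left hs0
  refine ⟨(psiEquiv hf hproper).symm (W + x • 1),
    isC1_psi_symm hf hproper (hWC1.add (isC1_one.smul x)),
    (avgSlope_eq_zero_iff hf hproper _).1 hslope0, hball _ ?_⟩
  rw [Metric.mem_ball, dist_eq_norm]
  have h1 : ‖W - V‖ < r / 2 := by rw [← dist_eq_norm]; exact hW3
  have h2 : ‖x • (1 : C0)‖ ≤ r / 4 := by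
    rw [norm_smul, norm_one, mul_one]
    exact (abs_le.2 hx).trans har
  calc ‖W + x • 1 - V‖ = ‖(W - V) + x • (1 : C0)‖ := by congr 1; abel
    _ ≤ ‖W - V‖ + ‖x • (1 : C0)‖ := norm_add_le _ _
    _ < r := by linarith

/-- If no continuously differentiable function is a common zero of `Σ₁` and `Σ₂`, all critical
points have the same type. -/
lemma sigma2_same_sign (hnd : ∀ u, IsC1 u → sigma1 f u = 0 → sigma2 f hf u ≠ 0) {V W : C0}
    (hV : V ∈ closure {V | IsC1 V}) (hW : W ∈ closure {V | IsC1 V})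
    (hV0 : sigma1 f ((psiEquiv hf hproper).symm V) = 0)
    (hW0 : sigma1 f ((psiEquiv hf hproper).symm W) = 0)
    (hVp : 0 < sigma2 f hf ((psiEquiv hf hproper).symm V)) :
    0 ≤ sigma2 f hf ((psiEquiv hf hproper).symm W) := by
  by_contra! hneg
  obtain ⟨u, hu, hu1, hu2⟩ := exists_isC1_critical hf hproper hV hV0 (s := 1) (by simpa using hVp)
  obtain ⟨v, hv, hv1, hv2⟩ := exists_isC1_critical hf hproper hW hW0 (s := -1) (by simpa using hneg)
  obtain ⟨w, hw, hw1, hw2⟩ := exists_common_zero hf hu hv hu1 hv1 (by simpa using hu2)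
    (by simpa using hv2)
  exact hnd w hw hw1 hw2

end CriticalPoints

/-! ### Behaviour at infinity -/

lemma preconnected_sign {Y : Type} [TopologicalSpace Y] {h : Y → ℝ} {A : Set Y}
    (hA : IsPreconnected A) (hc : ContinuousOn h A) (hne : ∀ y ∈ A, h y ≠ 0) {y₀ : Y} (hy₀ : y₀ ∈ A)
    (h0 : 0 < h y₀) : ∀ y ∈ A, 0 < h y := by
  intro y hy
  by_contra! hneg
  obtain ⟨z, hz, hz0⟩ := hA.intermediate_value hy hy₀ hc ⟨hneg, h0.le⟩
  exact hne z hz hz0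

/-- A function with one critical point, at which the second derivative is positive, has a global
minimum there. -/
lemma le_of_unique_critical {φ φ' : ℝ → ℝ} {x₀ A : ℝ} (hd : ∀ x, HasDerivAt φ (φ' x) x)
    (hc : Continuous φ') (h0 : ∀ x, φ' x = 0 ↔ x = x₀) (hA : HasDerivAt φ' A x₀) (hpos : 0 < A)
    (x : ℝ) : φ x₀ ≤ φ x := by
  have h00 : φ' x₀ = 0 := (h0 x₀).2 rfl
  have hslope := (hasDerivAt_iff_tendsto_slope.1 hA).eventually (lt_mem_nhds hpos)
  rw [eventually_nhdsWithin_iff] at hslope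
  obtain ⟨ρ, hρ, hslope⟩ := Metric.eventually_nhds_iff_ball.1 hslope
  have hne : ∀ y, y ≠ x₀ → φ' y ≠ 0 := fun y hy h => hy ((h0 y).1 h)
  have hright : ∀ y ∈ Ioi x₀, 0 < φ' y := by
    refine preconnected_sign (y₀ := x₀ + ρ / 2) isPreconnected_Ioi hc.continuousOn
      (fun y hy => hne y (ne_of_gt hy)) (by simp [hρ]) ?_
    have h1 := hslope (x₀ + ρ / 2) (by simp [abs_of_pos hρ, hρ]) (by simp [hρ.ne'])
    rw [slope_def_field, h00, sub_zero, add_sub_cancel_left] at h1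
    exact (div_pos_iff_of_pos_right (by positivity)).1 h1
  have hleft : ∀ y ∈ Iio x₀, 0 < -φ' y := by
    refine preconnected_sign (y₀ := x₀ - ρ / 2) isPreconnected_Iio hc.neg.continuousOn
      (fun y hy => neg_ne_zero.2 (hne y (ne_of_lt hy))) (by simp [hρ]) ?_
    have h1 := hslope (x₀ - ρ / 2) (by simp [abs_of_pos hρ, hρ]) (by simp [hρ.ne'])
    rw [slope_def_field, h00, sub_zero, sub_sub_cancel_left, div_neg, ← neg_div] at h1
    exact (div_pos_iff_of_pos_right (by positivity)).1 h1
  have hcφ : Continuous φ := continuous_iff_continuousAt.2 fun y => (hd y).continuousAt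
  rcases le_total x₀ x with h | h
  · refine monotoneOn_of_deriv_nonneg (convex_Ici x₀) hcφ.continuousOn
      (fun y _ => (hd y).differentiableAt.differentiableWithinAt) (fun y hy => ?_) self_mem_Ici h h
    rw [(hd y).deriv]
    rw [interior_Ici] at hy
    exact (hright y hy).le
  · refine antitoneOn_of_deriv_nonpos (convex_Iic x₀) hcφ.continuousOn
      (fun y _ => (hd y).differentiableAt.differentiableWithinAt) (fun y hy => ?_) h self_mem_Iic h
    rw [(hd y).deriv]
    rw [interior_Iic] at hy
    linarith [hleft y hy]

lemma abs_apply_le_norm (V : C0) (t : UnitAddCircle) : |V t| ≤ ‖V‖ := V.norm_coe_le_norm t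

/-- If the average is bounded below along one line of constants, `f` is positive at both ends. -/
lemma exists_pos_of_bounded_below (hf : IsSmooth f) (hproper : IsProperMap f) {s : ℝ}
    (hs : s = 1 ∨ s = -1) {V : C0} {L : ℝ} (hL : ∀ x : ℝ, L ≤ s * avg hf hproper (V + x • 1)) :
    ∃ R, ∀ t x, R < |x| → 0 < s * f (t, x) := by
  have hsabs : |s| = 1 := by rcases hs with rfl | rfl <;> simp
  obtain ⟨R, hR⟩ := exists_bound_of_proper hproper |L|
  have hbig : ∀ t x, R < |x| → |L| < |s * f (t, x)| := fun t x hx => by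
    rw [abs_mul, hsabs, one_mul]
    by_contra! h
    exact (hR t x h).not_gt hx
  have hne : ∀ t x, R < |x| → s * f (t, x) ≠ 0 := fun t x hx h => by
    have := hbig t x hx
    rw [h, abs_zero] at this
    exact (abs_nonneg L).not_gt this
  have hc : Continuous fun p : UnitAddCircle × ℝ => s * f p := by fun_prop
  -- Beyond `R`, `|f|` exceeds `|L|`, so a value of `s * f` that is at least `L` must be positive.
  -- Each average along the line is such a value, and connectedness of the two half cylinders, on
  -- which `f ≠ 0`, spreads the sign.
  have hpt : ∀ x t, s * avg hf hproper (V + x • 1) = s * f (t, (V + x • (1 : C0)) t) →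
      R < |V t + x| → 0 < s * f (t, V t + x) := fun x t h hx => by
    have e : (V + x • (1 : C0)) t = V t + x := by simp
    rw [e] at h
    have h1 := hL x
    rw [h] at h1
    by_contra! h2
    have h3 := hbig t _ hx
    rw [abs_of_nonpos h2] at h3
    linarith [neg_abs_le L]
  have hconn : IsPreconnected (univ : Set UnitAddCircle) := isPreconnected_univ
  have hRpos : ∀ t, ∀ x, 0 ≤ x → |R| + ‖V‖ < x → R < |V t + x| ∧ |R| < V t + x := fun t x _ hx => by
    have h1 := (abs_le.1 (abs_apply_le_norm V t)).1
    have h2 : |R| < V t + x := by linarith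
    exact ⟨(le_abs_self R).trans_lt (h2.trans_le (le_abs_self _)), h2⟩
  have hRneg : ∀ t, ∀ x, |R| + ‖V‖ < -x → R < |V t + x| ∧ V t + x < -|R| := fun t x hx => by
    have h1 := (abs_le.1 (abs_apply_le_norm V t)).2
    have h2 : V t + x < -|R| := by linarith
    refine ⟨(le_abs_self R).trans_lt ?_, h2⟩
    rw [abs_of_neg (a := V t + x) (by linarith [abs_nonneg R])]
    linarith
  have h0 : 0 ≤ |R| + ‖V‖ := by positivity
  have htop : ∀ p ∈ (univ : Set UnitAddCircle) ×ˢ Ioi |R|, 0 < s * f p := by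
    obtain ⟨t, ht⟩ := exists_avg_eq hf hproper (V + (|R| + ‖V‖ + 1) • 1)
    obtain ⟨h1, h2⟩ := hRpos t (|R| + ‖V‖ + 1) (by linarith) (by linarith)
    refine preconnected_sign (hconn.prod isPreconnected_Ioi) hc.continuousOn (fun p hp => ?_)
      (y₀ := (t, V t + (|R| + ‖V‖ + 1))) ⟨mem_univ _, h2⟩ (hpt _ t (by rw [ht]) h1)
    exact hne p.1 p.2 ((le_abs_self R).trans_lt (lt_of_lt_of_le hp.2 (le_abs_self _)))
  have hbot : ∀ p ∈ (univ : Set UnitAddCircle) ×ˢ Iio (-|R|), 0 < s * f p := by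
    obtain ⟨t, ht⟩ := exists_avg_eq hf hproper (V + (-(|R| + ‖V‖ + 1)) • 1)
    obtain ⟨h1, h2⟩ := hRneg t (-(|R| + ‖V‖ + 1)) (by linarith)
    refine preconnected_sign (hconn.prod isPreconnected_Iio) hc.continuousOn (fun p hp => ?_)
      (y₀ := (t, V t + -(|R| + ‖V‖ + 1))) ⟨mem_univ _, h2⟩ (hpt _ t (by rw [ht]) h1)
    have h3 : p.2 < -|R| := hp.2
    refine hne p.1 p.2 ((le_abs_self R).trans_lt ?_)
    linarith [neg_le_abs p.2]
  refine ⟨|R|, fun t x hx => ?_⟩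
  rcases lt_abs.1 hx with h | h
  · exact htop (t, x) ⟨mem_univ _, h⟩
  · exact hbot (t, x) ⟨mem_univ _, by simp only [mem_Iio]; linarith⟩

lemma exists_lt_avg (hf : IsSmooth f) (hproper : IsProperMap f) {s : ℝ} (hs : s = 1 ∨ s = -1)
    {R : ℝ} (hR : ∀ t x, R < |x| → 0 < s * f (t, x)) (V : C0) (M : ℝ) :
    ∃ R', ∀ x : ℝ, R' < |x| → M < s * avg hf hproper (V + x • 1) := by
  have hsabs : |s| = 1 := by rcases hs with rfl | rfl <;> simp
  obtain ⟨R₁, hR₁⟩ := exists_bound_of_proper hproper M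
  refine ⟨max R R₁ + ‖V‖, fun x hx => ?_⟩
  obtain ⟨t, ht⟩ := exists_avg_eq hf hproper (V + x • 1)
  have e : (V + x • (1 : C0)) t = V t + x := by simp
  rw [e] at ht
  rw [ht]
  have h1 : max R R₁ < |V t + x| := by
    have h2 := abs_sub (V t + x) (V t)
    rw [add_sub_cancel_left] at h2
    linarith [abs_apply_le_norm V t]
  have h3 := hR t _ ((le_max_left _ _).trans_lt h1)
  have h4 : M < |f (t, V t + x)| := by
    by_contra! h
    exact (hR₁ t _ h).not_gt ((le_max_right _ _).trans_lt h1)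
  rw [← abs_of_pos h3, abs_mul, hsabs, one_mul]
  exact h4

/-! ### The global fold -/

/-- The main theorem for an operator which, in global coordinates, is the average as a function of a
datum `V = K q + x`, where the range of `K`, together with the constants, contains the continuously
differentiable functions as a dense subset. -/
theorem isGlobalFold_of_coordinates (hf : IsSmooth f) (hproper : IsProperMap f)
    {X E F : Type} [NormedAddCommGroup X] [NormedSpace ℝ X] [CompleteSpace X]
    [NormedAddCommGroup E] [NormedSpace ℝ E] [NormedAddCommGroup F] [NormedSpace ℝ F]
    {G : E → F} (K : X →L[ℝ] C0) (hK : ∀ V, IsC1 V → ∃ x : ℝ, ∃ q, V = K q + x • 1)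
    (hdense : ∀ (x : ℝ) q, K q + x • 1 ∈ closure {V | IsC1 V})
    (e : E ≃ ℝ × X) (he : ContDiff ℝ ∞ e) (hes : ContDiff ℝ ∞ e.symm) (δ : F ≃L[ℝ] ℝ × X)
    (hG : ∀ x q, δ (G (e.symm (x, q))) = (avg hf hproper (K q + x • 1), q))
    (hcrit : ∃ u, IsCriticalPoint G u) (hfold : ∀ u, IsCriticalPoint G u → IsFold G u) :
    IsGlobalFold X G := by
  let c : ℝ × X → ℝ := fun p => avg hf hproper (K p.2 + p.1 • 1)
  have hc : ContDiff ℝ ∞ c := (contDiff_avg hf hproper).comp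
    ((K.contDiff.comp contDiff_snd).add (contDiff_fst.smul contDiff_const))
  have hpd : ∀ x q, pd c (x, q) = avgSlope hf hproper (K q + x • 1) := fun x q =>
    (hasDerivAt_pd hc x q).unique (hasDerivAt_avg hf hproper (K q) x)
  let u : ℝ → X → C0 := fun x q => (psiEquiv hf hproper).symm (K q + x • 1)
  have hpd0 : ∀ x q, pd c (x, q) = 0 ↔ sigma1 f (u x q) = 0 := fun x q => by
    rw [hpd, avgSlope_eq_zero_iff]
  let I : ℝ → X → ℝ := fun x q => expWeight (nemytskii (partialX f hf) (u x q))
  have hI : ∀ x q, 0 < I x q := fun x q => expWeight_pos _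
  have hpd2 : ∀ x q, pd c (x, q) = 0 → pd (pd c) (x, q) = sigma2 f hf (u x q) / I x q :=
    fun x q h => by
      have h1 := hasDerivAt_pd (contDiff_pd hc) x q
      simp only [hpd] at h1
      exact h1.unique (hasDerivAt_avgSlope hf hproper ((hpd0 x q).1 h))
  have hnd : ∀ x q, sigma1 f (u x q) = 0 → sigma2 f hf (u x q) ≠ 0 := fun x q h => by
    have h0 := (hpd0 x q).2 h
    have h1 := IsFold.pd_pd_ne_zero hc e he hes δ hG
      (hfold _ ((isCriticalPoint_iff_pd_eq_zero hc e he hes δ hG x q).2 h0)) h0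
    rw [hpd2 x q h0] at h1
    exact fun h2 => h1 (by rw [h2, zero_div])
  -- `psi f` sends `C¹` functions to `C¹` functions, which `hK` expresses in coordinates; so
  -- nondegeneracy reaches every `C¹` zero of `Σ₁`.
  have hndC1 : ∀ v, IsC1 v → sigma1 f v = 0 → sigma2 f hf v ≠ 0 := fun v hv h0 => by
    obtain ⟨x, q, hxq⟩ := hK (psi f v) (hv.add (isC1_prim _))
    have h1 : u x q = v := by
      simp only [u]
      rw [← hxq, psi_symm_apply]
    rw [← h1] at h0 ⊢
    exact hnd x q h0
  obtain ⟨u₀, hu₀⟩ := hcrit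
  obtain ⟨⟨x₀, q₀⟩, rfl⟩ := e.symm.surjective u₀
  have h00 : pd c (x₀, q₀) = 0 := (isCriticalPoint_iff_pd_eq_zero hc e he hes δ hG x₀ q₀).1 hu₀
  have h01 := (hpd0 x₀ q₀).1 h00
  obtain ⟨s, hs, hs0⟩ : ∃ s : ℝ, (s = 1 ∨ s = -1) ∧ 0 < s * sigma2 f hf (u x₀ q₀) := by
    rcases lt_or_gt_of_ne (hnd x₀ q₀ h01) with h | h
    · exact ⟨-1, Or.inr rfl, by linarith⟩
    · exact ⟨1, Or.inl rfl, by linarith⟩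
  have hss : s * s = 1 := by rcases hs with rfl | rfl <;> norm_num
  have hsign : ∀ x q, sigma1 f (u x q) = 0 → 0 < s * sigma2 f hf (u x q) := fun x q h => by
    have hne := hnd x q h
    rcases hs with rfl | rfl
    · rw [one_mul] at hs0 ⊢
      exact lt_of_le_of_ne (sigma2_same_sign hf hproper hndC1 (hdense x₀ q₀) (hdense x q) h01 h hs0)
        hne.symm
    · by_contra! h2
      have h3 : 0 < sigma2 f hf (u x q) := lt_of_le_of_ne (by linarith) hne.symm
      have h4 := sigma2_same_sign hf hproper hndC1 (hdense x q) (hdense x₀ q₀) h h01 h3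
      change 0 ≤ sigma2 f hf (u x₀ q₀) at h4
      linarith
  let c' : ℝ × X → ℝ := fun p => s * c p
  have hc' : ContDiff ℝ ∞ c' := contDiff_const.mul hc
  have hpd' : ∀ x q, pd c' (x, q) = s * pd c (x, q) := fun x q =>
    (hasDerivAt_pd hc' x q).unique ((hasDerivAt_pd hc x q).const_mul s)
  have hsne : s ≠ 0 := by rcases hs with rfl | rfl <;> norm_num
  have hpd0' : ∀ x q, pd c' (x, q) = 0 ↔ pd c (x, q) = 0 := fun x q => by
    rw [hpd', mul_eq_zero, or_iff_right hsne]
  have hpd2' : ∀ x q, pd c' (x, q) = 0 → 0 < pd (pd c') (x, q) := fun x q h => by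
    have h0 := (hpd0' x q).1 h
    have h1 : pd (pd c') (x, q) = s * pd (pd c) (x, q) := by
      have h2 := hasDerivAt_pd (contDiff_pd hc') x q
      simp only [hpd'] at h2
      exact h2.unique ((hasDerivAt_pd (contDiff_pd hc) x q).const_mul s)
    rw [h1, hpd2 x q h0, ← mul_div_assoc]
    exact div_pos (hsign x q ((hpd0 x q).1 h0)) (hI x q)
  -- Between two zeros of the derivative there would be one at which the second derivative is not
  -- positive.
  have huniq : ∀ q x y, pd c' (x, q) = 0 → pd c' (y, q) = 0 → x = y := by
    have key : ∀ q x y, pd c' (x, q) = 0 → pd c' (y, q) = 0 → ¬ x < y := fun q x y hx hy hxy => by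
      obtain ⟨z, -, hz0, hz⟩ := exists_zero_deriv_nonpos hxy
        (fun z => hasDerivAt_pd (contDiff_pd hc') z q) hx hy
      exact (hpd2' z q hz0).not_ge hz
    intro q x y hx hy
    exact le_antisymm (not_lt.1 (key q y x hy hx)) (not_lt.1 (key q x y hx hy))
  have hcritical₀ : pd c' (x₀, q₀) = 0 := (hpd0' _ _).2 h00
  -- The one fibre known to have a critical point is bounded below. The resulting positivity of `s *
  -- f` far out does not depend on `q` and makes every fibre coercive.
  obtain ⟨R, hR⟩ := exists_pos_of_bounded_below hf hproper hs (V := K q₀)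
    (L := c' (x₀, q₀)) (le_of_unique_critical (fun x => hasDerivAt_pd hc' x q₀)
      ((contDiff_pd hc').continuous.comp (Continuous.prodMk_left q₀))
      (fun x => ⟨fun h => huniq q₀ x x₀ h hcritical₀, fun h => h ▸ hcritical₀⟩)
      (hasDerivAt_pd (contDiff_pd hc') x₀ q₀) (hpd2' _ _ hcritical₀))
  have htop : ∀ q, Filter.Tendsto (fun x => c' (x, q)) Filter.atTop Filter.atTop := fun q => by
    refine Filter.tendsto_atTop.2 fun M => ?_
    obtain ⟨R', hR'⟩ := exists_lt_avg hf hproper hs hR (K q) M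
    filter_upwards [Filter.eventually_gt_atTop R'] with x hx
    exact (hR' x (hx.trans_le (le_abs_self x))).le
  have hbot : ∀ q, Filter.Tendsto (fun x => c' (x, q)) Filter.atBot Filter.atTop := fun q => by
    refine Filter.tendsto_atTop.2 fun M => ?_
    obtain ⟨R', hR'⟩ := exists_lt_avg hf hproper hs hR (K q) M
    filter_upwards [Filter.eventually_lt_atBot (-R')] with x hx
    exact (hR' x (by linarith [neg_le_abs x])).le
  have hex : ∀ q, ∃ x, pd c' (x, q) = 0 := fun q => by
    have hcont : Continuous fun x => c' (x, q) := hc'.continuous.comp (Continuous.prodMk_left q)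
    obtain ⟨z, hz⟩ := hcont.exists_forall_le (by
      rw [cocompact_eq_atBot_atTop]
      exact (hbot q).sup (htop q))
    exact ⟨z, IsLocalMin.hasDerivAt_eq_zero (Filter.Eventually.of_forall hz)
      (hasDerivAt_pd hc' z q)⟩
  choose m hm using hex
  refine isGlobalFold_of_family hc' (m := m)
    (fun x q => ⟨fun h => huniq q x (m q) h (hm q), fun h => h ▸ hm q⟩)
    (fun q => hpd2' _ _ (hm q)) htop hbot e he hes δ hss fun x q => ?_
  rw [hG, ← mul_assoc, hss, one_mul]

/-! ### Coordinates for the operators on `C¹` and `H¹` -/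

lemma prim_one : prim 1 = 0 := by
  ext t
  have h := (eq_prim_of_hasDerivAt (y := 0) (n := 1) (k := 1) fun r => by
    simpa using hasDerivAt_const r (0 : ℝ)).2 t
  simpa using h.symm

lemma contDiff_subtype_val {E : Type} [NormedAddCommGroup E] [NormedSpace ℝ E]
    (W : Submodule ℝ E) : ContDiff ℝ ∞ (Subtype.val : W → E) :=
  W.subtypeL.contDiff

lemma contDiff_to_submodule {E E' : Type} [NormedAddCommGroup E] [NormedSpace ℝ E]
    [NormedAddCommGroup E'] [NormedSpace ℝ E'] {W : Submodule ℝ E} (L : E' →L[ℝ] W) :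
    ContDiff ℝ ∞ L :=
  L.contDiff

/-- A global fold criterion for `u ↦ u' + f (t, u)` on a space `W` of pairs `(u, u')`, where `u'`
ranges over a space `B` in which the continuous functions are dense: `m` is the average on `B`, and
`J` integrates the elements of `B` of average zero. -/
theorem isGlobalFold_operator {f : C(UnitAddCircle × ℝ, ℝ)} (hf : IsSmooth f)
    (hproper : IsProperMap f) {B : Type} [NormedAddCommGroup B] [NormedSpace ℝ B] [CompleteSpace B]
    (ι : C0 →L[ℝ] B) (hι : DenseRange ι) (m : B →L[ℝ] ℝ) (hm : ∀ v, m (ι v) = meanC v)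
    (J : B →L[ℝ] C0) (hJ : ∀ v, J (ι v) = prim v) (hJ0 : ∀ v, J v 0 = 0)
    (X : Submodule ℝ B) (hX : ∀ v, v ∈ X ↔ m v = 0) (W : Submodule ℝ (C0 × B))
    (hW : ∀ p, p ∈ W ↔ m p.2 = 0 ∧ p.1 = p.1 0 • 1 + J p.2) {G : W → B}
    (hG : ∀ u, G u = u.1.2 + ι (nemytskii f u.1.1))
    (hcrit : ∃ u, IsCriticalPoint G u) (hfold : ∀ u, IsCriticalPoint G u → IsFold G u) :
    IsGlobalFold X G := by
  have hclosed : IsClosed (X : Set B) := by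
    have : (X : Set B) = m ⁻¹' {0} := by
      ext v
      exact hX v
    rw [this]
    exact isClosed_singleton.preimage m.continuous
  have : CompleteSpace X := hclosed.completeSpace_coe
  have hm1 : m (ι 1) = 1 := by rw [hm, meanC_one]
  have hJ1 : J (ι 1) = 0 := by rw [hJ, prim_one]
  -- The projection onto average zero along the constants.
  let P : B →L[ℝ] X := (ContinuousLinearMap.id ℝ B - m.smulRight (ι 1)).codRestrict X fun v => by
    rw [hX]
    simp [hm1]
  have hP : ∀ v, (P v : B) = v - m v • ι 1 := fun v => rfl
  have hPX : ∀ q : X, P q = q := fun q => by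
    ext1
    rw [hP, (hX _).1 q.2, zero_smul, sub_zero]
  have hJP : ∀ v, J (P v) = J v := fun v => by
    rw [hP, map_sub, map_smul, hJ1, smul_zero, sub_zero]
  have hmX : ∀ q : X, m q = 0 := fun q => (hX _).1 q.2
  let L : ℝ × X →L[ℝ] W :=
    (((ContinuousLinearMap.fst ℝ ℝ X).smulRight (1 : C0) +
      (J.comp X.subtypeL).comp (ContinuousLinearMap.snd ℝ ℝ X)).prod
      (X.subtypeL.comp (ContinuousLinearMap.snd ℝ ℝ X))).codRestrict W fun a => by
        rw [hW]
        simp [hJ0, hmX]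
  have hL1 : ∀ a, (L a).1.1 = a.1 • 1 + J a.2 := fun a => rfl
  have hL2 : ∀ a, (L a).1.2 = a.2 := fun a => rfl
  let w : ℝ × X → C0 := fun a => (psiEquiv hf hproper).symm (J a.2 + a.1 • 1)
  have hw : ∀ a, w a + prim (nemytskii f (w a)) = J a.2 + a.1 • 1 := fun a =>
    (psiEquiv hf hproper).apply_symm_apply _
  have hw0 : ∀ a, w a 0 = a.1 := fun a => by
    simpa [prim_zero, hJ0] using DFunLike.congr_fun (hw a) 0
  have hLw : ∀ a, (L (a.1, P (a.2 - ι (nemytskii f (w a))))).1.1 = w a := fun a => by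
    rw [hL1, hJP, map_sub J, hJ]
    refine Eq.trans ?_ (eq_sub_of_add_eq (hw a)).symm
    abel
  -- The coordinates of `u` are `u 0` and the part of `G u` of average zero. Conversely, `w` solves
  -- the integral equation with these data, and the derivative of `u` is recovered as `q` minus the
  -- oscillating part of `f (t, w)`.
  let e : W ≃ ℝ × X :=
    { toFun := fun u => (u.1.1 0, P (u.1.2 + ι (nemytskii f u.1.1)))
      invFun := fun a => L (a.1, P (a.2 - ι (nemytskii f (w a))))
      left_inv := fun u => by
        obtain ⟨h0, h1⟩ := (hW _).1 u.2
        have hu : w (u.1.1 0, P (u.1.2 + ι (nemytskii f u.1.1))) = u.1.1 := by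
          rw [Equiv.symm_apply_eq]
          change _ = u.1.1 + prim (nemytskii f u.1.1)
          rw [hJP, map_add, hJ, add_right_comm, add_comm (J _), ← h1]
        have hs : P (P (u.1.2 + ι (nemytskii f u.1.1)) - ι (nemytskii f u.1.1) : B)
            = ⟨u.1.2, (hX _).2 h0⟩ := by
          rw [map_sub, hPX, map_add, add_sub_cancel_right]
          exact hPX ⟨u.1.2, _⟩
        ext1
        refine Prod.ext ?_ ?_
        · rw [hL1, hu, hs]
          exact h1.symm
        · rw [hL2, hu, hs]
      right_inv := fun a => by
        refine Prod.ext ?_ ?_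
        · change (L _).1.1 0 = _
          rw [hLw, hw0]
        · change P ((L _).1.2 + ι (nemytskii f (L _).1.1)) = _
          rw [hLw, hL2, map_add, hPX, ← map_add, sub_add_cancel, hPX] }
  have hwsmooth : ContDiff ℝ ∞ w := (contDiff_psi_symm hf hproper).comp
    ((J.contDiff.comp (X.subtypeL.contDiff.comp contDiff_snd)).add
      (contDiff_fst.smul contDiff_const))
  let δ : B ≃L[ℝ] ℝ × X := ContinuousLinearEquiv.equivOfInverse (m.prod P)
    ((ContinuousLinearMap.fst ℝ ℝ X).smulRight (ι 1) +
      X.subtypeL.comp (ContinuousLinearMap.snd ℝ ℝ X))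
    (fun v => by simp [hP]) (fun a => by
      refine Prod.ext ?_ ?_
      · simp [hm1, hmX]
      · ext1
        simp [hP, hm1, hmX])
  refine isGlobalFold_of_coordinates hf hproper (J.comp X.subtypeL) (fun V hV => ?_) (fun x q => ?_)
    e ?_ ?_ δ (fun x q => ?_) hcrit hfold
  · obtain ⟨V', hV'⟩ := hV
    obtain ⟨h0, h1⟩ := eq_prim_of_hasDerivAt (y := V) (n := V') (k := 0) (by simpa using hV')
    refine ⟨V 0, ⟨ι V', (hX _).2 (by rw [hm, h0])⟩, ?_⟩
    ext t
    change V t = J (ι V') t + V 0 * 1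
    rw [h1 t, hJ, mul_one, add_comm]
  -- `J` sends the dense image of `C⁰` to `C¹` functions, and it is continuous.
  · refine closure_mono (s := (fun v => J v + x • 1) '' range ι) ?_ ?_
    · rintro _ ⟨_, ⟨p, rfl⟩, rfl⟩
      change IsC1 (J (ι p) + x • 1)
      rw [hJ]
      exact (isC1_prim p).add (isC1_one.smul x)
    · exact image_closure_subset_closure_image (J.continuous.add continuous_const)
        ⟨q, hι q, rfl⟩
  · have hsub : ContDiff ℝ ∞ fun u : W => u.1 := contDiff_subtype_val W
    have heval : ContDiff ℝ ∞ fun u : C0 => u 0 :=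
      (ContinuousMap.evalCLM ℝ (0 : UnitAddCircle) : C0 →L[ℝ] ℝ).contDiff
    exact (heval.comp hsub.fst).prodMk (P.contDiff.comp (hsub.snd.add
      (ι.contDiff.comp ((contDiff_nemytskii hf).comp hsub.fst))))
  · exact (contDiff_to_submodule L).comp (contDiff_fst.prodMk (P.contDiff.comp
      ((X.subtypeL.contDiff.comp contDiff_snd).sub
        (ι.contDiff.comp ((contDiff_nemytskii hf).comp hwsmooth)))))
  · have hGe : G (e.symm (x, q)) = (P (q - ι (nemytskii f (w (x, q)))) : B)
        + ι (nemytskii f (w (x, q))) := by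
      rw [hG]
      change (L _).1.2 + ι (nemytskii f (L _).1.1) = _
      rw [hLw, hL2]
    rw [hGe]
    refine Prod.ext ?_ ?_
    · change m _ = _
      rw [map_add, hmX, zero_add, hm]
      rfl
    · change P _ = _
      rw [map_add, hPX, ← map_add, sub_add_cancel, hPX]

lemma mem_C1_iff (p : C0 × C0) : p ∈ C1 ↔ meanC p.2 = 0 ∧ p.1 = p.1 0 • 1 + prim p.2 := by
  constructor
  · intro hp
    obtain ⟨h0, h1⟩ := eq_prim_of_hasDerivAt (y := p.1) (n := p.2) (k := 0) fun r => by
      simpa using hp r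
    refine ⟨h0.symm, ?_⟩
    ext t
    simpa using h1 t
  · rintro ⟨h0, h1⟩ s
    rw [h1]
    simpa [h0] using (hasDerivAt_prim p.2 s).const_add (p.1 0)

/-- Taking `r = 1` in the definition of `H1`, periodicity of `p.1` forces average zero; the linear
term of `primH` then disappears. -/
lemma mem_H1_iff (p : C0 × H0) : p ∈ H1 ↔ meanH p.2 = 0 ∧ p.1 = p.1 0 • 1 + primH p.2 := by
  constructor
  · intro hp
    have h1 := hp 1 (by simp)
    have h0 : meanH p.2 = 0 := by
      rw [coe_one_eq_zero] at h1
      rw [meanH_apply, ← intervalIntegral_circle]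
      linarith
    refine ⟨h0, C0_ext fun r hr => ?_⟩
    have := hp r hr
    change _ = p.1 0 * 1 + primH p.2 r
    rw [primH_coe, h0, this]
    ring
  · rintro ⟨h0, h1⟩ r hr
    have h2 : p.1 r = p.1 0 * 1 + primH p.2 r :=
      congrArg (fun v : C0 => v (r : UnitAddCircle)) h1
    rw [h2, primH_coe, h0]
    ring

end

end PeriodicFirstOrder

/-- Let `f : S¹ × ℝ → ℝ` be smooth and proper. In the `C` case (`F : C¹(S¹) → C⁰(S¹)`) and in the
`H` case (`F : H¹(S¹) → L²(S¹)`): if `0` is a regular value of `Σ₁`, `F` has a critical point and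
every critical point of `F` is a fold, then `F` is a smooth global fold. -/
theorem theorem4p5 (f : C(UnitAddCircle × ℝ, ℝ)) (hf : IsSmooth f) (hproper : IsProperMap f) :
    (IsRegularValue (fun u : C1 => sigma1 f u.1.1) 0 →
      (∃ u : C1, IsCriticalPoint (operatorC f) u) →
      (∀ u : C1, IsCriticalPoint (operatorC f) u → IsFold (operatorC f) u) →
      IsGlobalFold C0tilde (operatorC f)) ∧
    (IsRegularValue (fun u : H1 => sigma1 f u.1.1) 0 →
      (∃ u : H1, IsCriticalPoint (operatorH f) u) →
      (∀ u : H1, IsCriticalPoint (operatorH f) u → IsFold (operatorH f) u) →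
      IsGlobalFold H0tilde (operatorH f)) := by
  refine ⟨fun _ hcrit hfold => ?_, fun _ hcrit hfold => ?_⟩
  · exact isGlobalFold_operator hf hproper (ContinuousLinearMap.id ℝ C0)
      Function.surjective_id.denseRange meanC (fun _ => rfl) prim (fun _ => rfl) prim_zero C0tilde
      (fun v => by rw [meanC_apply]; rfl) C1 mem_C1_iff (fun _ => rfl) hcrit hfold
  · exact isGlobalFold_operator hf hproper inclH
      (ContinuousMap.toLp_denseRange ℝ volume ℝ (by norm_num)) meanH (fun _ => rfl) primH
      (fun _ => rfl) primH_zero H0tilde (fun _ => Iff.rfl) H1 mem_H1_iff (fun _ => rfl) hcrit hfold
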